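/- Let $n\ge 2$, $\alpha>0$, let $\ell$ be an integer with $\ell>\alpha$, $b\in(-1,1)$, $1<p\le\infty$, $1/p+1/p'=1$ (so $p'=1$ if $p=\infty$) and $\mu<n/(2p')$. Let $S^n$ be the unit sphere of $\mathbb R^{n+1}$ with its surface measure $dx$, $\langle a,b\rangle_S=\{x\in S^n: a<x_{n+1}<b\}$, and let $\sigma_{n-1}=2\pi^{n/2}/\Gamma(n/2)$. For a function $\varphi$ on the cap $\langle -1,b\rangle_S$ put $$(S^\alpha_{b-}\varphi)(x)=\frac{2}{\Gamma(\alpha)\,\sigma_{n-1}}\int_{\langle x_{n+1},b\rangle_S}\frac{(y_{n+1}-x_{n+1})^\alpha}{|x-y|^n}\,\varphi(y)\,dy,\qquad x\in\langle -1,b\rangle_S .$$ Write $x\in S^n\setminus\{\pm e_{n+1}\}$ in polar coordinates $x=(\theta,\xi')$, i.e. $x=(\xi'\sin\theta,-\cos\theta)$ with $0<\theta<\pi$, $\xi'\in S^{n-1}$, and put $s=\tan^2(\theta/2)$. For $\psi$ on $S^{n-1}$ let $$\Pi[\psi](r,\xi')=\frac1{\sigma_{n-1}}\int_{S^{n-1}}\frac{1-r^2}{|r\xi'-\eta'|^n}\,\psi(\eta')\,d\eta',\qquad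 0\le r<1,$$ be its Poisson integral. For $f:S^n\to\mathbb C$ and $u\le 0$ let $$(A^-_xf)(u)=(1+s-u)^{\alpha-n/2}\;\Pi\big[f(2\arctan\sqrt{s-u},\,\cdot\,)\big]\big((1-u/s)^{-1/2},\xi'\big)\ \ (u<0),\qquad (A^-_xf)(0)=(1+s)^{\alpha-n/2}f(x),$$ and for $\varepsilon>0$ let $$(T^\alpha_{-,\varepsilon}f)(x)=\frac{2^{-\alpha}}{\varkappa(\alpha,\ell)}\,(1+s)^{\alpha+n/2}\int_\varepsilon^\infty\frac{1}{\tau^{1+\alpha}}\sum_{j=0}^{\ell}\binom{\ell}{j}(-1)^j(A^-_xf)(-j\tau)\,d\tau,\qquad \varkappa(\alpha,\ell)=\int_0^\infty\frac{(1-e^{-\tau})^\ell}{\tau^{1+\alpha}}\,d\tau .$$ For $f$ on the cap $\langle -1,b\rangle_S$ let $T^\alpha_{b-,\varepsilon}f=P_{b-}T^\alpha_{-,\varepsilon}\Lambda_{b+}f$, where $\Lambda_{b+}$ extends $f$ by zero to the rest of $S^n$ and $P_{b-}$ restricts functions on $S^n$ to $\langle -1,b\rangle_S$. Suppose that $\varphi\in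 L^p(\langle -1,b\rangle_S;(1+x_{n+1})^\mu)$, i.e. $(1+x_{n+1})^\mu\varphi\in L^p(\langle -1,b\rangle_S)$, with complex values. Then for almost every $x\in\langle -1,b\rangle_S$ all these integrals exist in the Lebesgue sense, that is: the integral $(S^\alpha_{b-}\varphi)(x)$ converges absolutely, and, with $f=\Lambda_{b+}S^\alpha_{b-}\varphi$, the Poisson integral in $(A_x^-f)(u)$ converges absolutely for almost every $u<0$, and the integral in $(T^\alpha_{-,\varepsilon}f)(x)$ converges absolutely for every $\varepsilon>0$. Moreover, $$\lim_{\varepsilon\to0+}\big(T^\alpha_{b-,\varepsilon}S^\alpha_{b-}\varphi\big)(x)=\varphi(x)\qquad\text{for almost every }x\in\langle -1,b\rangle_S .$$ -/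

import Mathlib

open MeasureTheory Set Filter Topology
open scoped ENNReal

namespace SphFrac

/-- The unit sphere of the Euclidean space of dimension `d`. Thus `USphere (n + 1)` is the sphere
`S^n` and `USphere n` is the sphere `S^(n-1)`. -/
abbrev USphere (d : ℕ) : Type :=
  ↥(Metric.sphere (0 : EuclideanSpace ℝ (Fin d)) 1)

/-- The standard surface area measure of the unit sphere. -/
noncomputable abbrev surf (d : ℕ) : Measure (USphere d) :=
  (volume : Measure (EuclideanSpace ℝ (Fin d))).toSphere

/-- The surface area `2 π^(d/2) / Γ(d/2)` of the unit sphere of the Euclidean space of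
dimension `d`. -/
noncomputable def area (d : ℕ) : ℝ :=
  2 * Real.pi ^ ((d : ℝ) / 2) / Real.Gamma ((d : ℝ) / 2)

/-- The last coordinate of a point of `S^n`. -/
def lastCoord {n : ℕ} (x : USphere (n + 1)) : ℝ :=
  (x : EuclideanSpace ℝ (Fin (n + 1))) (Fin.last n)

/-- The open spherical segment of the points of `S^n` with last coordinate in `(a, b)`. -/
def segS (n : ℕ) (a b : ℝ) : Set (USphere (n + 1)) :=
  {x | a < lastCoord x ∧ lastCoord x < b}

/-- The surface area measure on a spherical segment. -/
noncomputable def segMeasure (n : ℕ) (a b : ℝ) : Measure (segS n a b) :=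
  (surf (n + 1)).comap Subtype.val

/-- Membership in the weighted space `L^p(Ω; w)`, that is, `w f ∈ L^p(Ω)`. -/
def MemWeightedLp {X : Type*} [MeasurableSpace X] (m : Measure X) (p : ℝ≥0∞) (w : X → ℝ)
    (f : X → ℂ) : Prop :=
  MemLp (fun x => (w x : ℂ) * f x) p m

/-! ### One-sided fractional integrals on spherical segments -/

/-- The integrand of the right-sided spherical fractional integral. -/
noncomputable def rightIntegrand {n : ℕ} {a b : ℝ} (α : ℝ) (φ : segS n a b → ℂ)
    (x y : segS n a b) : ℂ :=
  (((lastCoord y.1 - lastCoord x.1) ^ α /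
    ‖(x.1 : EuclideanSpace ℝ (Fin (n + 1))) - y.1‖ ^ n : ℝ) : ℂ) * φ y

/-- The part of the segment which lies above the point `x`. -/
def above {n : ℕ} {a b : ℝ} (x : segS n a b) : Set (segS n a b) :=
  {y | lastCoord x.1 < lastCoord y.1}

/-- The right-sided spherical fractional integral of order `α`. -/
noncomputable def fracRight {n : ℕ} {a b : ℝ} (α : ℝ) (φ : segS n a b → ℂ) :
    segS n a b → ℂ := fun x =>
  ((2 / (Real.Gamma α * area n) : ℝ) : ℂ) *
    ∫ y in above x, rightIntegrand α φ x y ∂(segMeasure n a b)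

/-! ### Spherical polar coordinates and the Poisson integral -/

/-- The point of `S^n` with polar coordinates `(θ, η)`, where `η ∈ S^(n-1)` and the angle `θ` is
measured from the South Pole `(0, …, 0, -1)`. -/
noncomputable def polar {n : ℕ} (θ : ℝ) (η : USphere n) : USphere (n + 1) :=
  ⟨WithLp.toLp 2 (Fin.snoc (α := fun _ => ℝ)
      (fun i => Real.sin θ * (η : EuclideanSpace ℝ (Fin n)) i) (-Real.cos θ)), by
    have h : ‖(η : EuclideanSpace ℝ (Fin n))‖ ^ 2 = 1 := by
      have := η.2
      rw [mem_sphere_zero_iff_norm] at this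
      rw [this]; norm_num
    rw [EuclideanSpace.norm_sq_eq] at h
    rw [mem_sphere_zero_iff_norm, EuclideanSpace.norm_eq, Real.sqrt_eq_one,
      Fin.sum_univ_castSucc]
    simp only [Fin.snoc_castSucc, Fin.snoc_last, Real.norm_eq_abs, sq_abs, mul_pow,
      ← Finset.mul_sum] at h ⊢
    rw [h]
    nlinarith [Real.sin_sq_add_cos_sq θ]⟩

/-- The polar angle in `[0, π]` of a point of `S^n`, measured from the South Pole. -/
noncomputable def angle {n : ℕ} (x : USphere (n + 1)) : ℝ :=
  Real.arccos (-lastCoord x)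

/-- The direction `ξ' = (x_1, …, x_n) / |(x_1, …, x_n)|` of a point of `S^n` other than the poles
(and zero at the poles). -/
noncomputable def direction {n : ℕ} (x : USphere (n + 1)) : EuclideanSpace ℝ (Fin n) :=
  let v : EuclideanSpace ℝ (Fin n) :=
    WithLp.toLp 2 (fun i => (x : EuclideanSpace ℝ (Fin (n + 1))) (Fin.castSucc i))
  ‖v‖⁻¹ • v

/-- The integrand of the Poisson integral on `S^(n-1)`. -/
noncomputable def poissonIntegrand {n : ℕ} (ψ : USphere n → ℂ) (ξ : EuclideanSpace ℝ (Fin n))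
    (r : ℝ) (η : USphere n) : ℂ :=
  (((1 - r ^ 2) / ‖r • ξ - (η : EuclideanSpace ℝ (Fin n))‖ ^ n : ℝ) : ℂ) * ψ η

/-- The Poisson integral of `ψ` at the point `r ξ`, where `|ξ| = 1` and `0 ≤ r < 1`. -/
noncomputable def poisson {n : ℕ} (ψ : USphere n → ℂ) (ξ : EuclideanSpace ℝ (Fin n))
    (r : ℝ) : ℂ :=
  ((1 / area n : ℝ) : ℂ) * ∫ η, poissonIntegrand ψ ξ r η ∂(surf n)

/-! ### Hypersingular integrals on the sphere -/

/-- The finite difference of order `l` with step `t` of the function `F` at the point `u`. -/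
noncomputable def finDiff (l : ℕ) (t : ℝ) (F : ℝ → ℂ) (u : ℝ) : ℂ :=
  ∑ j ∈ Finset.range (l + 1), (l.choose j : ℂ) * (-1) ^ j * F (u - j * t)

/-- The normalizing constant of the hypersingular integral. -/
noncomputable def kappa (α : ℝ) (l : ℕ) : ℝ :=
  ∫ t in Ioi (0 : ℝ), (1 - Real.exp (-t)) ^ l / t ^ (1 + α)

/-- `tan² (θ / 2)` for the polar angle `θ` of `x`. -/
noncomputable def tanSq {n : ℕ} (x : USphere (n + 1)) : ℝ :=
  Real.tan (angle x / 2) ^ 2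

/-- The restriction of `f` to the parallel of `S^n` whose polar angle is
`2 arctan √(tan² (θ / 2) - u)`, where `θ` is the polar angle of `x`. -/
noncomputable def onParallel {n : ℕ} (f : USphere (n + 1) → ℂ) (x : USphere (n + 1)) (u : ℝ) :
    USphere n → ℂ := fun η =>
  f (polar (2 * Real.arctan (Real.sqrt (tanSq x - u))) η)

/-- The radius `(1 - u / tan² (θ / 2))^(-1/2)` at which the Poisson integral is taken. -/
noncomputable def poissonRadius {n : ℕ} (x : USphere (n + 1)) (u : ℝ) : ℝ :=
  (1 - u / tanSq x) ^ (-(1 / 2) : ℝ)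

/-- The function `u ↦ (A_x^- f)(u)`; only the values at `u ≤ 0` are of interest. -/
noncomputable def aMinus {n : ℕ} (α : ℝ) (f : USphere (n + 1) → ℂ) (x : USphere (n + 1))
    (u : ℝ) : ℂ :=
  if u < 0 then
    (((1 + tanSq x - u) ^ (α - (n : ℝ) / 2) : ℝ) : ℂ) *
      poisson (onParallel f x u) (direction x) (poissonRadius x u)
  else
    (((1 + tanSq x) ^ (α - (n : ℝ) / 2) : ℝ) : ℂ) * f x

/-- The integrand of the hypersingular integral. -/
noncomputable def hyperIntegrand {n : ℕ} (α : ℝ) (l : ℕ) (f : USphere (n + 1) → ℂ)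
    (x : USphere (n + 1)) (t : ℝ) : ℂ :=
  finDiff l t (aMinus α f x) 0 / ((t ^ (1 + α) : ℝ) : ℂ)

/-- The truncated hypersingular integral on the sphere, for the right-sided fractional
integral. -/
noncomputable def truncT {n : ℕ} (α : ℝ) (l : ℕ) (ε : ℝ) (f : USphere (n + 1) → ℂ) :
    USphere (n + 1) → ℂ := fun x =>
  (((2 : ℝ) ^ (-α) / kappa α l * (1 + tanSq x) ^ (α + (n : ℝ) / 2) : ℝ) : ℂ) *
    ∫ t in Ioi ε, hyperIntegrand α l f x t

/-! ### Restriction, extension by zero, and the operator on the cap -/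

open Classical in
/-- Extension by zero of a function on a spherical segment to the whole sphere. -/
noncomputable def extendZero {n : ℕ} {a b : ℝ} (f : segS n a b → ℂ) : USphere (n + 1) → ℂ :=
  fun x => if h : x ∈ segS n a b then f ⟨x, h⟩ else 0

/-- Restriction of a function on the sphere to a spherical segment. -/
def restr {n : ℕ} (a b : ℝ) (f : USphere (n + 1) → ℂ) : segS n a b → ℂ :=
  fun x => f x.1

/-- The truncated hypersingular operator on a spherical segment: extension by zero, followed by
the truncated operator on the sphere, followed by restriction. -/
noncomputable def truncTSeg {n : ℕ} {a b : ℝ} (α : ℝ) (l : ℕ) (ε : ℝ) (f : segS n a b → ℂ) :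
    segS n a b → ℂ :=
  restr a b (truncT α l ε (extendZero f))

end SphFrac

namespace SphFrac

/-! ### Second differences and the maximum principle -/

/-! Write a point of the sphere as `capChart t η` with t = tan²(θ/2). In these coordinates the
kernel of the fractional integral, times the density of surface measure, is a product of powers of 1
+ s and 1 + t, the Riemann–Liouville kernel (t - s)^(α-1) and the Poisson kernel of radius √(s/t)
(`kernel_mul_capWeight`). Hence, with G(t, η) = (1 + t)^(-(α+n/2)) φ, the fractional integral at (s,
ξ) is, up to an elementary factor, the integral over t > s of (t - s)^(α-1) times the Poisson
integral of G(t, ·) at √(s/t) ξ.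

Poisson operators multiply radii, and √(s/(s+v)) √((s+v)/t) = √(s/t). The Poisson integral in (A_x^-
f)(-v) therefore turns the fractional integral over the parallel s + v into 2^α times the
one-dimensional Riemann–Liouville integral at v of h(t) = Π[G(s+t, ·)](√(s/(s+t)) ξ)
(`cPoisson_capFrac`, `aMinus_capChart`). The hypersingular integral is thus a truncated Marchaud
derivative of a Riemann–Liouville integral, and Fubini gives ∫ k(y) h(εy) dy with an explicit kernel
k (`truncated_marchaud`). Its mass is κ(α, ℓ), found by testing on e^(-t) (`integral_avgKernel`).

It remains to let ε tend to 0 almost everywhere. Here the radius and the parallel move together, so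
a maximal inequality is needed. The radial maximal function of the Poisson integral is of weak type
(1,1) by Hopf's maximal ergodic lemma: along the radii exp(-2^(-j)) Poisson operators are powers of
a single positive operator of mass one, and Harnack's inequality turns a single large Poisson
integral into a large ergodic sum (`measure_exists_rPoisson_gt_le`). So the maximal function of an
L^p function, p > 1, is integrable on each parallel. Lebesgue differentiation in t controls its
averages over short intervals, and a dyadic majorant of k passes from those averages to the integral
against k (`eventually_lintegral_kernel_le`). Approximation by continuous functions finishes the
argument (`ae_tendsto_avgKernel`).

The facts about the Poisson kernel, mass one and the semigroup law, come from the maximum principle.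
Harmonicity is encoded by limits of second difference quotients along the axes, so that no
derivative under an integral sign is ever needed. The weight (1 + x_(n+1))^μ matters only near the
South Pole, whereas the integrals at a point with parameter s involve only t > s; there the weight
is bounded above and below. -/

theorem abs_symm_second_difference_le {f f' f'' : ℝ → ℝ} {δ M : ℝ}
    (h1 : ∀ t ∈ Icc (-δ) δ, HasDerivAt f (f' t) t)
    (h2 : ∀ t ∈ Icc (-δ) δ, HasDerivAt f' (f'' t) t)
    (hM : ∀ t ∈ Icc (-δ) δ, |f'' t| ≤ M) {h : ℝ} (h0 : 0 ≤ h) (hδ : h ≤ δ) :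
    |f h + f (-h) - 2 * f 0| ≤ 2 * M * h ^ 2 := by
  have hb : ∀ t ∈ Icc (0 : ℝ) h, ‖f' t - f' (-t)‖ ≤ 2 * M * h := by
    intro t ht
    have := (convex_Icc (-δ) δ).norm_image_sub_le_of_norm_hasDerivWithin_le
      (f := f') (f' := f'') (C := M) (x := -t) (y := t)
      (fun x hx => (h2 x hx).hasDerivWithinAt) hM
      ⟨by linarith [ht.1, ht.2], by linarith [ht.1, ht.2]⟩
      ⟨by linarith [ht.1, ht.2], by linarith [ht.1, ht.2]⟩
    have hM0 : 0 ≤ M := (abs_nonneg _).trans (hM 0 ⟨by linarith, by linarith⟩)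
    refine this.trans ?_
    rw [Real.norm_eq_abs, abs_of_nonneg (by linarith [ht.1])]
    nlinarith [ht.1, ht.2]
  -- The even function f t + f (-t) has derivative f' t - f' (-t), which the first mean value
  -- inequality bounds by 2Mh.
  have := (convex_Icc (0 : ℝ) h).norm_image_sub_le_of_norm_hasDerivWithin_le
    (f := fun t => f t + f (-t)) (f' := fun t => f' t - f' (-t)) (C := 2 * M * h)
    (x := 0) (y := h)
    (fun x hx => by
      have e1 := h1 x ⟨by linarith [hx.1], by linarith [hx.2]⟩
      have e2 := (h1 (-x) ⟨by linarith [hx.2], by linarith [hx.1]⟩).comp x (hasDerivAt_neg x)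
      refine HasDerivAt.hasDerivWithinAt ?_
      exact (e1.add e2).congr_deriv (by ring)) hb ⟨le_rfl, h0⟩ ⟨h0, le_rfl⟩
  simp only [Real.norm_eq_abs, neg_zero, sub_zero, abs_of_nonneg h0] at this
  calc _ = |f h + f (-h) - (f 0 + f 0)| := by ring_nf
    _ ≤ _ := this
    _ = _ := by ring

theorem tendsto_symm_second_difference {f f' f'' : ℝ → ℝ} {δ : ℝ} (hδ : 0 < δ)
    (h1 : ∀ t ∈ Icc (-δ) δ, HasDerivAt f (f' t) t)
    (h2 : ∀ t ∈ Icc (-δ) δ, HasDerivAt f' (f'' t) t) (hc : ContinuousAt f'' 0) :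
    Tendsto (fun h => (f h + f (-h) - 2 * f 0) / h ^ 2) (𝓝[>] 0) (𝓝 (f'' 0)) := by
  rw [Metric.tendsto_nhdsWithin_nhds]
  intro ε hε
  obtain ⟨ρ, hρ, hρ'⟩ := Metric.continuousAt_iff.1 hc (ε / 4) (by positivity)
  refine ⟨min ρ δ, lt_min hρ hδ, ?_⟩
  intro h hh hd
  have hh : 0 < h := hh
  rw [Real.dist_eq, sub_zero, abs_of_pos hh] at hd
  have hρh := hd.trans_le (min_le_left _ _)
  have hδh := hd.trans_le (min_le_right _ _)
  -- The parabola with second derivative `f'' 0` is subtracted; its second difference is exactly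
  -- `f'' 0 * h ^ 2`. The remainder has second derivative at most ε/4 on [-h, h].
  have := abs_symm_second_difference_le (δ := h) (M := ε / 4)
    (f := fun t => f t - f'' 0 / 2 * t ^ 2) (f' := fun t => f' t - f'' 0 * t)
    (f'' := fun t => f'' t - f'' 0)
    (fun t ht => by
      have := (h1 t ⟨by linarith [ht.1], by linarith [ht.2]⟩).sub
        ((hasDerivAt_pow 2 t).const_mul (f'' 0 / 2))
      exact this.congr_deriv (by push_cast; ring))
    (fun t ht => by
      have := (h2 t ⟨by linarith [ht.1], by linarith [ht.2]⟩).sub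
        ((hasDerivAt_id t).const_mul (f'' 0))
      exact this.congr_deriv (by ring))
    (fun t ht => by
      have := hρ' (x := t) (by
        rw [Real.dist_eq, sub_zero, abs_lt]; constructor <;> linarith [ht.1, ht.2])
      exact this.le) hh.le le_rfl
  rw [Real.dist_eq]
  have e : (f h + f (-h) - 2 * f 0) / h ^ 2 - f'' 0 =
      ((f h - f'' 0 / 2 * h ^ 2) + (f (-h) - f'' 0 / 2 * (-h) ^ 2) -
        2 * (f 0 - f'' 0 / 2 * 0 ^ 2)) / h ^ 2 := by
    field_simp; ring
  rw [e, abs_div, abs_of_pos (by positivity : 0 < h ^ 2), div_lt_iff₀ (by positivity)]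
  refine this.trans_lt ?_
  have : 0 < h ^ 2 := by positivity
  nlinarith

/-- The sum of the symmetric second differences of `V` at `x` along the coordinate axes. -/
noncomputable def secondDiff {n : ℕ} (V : EuclideanSpace ℝ (Fin n) → ℝ)
    (x : EuclideanSpace ℝ (Fin n)) (h : ℝ) : ℝ :=
  ∑ i, (V (x + h • EuclideanSpace.single i (1 : ℝ)) +
    V (x - h • EuclideanSpace.single i (1 : ℝ)) - 2 * V x)

/-- The discrete Laplacian of `V` at `x` tends to zero with the mesh size. -/
def IsDiscHarmonicAt {n : ℕ} (V : EuclideanSpace ℝ (Fin n) → ℝ)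
    (x : EuclideanSpace ℝ (Fin n)) : Prop :=
  Tendsto (fun h : ℝ => secondDiff V x h / h ^ 2) (𝓝[>] 0) (𝓝 0)

section
variable {n : ℕ} {V W : EuclideanSpace ℝ (Fin n) → ℝ} {x : EuclideanSpace ℝ (Fin n)}

theorem IsDiscHarmonicAt.sub (hV : IsDiscHarmonicAt V x) (hW : IsDiscHarmonicAt W x) :
    IsDiscHarmonicAt (fun y => V y - W y) x := by
  have := Tendsto.sub hV hW
  rw [sub_zero] at this
  refine this.congr fun h => ?_
  rw [← sub_div]
  congr 1
  simp only [secondDiff, ← Finset.sum_sub_distrib]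
  exact Finset.sum_congr rfl fun i _ => by ring

theorem IsDiscHarmonicAt.const_mul (c : ℝ) (hV : IsDiscHarmonicAt V x) :
    IsDiscHarmonicAt (fun y => c * V y) x := by
  have := Tendsto.const_mul c hV
  rw [mul_zero] at this
  refine this.congr fun h => ?_
  rw [← mul_div_assoc]
  congr 1
  simp only [secondDiff, Finset.mul_sum]
  exact Finset.sum_congr rfl fun i _ => by ring

theorem isDiscHarmonicAt_const (c : ℝ) : IsDiscHarmonicAt (fun _ => c) x := by
  refine tendsto_const_nhds.congr fun h => ?_
  simp [secondDiff]; ring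

theorem IsDiscHarmonicAt.comp_smul {c : ℝ} (hc : 0 ≤ c) (hV : IsDiscHarmonicAt V (c • x)) :
    IsDiscHarmonicAt (fun y => V (c • y)) x := by
  rcases hc.eq_or_lt with rfl | hc
  · simpa using isDiscHarmonicAt_const (V 0)
  have h1 : Tendsto (fun h : ℝ => c * h) (𝓝[>] 0) (𝓝[>] 0) := by
    refine tendsto_nhdsWithin_iff.2 ⟨?_, ?_⟩
    · have : Tendsto (fun h : ℝ => c * h) (𝓝 0) (𝓝 (c * 0)) := tendsto_id.const_mul c
      rw [mul_zero] at this
      exact this.mono_left nhdsWithin_le_nhds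
    · filter_upwards [self_mem_nhdsWithin] with h hh
      exact mul_pos hc hh
  have := (Tendsto.comp hV h1).const_mul (c ^ 2)
  rw [mul_zero] at this
  refine this.congr fun h => ?_
  have : secondDiff (fun y => V (c • y)) x h = secondDiff V (c • x) (c * h) := by
    simp [secondDiff, smul_add, smul_sub, smul_smul]
  rw [this, Function.comp_apply]
  rcases eq_or_ne h 0 with rfl | hh
  · simp
  · field_simp

/-- The parallelogram law in each axis direction. This is the strictly subharmonic perturbation used
in the maximum principle. -/
theorem secondDiff_norm_sq (x : EuclideanSpace ℝ (Fin n)) (h : ℝ) :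
    secondDiff (fun y => ‖y‖ ^ 2) x h = 2 * n * h ^ 2 := by
  have : ∀ i : Fin n, ‖x + h • EuclideanSpace.single i (1 : ℝ)‖ ^ 2 +
      ‖x - h • EuclideanSpace.single i (1 : ℝ)‖ ^ 2 - 2 * ‖x‖ ^ 2 = 2 * h ^ 2 := by
    intro i
    have := parallelogram_law_with_norm ℝ x (h • EuclideanSpace.single i (1 : ℝ))
    have e : ‖h • EuclideanSpace.single i (1 : ℝ)‖ * ‖h • EuclideanSpace.single i (1 : ℝ)‖
        = h ^ 2 := by
      rw [norm_smul]; simp [← sq]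
    nlinarith
  simp only [secondDiff, this]
  simp; ring

theorem norm_single_step_le (i : Fin n) {h : ℝ} (hh : 0 ≤ h) :
    ‖h • EuclideanSpace.single i (1 : ℝ)‖ = h := by
  rw [norm_smul]; simp [abs_of_nonneg hh]

/-- The weak maximum principle on a ball. -/
theorem le_of_isDiscHarmonicAt (hn : 0 < n) {ρ C : ℝ} (hρ : 0 < ρ)
    (hc : ContinuousOn V (Metric.closedBall 0 ρ))
    (hV : ∀ y ∈ Metric.ball (0 : EuclideanSpace ℝ (Fin n)) ρ, IsDiscHarmonicAt V y)
    (hC : ∀ y ∈ Metric.sphere (0 : EuclideanSpace ℝ (Fin n)) ρ, V y ≤ C)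
    (hx : x ∈ Metric.closedBall 0 ρ) : V x ≤ C := by
  by_contra! hcon
  -- With this size, adding e‖y‖² raises V on the sphere by only half of the supposed excess V x -
  -- C, so the perturbed function still has its maximum inside.
  set e : ℝ := (V x - C) / (2 * ρ ^ 2) with he
  have he0 : 0 < e := by have := sub_pos.2 hcon; positivity
  have heρ : e * ρ ^ 2 = (V x - C) / 2 := by rw [he]; field_simp
  obtain ⟨x₀, hx₀, hmax⟩ := (isCompact_closedBall (0 : EuclideanSpace ℝ (Fin n)) ρ).exists_isMaxOn
    ⟨x, hx⟩ (f := fun y => V y + e * ‖y‖ ^ 2) (by fun_prop)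
  have h1 : V x + e * ‖x‖ ^ 2 ≤ V x₀ + e * ‖x₀‖ ^ 2 := hmax hx
  have hx₀b : x₀ ∈ Metric.ball (0 : EuclideanSpace ℝ (Fin n)) ρ := by
    by_contra hnb
    rw [mem_closedBall_zero_iff] at hx₀
    rw [mem_ball_zero_iff] at hnb
    have heq : ‖x₀‖ = ρ := le_antisymm hx₀ (not_lt.1 hnb)
    have := hC x₀ (mem_sphere_zero_iff_norm.2 heq)
    rw [heq, heρ] at h1
    have : 0 ≤ e * ‖x‖ ^ 2 := by positivity
    linarith
  have h2 := hV x₀ hx₀b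
  -- At an interior maximum of V + e‖y‖² all its second differences are nonpositive, so those of V
  -- sum to at most -2neh². This contradicts the limit 0.
  have h3 : ∀ᶠ h in 𝓝[>] (0 : ℝ), secondDiff V x₀ h / h ^ 2 ≤ -(2 * n * e) := by
    have : ∀ᶠ h in 𝓝[>] (0 : ℝ), h < ρ - ‖x₀‖ :=
      nhdsWithin_le_nhds (eventually_lt_nhds (sub_pos.2 (mem_ball_zero_iff.1 hx₀b)))
    filter_upwards [this, self_mem_nhdsWithin] with h hh hpos
    have hpos : 0 < h := hpos
    rw [div_le_iff₀ (by positivity)]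
    have h4 : secondDiff V x₀ h + e * secondDiff (fun y => ‖y‖ ^ 2) x₀ h ≤ 0 := by
      simp only [secondDiff, Finset.mul_sum, ← Finset.sum_add_distrib]
      refine Finset.sum_nonpos fun i _ => ?_
      have hi := norm_single_step_le i hpos.le
      have a1 := hmax (a := x₀ + h • EuclideanSpace.single i (1 : ℝ)) (by
        rw [mem_closedBall_zero_iff]; exact (norm_add_le _ _).trans (by rw [hi]; linarith))
      have a2 := hmax (a := x₀ - h • EuclideanSpace.single i (1 : ℝ)) (by
        rw [mem_closedBall_zero_iff]; exact (norm_sub_le _ _).trans (by rw [hi]; linarith))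
      simp only [mem_ofPred_eq] at a1 a2
      linarith
    rw [secondDiff_norm_sq] at h4
    linarith
  have h5 := le_of_tendsto h2 h3
  have : 0 < 2 * n * e := by positivity
  linarith

/-- The weak minimum principle on a ball. -/
theorem ge_of_isDiscHarmonicAt (hn : 0 < n) {ρ C : ℝ} (hρ : 0 < ρ)
    (hc : ContinuousOn V (Metric.closedBall 0 ρ))
    (hV : ∀ y ∈ Metric.ball (0 : EuclideanSpace ℝ (Fin n)) ρ, IsDiscHarmonicAt V y)
    (hC : ∀ y ∈ Metric.sphere (0 : EuclideanSpace ℝ (Fin n)) ρ, C ≤ V y)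
    (hx : x ∈ Metric.closedBall 0 ρ) : C ≤ V x := by
  have := le_of_isDiscHarmonicAt (V := fun y => -1 * V y) (C := -1 * C) hn hρ
    (continuousOn_const.mul hc) (fun y hy => (hV y hy).const_mul (-1))
    (fun y hy => by linarith [hC y hy]) hx
  linarith

end


/-! ### The Poisson kernel of the ball -/

/-- The Poisson kernel of the unit ball, without normalization. -/
noncomputable def pKer {n : ℕ} (x y : EuclideanSpace ℝ (Fin n)) : ℝ :=
  (1 - ‖x‖ ^ 2) / ‖x - y‖ ^ n

/-- The first derivative of `(N - 2 a t - t²) (D + 2 c t + t²)^(-m)`. -/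
noncomputable def lineDeriv₁ (m N a D c t : ℝ) : ℝ :=
  (-2 * a - 2 * t) * (D + 2 * c * t + t ^ 2) ^ (-m) +
    (N - 2 * a * t - t ^ 2) * ((2 * c + 2 * t) * -m * (D + 2 * c * t + t ^ 2) ^ (-m - 1))

/-- The second derivative of `(N - 2 a t - t²) (D + 2 c t + t²)^(-m)`. -/
noncomputable def lineDeriv₂ (m N a D c t : ℝ) : ℝ :=
  -2 * (D + 2 * c * t + t ^ 2) ^ (-m) +
    2 * ((-2 * a - 2 * t) * ((2 * c + 2 * t) * -m * (D + 2 * c * t + t ^ 2) ^ (-m - 1))) +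
    (N - 2 * a * t - t ^ 2) * (2 * -m * (D + 2 * c * t + t ^ 2) ^ (-m - 1) +
      (2 * c + 2 * t) * -m * ((2 * c + 2 * t) * (-m - 1) *
        (D + 2 * c * t + t ^ 2) ^ (-m - 1 - 1)))

section line
variable {m N a D c t : ℝ}

theorem hasDerivAt_quad (D c t : ℝ) :
    HasDerivAt (fun t => D + 2 * c * t + t ^ 2) (2 * c + 2 * t) t := by
  have h1 : HasDerivAt (fun t : ℝ => 2 * c * t) (2 * c * 1) t :=
    (hasDerivAt_id t).const_mul (2 * c)
  have := (h1.const_add D).add (hasDerivAt_pow 2 t)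
  exact this.congr_deriv (by push_cast; ring)

theorem hasDerivAt_quad' (N a t : ℝ) :
    HasDerivAt (fun t => N - 2 * a * t - t ^ 2) (-2 * a - 2 * t) t := by
  have h1 : HasDerivAt (fun t : ℝ => 2 * a * t) (2 * a * 1) t :=
    (hasDerivAt_id t).const_mul (2 * a)
  have := (h1.const_sub N).sub (hasDerivAt_pow 2 t)
  exact this.congr_deriv (by push_cast; ring)

theorem hasDerivAt_line (h : 0 < D + 2 * c * t + t ^ 2) :
    HasDerivAt (fun t => (N - 2 * a * t - t ^ 2) * (D + 2 * c * t + t ^ 2) ^ (-m))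
      (lineDeriv₁ m N a D c t) t :=
  (hasDerivAt_quad' N a t).mul ((hasDerivAt_quad D c t).rpow_const (Or.inl h.ne'))

theorem hasDerivAt_lineDeriv₁ (h : 0 < D + 2 * c * t + t ^ 2) :
    HasDerivAt (lineDeriv₁ m N a D c) (lineDeriv₂ m N a D c t) t := by
  have e1 : HasDerivAt (fun t : ℝ => -2 * a - 2 * t) (-2) t := by
    have := ((hasDerivAt_id t).const_mul (2 : ℝ)).const_sub (-2 * a)
    exact this.congr_deriv (by ring)
  have e2 : HasDerivAt (fun t : ℝ => (2 * c + 2 * t) * -m) (2 * -m) t := by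
    have := (((hasDerivAt_id t).const_mul (2 : ℝ)).const_add (2 * c)).mul_const (-m)
    exact this.congr_deriv (by ring)
  have q := hasDerivAt_quad D c t
  have := (e1.mul (q.rpow_const (p := -m) (Or.inl h.ne'))).add
    ((hasDerivAt_quad' N a t).mul (e2.mul (q.rpow_const (p := -m - 1) (Or.inl h.ne'))))
  exact this.congr_deriv (by simp only [Pi.mul_apply, lineDeriv₂]; ring)

theorem continuousAt_lineDeriv₂ (h : 0 < D) : ContinuousAt (lineDeriv₂ m N a D c) 0 := by
  have q : ∀ p : ℝ, ContinuousAt (fun t => (D + 2 * c * t + t ^ 2) ^ p) 0 := fun p =>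
    ContinuousAt.rpow_const (by fun_prop) (Or.inl (by simp [h.ne']))
  unfold lineDeriv₂
  have := q (-m); have := q (-m - 1); have := q (-m - 1 - 1)
  fun_prop

/-- The bound depends only on m and the lower bound d of the quadratic: all exponents are
nonpositive, so its powers are dominated by powers of d. -/
theorem abs_lineDeriv₂_le {d : ℝ} (hd : 0 < d) (hm : 0 ≤ m) (hD : d ≤ D + 2 * c * t + t ^ 2)
    (hN : |N - 2 * a * t - t ^ 2| ≤ 1) (ha : |-2 * a - 2 * t| ≤ 2) (hc : |2 * c + 2 * t| ≤ 4) :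
    |lineDeriv₂ m N a D c t| ≤ 2 * d ^ (-m) + 2 * (2 * (4 * m * d ^ (-m - 1))) +
      1 * (2 * m * d ^ (-m - 1) + 4 * m * (4 * (m + 1) * d ^ (-m - 1 - 1))) := by
  have q : ∀ p : ℝ, p ≤ 0 → |(D + 2 * c * t + t ^ 2) ^ p| ≤ d ^ p := fun p hp => by
    rw [abs_of_nonneg (Real.rpow_nonneg (hd.le.trans hD) _)]
    exact Real.rpow_le_rpow_of_nonpos hd hD hp
  have q1 := q (-m) (by linarith)
  have q2 := q (-m - 1) (by linarith)
  have q3 := q (-m - 1 - 1) (by linarith)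
  unfold lineDeriv₂
  refine (abs_add_three _ _ _).trans ?_
  gcongr ?_ + ?_ + ?_
  · rw [abs_mul]; gcongr; norm_num
  · rw [abs_mul, abs_mul, abs_mul, abs_mul, abs_neg, abs_of_nonneg hm, abs_of_nonneg zero_le_two]
    gcongr
  · rw [abs_mul]
    gcongr
    refine (abs_add_le _ _).trans ?_
    rw [abs_mul, abs_mul, abs_mul, abs_mul, abs_mul, abs_mul, abs_neg, abs_of_nonneg hm,
      show -m - 1 = -(m + 1) by ring, abs_neg, abs_of_nonneg (by linarith : 0 ≤ m + 1),
      abs_of_nonneg zero_le_two, ← show -m - 1 = -(m + 1) by ring]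
    gcongr

end line

section kernel
variable {n : ℕ} {x y : EuclideanSpace ℝ (Fin n)}

theorem norm_add_single_sq (x : EuclideanSpace ℝ (Fin n)) (i : Fin n) (h : ℝ) :
    ‖x + h • EuclideanSpace.single i (1 : ℝ)‖ ^ 2 = ‖x‖ ^ 2 + 2 * x i * h + h ^ 2 := by
  rw [norm_add_sq_real, inner_smul_right, EuclideanSpace.inner_single_right, norm_smul]
  simp; ring

/-- Along an axis both the numerator and the squared distance are quadratic polynomials in the step,
which reduces the derivatives of the kernel to one-variable calculus with m = n/2. -/
theorem pKer_line (x y : EuclideanSpace ℝ (Fin n)) (i : Fin n) (h : ℝ) :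
    pKer (x + h • EuclideanSpace.single i (1 : ℝ)) y =
      ((1 - ‖x‖ ^ 2) - 2 * x i * h - h ^ 2) *
        (‖x - y‖ ^ 2 + 2 * (x i - y i) * h + h ^ 2) ^ (-((n : ℝ) / 2)) := by
  have h2 := norm_add_single_sq (x - y) i h
  rw [show x - y + h • EuclideanSpace.single i (1 : ℝ) =
    x + h • EuclideanSpace.single i (1 : ℝ) - y by abel, PiLp.sub_apply] at h2
  rw [pKer, norm_add_single_sq, ← h2, Real.rpow_neg (by positivity), div_eq_mul_inv,
    ← Real.rpow_natCast_mul (norm_nonneg _), Nat.cast_ofNat,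
    mul_div_cancel₀ _ (two_ne_zero), Real.rpow_natCast]
  ring

theorem lineDist_eq (x y : EuclideanSpace ℝ (Fin n)) (i : Fin n) (t : ℝ) :
    ‖x - y‖ ^ 2 + 2 * (x i - y i) * t + t ^ 2 =
      ‖x + t • EuclideanSpace.single i (1 : ℝ) - y‖ ^ 2 := by
  rw [show x + t • EuclideanSpace.single i (1 : ℝ) - y =
    (x - y) + t • EuclideanSpace.single i (1 : ℝ) by abel, norm_add_single_sq, PiLp.sub_apply]

theorem le_norm_line_sub (hy : ‖y‖ = 1) (i : Fin n) {t δ : ℝ} (hδ : ‖x‖ + 2 * δ ≤ 1)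
    (ht : t ∈ Icc (-δ) δ) : δ ≤ ‖x + t • EuclideanSpace.single i (1 : ℝ) - y‖ := by
  have h1 : ‖t • EuclideanSpace.single i (1 : ℝ)‖ ≤ δ := by
    rw [norm_smul]; simpa using abs_le.2 ht
  have h2 := norm_add_le x (t • EuclideanSpace.single i (1 : ℝ))
  have h3 := norm_sub_norm_le y (x + t • EuclideanSpace.single i (1 : ℝ))
  rw [norm_sub_rev] at h3
  linarith

/-- The constant is uniform in the boundary point and the direction because the segment stays at
distance at least δ from the unit sphere. It is the dominating constant when second differences pass
through the Poisson integral. -/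
theorem pKer_line_second_difference_bound {δ : ℝ} (hδ : 0 < δ) (hx : ‖x‖ + 2 * δ ≤ 1) :
    ∃ M : ℝ, ∀ y : EuclideanSpace ℝ (Fin n), ‖y‖ = 1 → ∀ i, ∀ h, 0 ≤ h → h ≤ δ →
      |pKer (x + h • EuclideanSpace.single i (1 : ℝ)) y +
        pKer (x - h • EuclideanSpace.single i (1 : ℝ)) y - 2 * pKer x y| ≤ M * h ^ 2 := by
  have hx1 : ‖x‖ ≤ 1 := by linarith
  set m : ℝ := (n : ℝ) / 2 with hm
  have hm0 : 0 ≤ m := by positivity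
  refine ⟨2 * (2 * (δ ^ 2) ^ (-m) + 2 * (2 * (4 * m * (δ ^ 2) ^ (-m - 1))) +
    1 * (2 * m * (δ ^ 2) ^ (-m - 1) + 4 * m * (4 * (m + 1) * (δ ^ 2) ^ (-m - 1 - 1)))), fun y hy i h h0 hhδ => ?_⟩
  have hpos : ∀ t ∈ Icc (-δ) δ, δ ^ 2 ≤ ‖x - y‖ ^ 2 + 2 * (x i - y i) * t + t ^ 2 := by
    intro t ht
    rw [lineDist_eq]
    exact pow_le_pow_left₀ hδ.le (le_norm_line_sub hy i hx ht) 2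
  have hco : ∀ (z : EuclideanSpace ℝ (Fin n)), |z i| ≤ ‖z‖ := fun z => PiLp.norm_apply_le z i
  have key := abs_symm_second_difference_le (δ := δ) (h := h)
    (f := fun t => ((1 - ‖x‖ ^ 2) - 2 * x i * t - t ^ 2) *
        (‖x - y‖ ^ 2 + 2 * (x i - y i) * t + t ^ 2) ^ (-m))
    (fun t ht => hasDerivAt_line ((by positivity : (0 : ℝ) < δ ^ 2).trans_le (hpos t ht)))
    (fun t ht => hasDerivAt_lineDeriv₁ ((by positivity : (0 : ℝ) < δ ^ 2).trans_le (hpos t ht)))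
    (fun t ht => abs_lineDeriv₂_le (d := δ ^ 2) (by positivity) hm0 (hpos t ht)
      (by
        have : (1 - ‖x‖ ^ 2) - 2 * x i * t - t ^ 2 =
            1 - ‖x + t • EuclideanSpace.single i (1 : ℝ)‖ ^ 2 := by
          rw [norm_add_single_sq]; ring
        have h1 : ‖x + t • EuclideanSpace.single i (1 : ℝ)‖ ≤ 1 := by
          refine (norm_add_le _ _).trans ?_
          have : ‖t • EuclideanSpace.single i (1 : ℝ)‖ ≤ δ := by
            rw [norm_smul]; simpa using abs_le.2 ht
          linarith
        rw [this, abs_le]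
        constructor <;> nlinarith [norm_nonneg (x + t • EuclideanSpace.single i (1 : ℝ))])
      (by
        have := abs_le.1 (hco x)
        rw [abs_le]; constructor <;> linarith [ht.1, ht.2])
      (by
        have := abs_le.1 (hco x)
        have h2 := hco y
        rw [hy] at h2
        have h2 := abs_le.1 h2
        rw [abs_le]; constructor <;> linarith [ht.1, ht.2])) h0 hhδ
  have e1 := pKer_line x y i h
  have e2 := pKer_line x y i (-h)
  have e3 := pKer_line x y i 0
  rw [neg_smul, ← sub_eq_add_neg] at e2
  rw [zero_smul, add_zero] at e3
  rw [e1, e2, e3]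
  exact key

/-- The Laplacian of the Poisson kernel, computed by hand. All powers are reduced to D^(-m-1) and
D^(-m-2) with D = ‖x - y‖²; the cross sum uses ‖y‖ = 1, and the terms cancel precisely because 2m =
n. -/
theorem lineDeriv₂_sum (hy : ‖y‖ = 1) (hx : ‖x‖ < 1) :
    ∑ i, lineDeriv₂ ((n : ℝ) / 2) (1 - ‖x‖ ^ 2) (x i) (‖x - y‖ ^ 2) (x i - y i) 0 = 0 := by
  have hD : 0 < ‖x - y‖ ^ 2 := by
    have h3 := norm_sub_norm_le y x
    rw [norm_sub_rev] at h3
    have : 0 < ‖x - y‖ := by linarith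
    positivity
  set m : ℝ := (n : ℝ) / 2
  set D := ‖x - y‖ ^ 2 with hDdef
  have r1 : D ^ (-m) = D * D ^ (-m - 1) := by
    rw [mul_comm, ← Real.rpow_add_one hD.ne']; congr 1; ring
  have r2 : D * D ^ (-m - 1 - 1) = D ^ (-m - 1) := by
    rw [mul_comm, ← Real.rpow_add_one hD.ne']; congr 1; ring
  set R := D ^ (-m - 1)
  set Q := D ^ (-m - 1 - 1)
  have e : ∀ i, lineDeriv₂ m (1 - ‖x‖ ^ 2) (x i) D (x i - y i) 0 =
      (-2 * D * R - 2 * m * (1 - ‖x‖ ^ 2) * R) + 8 * m * R * (x i * (x i - y i)) +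
      4 * m * (m + 1) * (1 - ‖x‖ ^ 2) * Q * (x i - y i) ^ 2 := by
    intro i
    simp only [lineDeriv₂, mul_zero, add_zero, zero_pow two_ne_zero, sub_zero]
    rw [r1]; ring
  have s1 : ∑ i, (x i - y i) ^ 2 = D := by
    rw [hDdef, EuclideanSpace.norm_sq_eq]; simp
  have s2 : ∑ i, x i * (x i - y i) = (‖x‖ ^ 2 + D - 1) / 2 := by
    have a1 : ‖x‖ ^ 2 = ∑ i, x i ^ 2 := by rw [EuclideanSpace.norm_sq_eq]; simp
    have a2 : (1 : ℝ) = ∑ i, y i ^ 2 := by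
      have : ‖y‖ ^ 2 = 1 := by rw [hy]; norm_num
      rw [← this, EuclideanSpace.norm_sq_eq]; simp
    have a3 : ∑ i, x i * (x i - y i) =
        (∑ i, x i ^ 2 + ∑ i, (x i - y i) ^ 2 - ∑ i, y i ^ 2) / 2 := by
      rw [← Finset.sum_add_distrib, ← Finset.sum_sub_distrib, Finset.sum_div]
      exact Finset.sum_congr rfl fun i _ => by ring
    rw [a3, ← a1, s1, ← a2]
  simp only [e, Finset.sum_add_distrib, ← Finset.mul_sum, s1, s2]
  simp only [Finset.sum_const, Finset.card_univ, Fintype.card_fin, nsmul_eq_mul]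
  rw [show (n : ℝ) = 2 * m by simp [m]; ring]
  linear_combination 4 * m * (m + 1) * (1 - ‖x‖ ^ 2) * r2

theorem pKer_isDiscHarmonicAt (hy : ‖y‖ = 1) (hx : ‖x‖ < 1) :
    IsDiscHarmonicAt (fun z => pKer z y) x := by
  set δ : ℝ := (1 - ‖x‖) / 2 with hδ
  have hδ0 : 0 < δ := by linarith [hδ]
  have hxδ : ‖x‖ + 2 * δ ≤ 1 := by linarith [hδ]
  have hpos : ∀ i, ∀ t ∈ Icc (-δ) δ, 0 < ‖x - y‖ ^ 2 + 2 * (x i - y i) * t + t ^ 2 := by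
    intro i t ht
    rw [lineDist_eq]
    exact pow_pos (hδ0.trans_le (le_norm_line_sub hy i hxδ ht)) 2
  have := tendsto_finsetSum Finset.univ fun i _ => tendsto_symm_second_difference
    (f := fun t => ((1 - ‖x‖ ^ 2) - 2 * x i * t - t ^ 2) *
        (‖x - y‖ ^ 2 + 2 * (x i - y i) * t + t ^ 2) ^ (-((n : ℝ) / 2))) hδ0
    (fun t ht => hasDerivAt_line (hpos i t ht))
    (fun t ht => hasDerivAt_lineDeriv₁ (hpos i t ht))
    (continuousAt_lineDeriv₂ (by
      have := hpos i 0 ⟨by linarith, hδ0.le⟩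
      simpa using this))
  rw [lineDeriv₂_sum hy hx] at this
  refine this.congr fun h => ?_
  rw [secondDiff, Finset.sum_div]
  refine Finset.sum_congr rfl fun i _ => ?_
  have e1 := pKer_line x y i h
  have e2 := pKer_line x y i (-h)
  have e3 := pKer_line x y i 0
  rw [neg_smul, ← sub_eq_add_neg] at e2
  rw [zero_smul, add_zero] at e3
  rw [e1, e2, e3]

end kernel


/-! ### Poisson integrals of continuous functions -/

section
variable {n : ℕ} {x y : EuclideanSpace ℝ (Fin n)}

theorem USphere.norm_eq {n : ℕ} (η : USphere n) : ‖(η : EuclideanSpace ℝ (Fin n))‖ = 1 :=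
  mem_sphere_zero_iff_norm.1 η.2

theorem one_sub_le_norm_sub (hy : ‖y‖ = 1) : 1 - ‖x‖ ≤ ‖x - y‖ := by
  have h3 := norm_sub_norm_le y x
  rw [norm_sub_rev] at h3
  linarith

theorem pKer_nonneg (hx : ‖x‖ ≤ 1) : 0 ≤ pKer x y :=
  div_nonneg (by nlinarith [norm_nonneg x]) (by positivity)

theorem pKer_le {d : ℝ} (hd : 0 < d) (h : d ≤ ‖x - y‖) (hx : ‖x‖ ≤ 1) :
    pKer x y ≤ (1 - ‖x‖ ^ 2) / d ^ n :=
  div_le_div_of_nonneg_left (by nlinarith [norm_nonneg x]) (by positivity) (by gcongr)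

theorem pKer_le_of_norm_le {ρ : ℝ} (hρ : ρ < 1) (hx : ‖x‖ ≤ ρ) (hy : ‖y‖ = 1) :
    pKer x y ≤ 1 / (1 - ρ) ^ n := by
  refine (pKer_le (sub_pos.2 hρ) ?_ (hx.trans hρ.le)).trans ?_
  · exact (sub_le_sub_left hx 1).trans (one_sub_le_norm_sub hy)
  · have : 0 < (1 - ρ) ^ n := pow_pos (sub_pos.2 hρ) n
    gcongr
    nlinarith [norm_nonneg x]

theorem continuousOn_pKer :
    ContinuousOn (fun p : EuclideanSpace ℝ (Fin n) × USphere n =>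
      pKer p.1 (p.2 : EuclideanSpace ℝ (Fin n))) {p | ‖p.1‖ < 1} := by
  unfold pKer
  refine ContinuousOn.div (by fun_prop) (by fun_prop) fun p hp => ?_
  have hp : ‖p.1‖ < 1 := hp
  have := one_sub_le_norm_sub (x := p.1) p.2.norm_eq
  exact pow_ne_zero _ (by linarith)

theorem pKer_zero (hy : ‖y‖ = 1) : pKer 0 y = 1 := by
  simp [pKer, hy]

theorem pKer_smul_comm {ξ η : EuclideanSpace ℝ (Fin n)} (hξ : ‖ξ‖ = 1) (hη : ‖η‖ = 1) (r : ℝ) :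
    pKer (r • ξ) η = pKer (r • η) ξ := by
  have : ‖r • ξ - η‖ ^ 2 = ‖r • η - ξ‖ ^ 2 := by
    rw [norm_sub_sq_real, norm_sub_sq_real, norm_smul, norm_smul, hξ, hη, inner_smul_left,
      inner_smul_left, real_inner_comm]
  have : ‖r • ξ - η‖ = ‖r • η - ξ‖ := by
    rwa [sq_eq_sq₀ (norm_nonneg _) (norm_nonneg _)] at this
  rw [pKer, pKer, this, norm_smul, norm_smul, hξ, hη]

/-- The measure `toSphere` gives the sphere n times the volume of the unit ball; Γ(n/2 + 1) = (n/2)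
Γ(n/2) converts this into the classical formula. -/
theorem measureReal_surf_univ (hn : 0 < n) : (surf n).real univ = area n := by
  have : Nonempty (Fin n) := ⟨⟨0, hn⟩⟩
  rw [Measure.toSphere_real_apply_univ, measureReal_def, EuclideanSpace.volume_ball]
  have hn' : (0 : ℝ) < n := by exact_mod_cast hn
  have hG := Real.Gamma_pos_of_pos (half_pos hn')
  rw [ENNReal.ofReal_one, one_pow, one_mul, ENNReal.toReal_ofReal (by positivity), area,
    finrank_euclideanSpace, Fintype.card_fin, Real.Gamma_add_one (by positivity),
    Real.sqrt_eq_rpow, ← Real.rpow_mul_natCast Real.pi_pos.le]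
  field_simp

theorem area_pos (hn : 0 < n) : 0 < area n := by
  have hn' : (0 : ℝ) < n := by exact_mod_cast hn
  have hG := Real.Gamma_pos_of_pos (half_pos hn')
  have := Real.pi_pos
  unfold area; positivity

theorem continuous_pKer_right (hx : ‖x‖ < 1) :
    Continuous fun η : USphere n => pKer x (η : EuclideanSpace ℝ (Fin n)) := by
  have := continuousOn_pKer.comp_continuous (f := fun η : USphere n => (x, η)) (by fun_prop)
    (fun _ => hx)
  exact this

theorem integrable_pKer_mul (hx : ‖x‖ < 1) {ψ : USphere n → ℝ} (hψ : Continuous ψ) :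
    Integrable (fun η : USphere n => pKer x (η : EuclideanSpace ℝ (Fin n)) * ψ η) (surf n) :=
  ((continuous_pKer_right hx).mul hψ).integrable_of_hasCompactSupport
    (HasCompactSupport.of_compactSpace _)

theorem exists_bound_of_continuous {ψ : USphere n → ℝ} (hψ : Continuous ψ) :
    ∃ C, 0 ≤ C ∧ ∀ η, |ψ η| ≤ C := by
  obtain ⟨C, hC⟩ := isCompact_univ.exists_bound_of_continuousOn hψ.continuousOn
  exact ⟨max C 0, le_max_right _ _, fun η => (hC η trivial).trans (le_max_left _ _)⟩

theorem continuousOn_poissonInt {ψ : USphere n → ℝ} (hψ : Continuous ψ) {ρ : ℝ} (hρ : ρ < 1) :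
    ContinuousOn (fun x => ∫ η, pKer x (η : EuclideanSpace ℝ (Fin n)) * ψ η ∂(surf n))
      (Metric.closedBall 0 ρ) := by
  obtain ⟨C, hC0, hC⟩ := exists_bound_of_continuous hψ
  refine continuousOn_of_dominated (bound := fun _ => 1 / (1 - ρ) ^ n * C) ?_ ?_ ?_ ?_
  · intro x hx
    rw [mem_closedBall_zero_iff] at hx
    exact (integrable_pKer_mul (hx.trans_lt hρ) hψ).aestronglyMeasurable
  · intro x hx
    rw [mem_closedBall_zero_iff] at hx
    refine Eventually.of_forall fun η => ?_
    rw [norm_mul, Real.norm_of_nonneg (pKer_nonneg (hx.trans hρ.le))]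
    have := pKer_le_of_norm_le hρ hx η.norm_eq
    have h0 := pKer_nonneg (y := (η : EuclideanSpace ℝ (Fin n))) (hx.trans hρ.le)
    exact mul_le_mul this (hC η) (abs_nonneg _) (h0.trans this)
  · exact integrable_const _
  · refine Eventually.of_forall fun η => ?_
    refine ContinuousOn.mul ?_ continuousOn_const
    refine continuousOn_pKer.comp (f := fun x => (x, η)) (by fun_prop) fun x hx => ?_
    rw [mem_closedBall_zero_iff] at hx
    exact hx.trans_lt hρ

theorem secondDiff_integral {ψ : USphere n → ℝ} (hψ : Continuous ψ) {h : ℝ} (h0 : 0 ≤ h)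
    (hx : ‖x‖ + h < 1) :
    secondDiff (fun x => ∫ η, pKer x (η : EuclideanSpace ℝ (Fin n)) * ψ η ∂(surf n)) x h =
      ∫ η, secondDiff (fun x => pKer x (η : EuclideanSpace ℝ (Fin n))) x h * ψ η ∂(surf n) := by
  have i0 := integrable_pKer_mul (x := x) (by linarith) hψ
  have i1 : ∀ i, Integrable (fun η : USphere n =>
      pKer (x + h • EuclideanSpace.single i (1 : ℝ)) (η : EuclideanSpace ℝ (Fin n)) * ψ η)
      (surf n) := fun i => integrable_pKer_mul ((norm_add_le _ _).trans_lt (by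
        rwa [norm_single_step_le i h0])) hψ
  have i2 : ∀ i, Integrable (fun η : USphere n =>
      pKer (x - h • EuclideanSpace.single i (1 : ℝ)) (η : EuclideanSpace ℝ (Fin n)) * ψ η)
      (surf n) := fun i => integrable_pKer_mul ((norm_sub_le _ _).trans_lt (by
        rwa [norm_single_step_le i h0])) hψ
  simp only [secondDiff, Finset.sum_mul, sub_mul, add_mul, mul_assoc]
  rw [integral_finsetSum]
  · refine Finset.sum_congr rfl fun i _ => ?_
    have i3 : Integrable (fun η : USphere n =>
        pKer (x + h • EuclideanSpace.single i (1 : ℝ)) (η : EuclideanSpace ℝ (Fin n)) * ψ η +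
        pKer (x - h • EuclideanSpace.single i (1 : ℝ)) (η : EuclideanSpace ℝ (Fin n)) * ψ η)
        (surf n) := (i1 i).add (i2 i)
    rw [integral_sub i3 (i0.const_mul 2), integral_add (i1 i) (i2 i), integral_const_mul]
  · exact fun i _ => ((i1 i).add (i2 i)).sub (i0.const_mul 2)

/-- Second differences commute with the integral, and the uniform bound for the kernel lets
dominated convergence carry the pointwise limit 0 through it. -/
theorem poissonInt_isDiscHarmonicAt {ψ : USphere n → ℝ} (hψ : Continuous ψ) (hx : ‖x‖ < 1) :
    IsDiscHarmonicAt
      (fun x => ∫ η, pKer x (η : EuclideanSpace ℝ (Fin n)) * ψ η ∂(surf n)) x := by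
  obtain ⟨C, hC0, hC⟩ := exists_bound_of_continuous hψ
  set δ : ℝ := (1 - ‖x‖) / 2 with hδ
  have hδ0 : 0 < δ := by linarith [hδ]
  have hxδ : ‖x‖ + 2 * δ ≤ 1 := by linarith [hδ]
  obtain ⟨M, hM⟩ := pKer_line_second_difference_bound hδ0 hxδ
  have hsmall : ∀ᶠ h in 𝓝[>] (0 : ℝ), 0 < h ∧ h < δ := by
    filter_upwards [self_mem_nhdsWithin, nhdsWithin_le_nhds (eventually_lt_nhds hδ0)]
      with h h1 h2 using ⟨h1, h2⟩
  have key : Tendsto (fun h : ℝ => ∫ η : USphere n,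
      secondDiff (fun x => pKer x (η : EuclideanSpace ℝ (Fin n))) x h / h ^ 2 * ψ η ∂(surf n))
      (𝓝[>] 0) (𝓝 (∫ _η : USphere n, (0 : ℝ) ∂(surf n))) := by
    refine tendsto_integral_filter_of_dominated_convergence (fun _ => n * M * C) ?_ ?_
      (integrable_const _) ?_
    · filter_upwards [hsmall] with h hh
      refine AEStronglyMeasurable.mul ?_ hψ.aestronglyMeasurable
      have : Continuous fun η : USphere n =>
          secondDiff (fun x => pKer x (η : EuclideanSpace ℝ (Fin n))) x h / h ^ 2 := by
        unfold secondDiff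
        refine Continuous.div_const (continuous_finsetSum _ fun i _ => ?_) _
        refine (Continuous.add ?_ ?_).sub (continuous_const.mul (continuous_pKer_right hx))
        · exact continuous_pKer_right ((norm_add_le _ _).trans_lt (by
            rw [norm_single_step_le i hh.1.le]; linarith))
        · exact continuous_pKer_right ((norm_sub_le _ _).trans_lt (by
            rw [norm_single_step_le i hh.1.le]; linarith))
      exact this.aestronglyMeasurable
    · filter_upwards [hsmall] with h hh
      refine Eventually.of_forall fun η => ?_
      have hb : |secondDiff (fun x => pKer x (η : EuclideanSpace ℝ (Fin n))) x h / h ^ 2|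
          ≤ n * M := by
        rw [abs_div, abs_of_pos (pow_pos hh.1 2), div_le_iff₀ (pow_pos hh.1 2), secondDiff]
        refine (Finset.abs_sum_le_sum_abs _ _).trans ?_
        refine (Finset.sum_le_sum fun i _ => hM η η.norm_eq i h hh.1.le hh.2.le).trans ?_
        simp [mul_assoc]
      rw [norm_mul, Real.norm_eq_abs, Real.norm_eq_abs]
      exact mul_le_mul hb (hC η) (abs_nonneg _) ((abs_nonneg _).trans hb)
    · refine Eventually.of_forall fun η => ?_
      have := (pKer_isDiscHarmonicAt (y := (η : EuclideanSpace ℝ (Fin n))) η.norm_eq hx)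
      simpa using Tendsto.mul_const (ψ η) this
  rw [integral_zero] at key
  refine key.congr' ?_
  filter_upwards [hsmall] with h hh
  rw [secondDiff_integral hψ hh.1.le (by linarith), ← integral_div]
  exact integral_congr_ae (Eventually.of_forall fun η => by ring)

/-! ### Rotations -/

/-- The action of a linear isometry on the unit sphere. -/
noncomputable def sphereMap (R : EuclideanSpace ℝ (Fin n) ≃ₗᵢ[ℝ] EuclideanSpace ℝ (Fin n)) (η : USphere n) :
    USphere n :=
  ⟨R η, by rw [mem_sphere_zero_iff_norm, R.norm_map, η.norm_eq]⟩

open scoped Pointwise in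
-- Surface measure is, up to the factor n, the volume of the cone over a set; a linear isometry
-- preserves volume and maps cones to cones.
theorem measurePreserving_sphereMap
    (R : EuclideanSpace ℝ (Fin n) ≃ₗᵢ[ℝ] EuclideanSpace ℝ (Fin n)) :
    MeasurePreserving (sphereMap R) (surf n) (surf n) := by
  have hm : Measurable (sphereMap R) :=
    (Continuous.subtype_mk (by fun_prop) _).measurable
  refine ⟨hm, Measure.ext fun s hs => ?_⟩
  have h0 := MeasurePreserving.measure_preimage_equiv
    (f := R.toHomeomorph.toMeasurableEquiv) R.measurePreserving
    (Ioo (0 : ℝ) 1 • (Subtype.val '' s))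
  rw [Measure.map_apply hm hs, Measure.toSphere_apply' _ (hm hs), Measure.toSphere_apply' _ hs,
    ← h0]
  congr 2
  ext z
  simp only [Set.mem_smul, mem_preimage]
  constructor
  · rintro ⟨r, hr, w, ⟨w', hw', rfl⟩, rfl⟩
    exact ⟨r, hr, R w', ⟨sphereMap R w', hw', rfl⟩, (map_smul R r (w' : EuclideanSpace ℝ (Fin n))).symm⟩
  · rintro ⟨r, hr, w, ⟨w', hw', rfl⟩, h2⟩
    refine ⟨r, hr, R.symm w', ⟨sphereMap R.symm w', ?_, rfl⟩, ?_⟩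
    · rw [mem_preimage]
      convert hw'
      exact Subtype.ext (R.apply_symm_apply _)
    · apply R.injective
      rw [map_smul, R.apply_symm_apply]
      exact h2

theorem integral_pKer_map (R : EuclideanSpace ℝ (Fin n) ≃ₗᵢ[ℝ] EuclideanSpace ℝ (Fin n))
    (x : EuclideanSpace ℝ (Fin n)) :
    ∫ η : USphere n, pKer (R x) (η : EuclideanSpace ℝ (Fin n)) ∂(surf n) =
      ∫ η : USphere n, pKer x (η : EuclideanSpace ℝ (Fin n)) ∂(surf n) := by
  have hm := measurePreserving_sphereMap R
  conv_lhs => rw [← hm.map_eq]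
  rw [integral_map hm.measurable.aemeasurable]
  · refine integral_congr_ae (Eventually.of_forall fun η => ?_)
    simp only [pKer, sphereMap, R.norm_map, ← map_sub]
  · refine Measurable.aestronglyMeasurable ?_
    unfold pKer
    fun_prop

/-- The reflection in the hyperplane orthogonal to x - y exchanges two points of equal norm. -/
theorem integral_pKer_eq_of_norm_eq (h : ‖x‖ = ‖y‖) :
    ∫ η : USphere n, pKer x (η : EuclideanSpace ℝ (Fin n)) ∂(surf n) =
      ∫ η : USphere n, pKer y (η : EuclideanSpace ℝ (Fin n)) ∂(surf n) := by
  have := integral_pKer_map (Submodule.reflection (Submodule.span ℝ {x - y})ᗮ) x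
  rw [Submodule.reflection_sub h] at this
  exact this.symm

/-- The Poisson kernel has total mass one. -/
theorem integral_pKer (hn : 0 < n) (hx : ‖x‖ < 1) :
    ∫ η : USphere n, pKer x (η : EuclideanSpace ℝ (Fin n)) ∂(surf n) = area n := by
  rcases eq_or_ne x 0 with rfl | hx0
  · rw [integral_congr_ae (Eventually.of_forall fun η : USphere n => pKer_zero η.norm_eq)]
    rw [integral_const, measureReal_surf_univ hn]; simp
  have h0 : ∫ η : USphere n, pKer 0 (η : EuclideanSpace ℝ (Fin n)) ∂(surf n) = area n := by
    rw [integral_congr_ae (Eventually.of_forall fun η : USphere n => pKer_zero η.norm_eq)]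
    rw [integral_const, measureReal_surf_univ hn]; simp
  have hρ : 0 < ‖x‖ := norm_pos_iff.2 hx0
  have hc := continuousOn_poissonInt (n := n) (ψ := fun _ => 1) continuous_const hx
  have hh : ∀ z : EuclideanSpace ℝ (Fin n), ‖z‖ < 1 → _ :=
    fun z hz => poissonInt_isDiscHarmonicAt (ψ := fun _ => 1) continuous_const hz
  simp only [mul_one] at hc hh
  have hz : (0 : EuclideanSpace ℝ (Fin n)) ∈ Metric.closedBall 0 ‖x‖ := by simp
  -- The mass is harmonic in the pole and constant on the sphere of radius ‖x‖, so the maximum and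
  -- minimum principles force the boundary value to equal the value at 0.
  have u1 := le_of_isDiscHarmonicAt hn hρ hc
    (fun z hz => hh z ((mem_ball_zero_iff.1 hz).trans hx))
    (fun z hz => (integral_pKer_eq_of_norm_eq (mem_sphere_zero_iff_norm.1 hz)).le) hz
  have u2 := ge_of_isDiscHarmonicAt hn hρ hc
    (fun z hz => hh z ((mem_ball_zero_iff.1 hz).trans hx))
    (fun z hz => (integral_pKer_eq_of_norm_eq (mem_sphere_zero_iff_norm.1 hz)).ge) hz
  linarith

/-- A function which is continuous on the closed ball and discretely harmonic inside is the
Poisson integral of its boundary values. -/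
theorem poissonInt_eq_of_isDiscHarmonicAt (hn : 0 < n) {u : EuclideanSpace ℝ (Fin n) → ℝ}
    (hu : ContinuousOn u (Metric.closedBall 0 1))
    (hd : ∀ z : EuclideanSpace ℝ (Fin n), ‖z‖ < 1 → IsDiscHarmonicAt u z) (hx : ‖x‖ < 1) :
    ∫ η : USphere n, pKer x (η : EuclideanSpace ℝ (Fin n)) * u η ∂(surf n) = area n * u x := by
  have hψ : Continuous fun η : USphere n => u η := by
    refine hu.comp_continuous continuous_subtype_val fun η => ?_
    rw [mem_closedBall_zero_iff, η.norm_eq]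
  obtain ⟨C, hC⟩ := (isCompact_closedBall (0 : EuclideanSpace ℝ (Fin n)) 1).exists_bound_of_continuousOn hu
  have huc := (isCompact_closedBall (0 : EuclideanSpace ℝ (Fin n)) 1).uniformContinuousOn_of_continuous hu
  rw [Metric.uniformContinuousOn_iff] at huc
  have hA := area_pos hn
  set W : EuclideanSpace ℝ (Fin n) → ℝ := fun x =>
    (∫ η : USphere n, pKer x (η : EuclideanSpace ℝ (Fin n)) * u η ∂(surf n)) - area n * u x with hW
  have hC0 : 0 ≤ C := (norm_nonneg _).trans (hC 0 (by simp))
  -- Boundary control of the difference W. Boundary points within δ of z contribute at most ε by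
  -- uniform continuity; at the others the kernel is at most (1 - ‖z‖²)/δ^n, which vanishes as ‖z‖
  -- tends to 1.
  have bd : ∀ ε > 0, ∃ δ > 0, ∀ z : EuclideanSpace ℝ (Fin n), ‖z‖ < 1 →
      |W z| ≤ ε * area n + (1 - ‖z‖ ^ 2) / δ ^ n * (2 * C) * area n := by
    intro ε hε
    obtain ⟨δ, hδ, h⟩ := huc ε hε
    refine ⟨δ, hδ, fun z hz => ?_⟩
    have hzb : z ∈ Metric.closedBall (0 : EuclideanSpace ℝ (Fin n)) 1 := by
      rw [mem_closedBall_zero_iff]; exact hz.le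
    have e : W z = ∫ η : USphere n,
        pKer z (η : EuclideanSpace ℝ (Fin n)) * (u η - u z) ∂(surf n) := by
      simp only [hW, mul_sub]
      rw [integral_sub (integrable_pKer_mul hz hψ) (integrable_pKer_mul hz continuous_const),
        integral_mul_const, integral_pKer hn hz]
    have hi : Integrable (fun η : USphere n => pKer z (η : EuclideanSpace ℝ (Fin n)) * ε)
      (surf n) := integrable_pKer_mul hz continuous_const
    have hz2 : 0 ≤ 1 - ‖z‖ ^ 2 := by nlinarith [norm_nonneg z]
    rw [e, ← Real.norm_eq_abs]
    calc _ ≤ ∫ η : USphere n, (pKer z (η : EuclideanSpace ℝ (Fin n)) * ε +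
          (1 - ‖z‖ ^ 2) / δ ^ n * (2 * C)) ∂(surf n) := by
          refine norm_integral_le_of_norm_le (hi.add (integrable_const _))
            (Eventually.of_forall fun η => ?_)
          have hp := pKer_nonneg (y := (η : EuclideanSpace ℝ (Fin n))) hz.le
          have hηb : (η : EuclideanSpace ℝ (Fin n)) ∈ Metric.closedBall 0 1 := by
            rw [mem_closedBall_zero_iff, η.norm_eq]
          rw [norm_mul, Real.norm_of_nonneg hp]
          by_cases hd : dist (η : EuclideanSpace ℝ (Fin n)) z < δ
          · have h1 := h _ hηb _ hzb hd
            rw [dist_eq_norm_sub] at h1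
            have : 0 ≤ (1 - ‖z‖ ^ 2) / δ ^ n * (2 * C) := by positivity
            nlinarith
          · rw [dist_comm, dist_eq_norm_sub, not_lt] at hd
            have h1 : ‖u η - u z‖ ≤ 2 * C := (norm_sub_le _ _).trans (by
              linarith [hC _ hηb, hC _ hzb])
            have h2 := pKer_le hδ hd hz.le
            have h3 : 0 ≤ pKer z (η : EuclideanSpace ℝ (Fin n)) * ε := by positivity
            have := mul_le_mul h2 h1 (norm_nonneg _) (hp.trans h2)
            linarith
      _ = _ := by
          rw [integral_add hi (integrable_const _), integral_mul_const, integral_pKer hn hz,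
            integral_const, measureReal_surf_univ hn, smul_eq_mul]
          ring
  have hWd : ∀ z : EuclideanSpace ℝ (Fin n), ‖z‖ < 1 → IsDiscHarmonicAt W z := fun z hz =>
    (poissonInt_isDiscHarmonicAt hψ hz).sub ((hd z hz).const_mul _)
  -- W is defined on the open ball only by its integral, so the maximum principle is applied on
  -- balls of radius ρ < 1, and then ρ tends to 1.
  have main : ∀ ε > 0, |W x| ≤ ε * area n := by
    intro ε hε
    obtain ⟨δ, hδ, h⟩ := bd ε hε
    have hlim : Tendsto (fun ρ : ℝ => ε * area n + (1 - ρ ^ 2) / δ ^ n * (2 * C) * area n)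
        (𝓝[<] 1) (𝓝 (ε * area n)) := by
      have : Continuous fun ρ : ℝ =>
        ε * area n + (1 - ρ ^ 2) / δ ^ n * (2 * C) * area n := by fun_prop
      have := (this.tendsto 1).mono_left (nhdsWithin_le_nhds (s := Iio 1))
      simpa using this
    refine ge_of_tendsto hlim ?_
    filter_upwards [Ioo_mem_nhdsLT hx] with ρ hρ
    have hρ0 : 0 < ρ := (norm_nonneg x).trans_lt hρ.1
    have hWc : ContinuousOn W (Metric.closedBall 0 ρ) :=
      (continuousOn_poissonInt hψ hρ.2).sub
        (continuousOn_const.mul (hu.mono (Metric.closedBall_subset_closedBall hρ.2.le)))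
    have hxρ : x ∈ Metric.closedBall 0 ρ := by rw [mem_closedBall_zero_iff]; exact hρ.1.le
    have hs : ∀ z ∈ Metric.sphere (0 : EuclideanSpace ℝ (Fin n)) ρ,
        |W z| ≤ ε * area n + (1 - ρ ^ 2) / δ ^ n * (2 * C) * area n := by
      intro z hz
      have hz := mem_sphere_zero_iff_norm.1 hz
      have := h z (hz ▸ hρ.2)
      rwa [hz] at this
    have hball : ∀ z ∈ Metric.ball (0 : EuclideanSpace ℝ (Fin n)) ρ, ‖z‖ < 1 := fun z hz =>
      (mem_ball_zero_iff.1 hz).trans hρ.2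
    have u1 := le_of_isDiscHarmonicAt hn hρ0 hWc (fun z hz => hWd z (hball z hz))
      (fun z hz => (le_abs_self _).trans (hs z hz)) hxρ
    have u2 := ge_of_isDiscHarmonicAt hn hρ0 hWc (fun z hz => hWd z (hball z hz))
      (fun z hz => (abs_le.1 (hs z hz)).1) hxρ
    exact abs_le.2 ⟨u2, u1⟩
  have : |W x| ≤ 0 := by
    refine le_of_forall_pos_le_add fun ε hε => ?_
    have := main (ε / area n) (by positivity)
    rw [div_mul_cancel₀ _ hA.ne'] at this
    linarith
  have := abs_nonpos_iff.1 this
  simp only [hW] at this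
  linarith

/-- The semigroup property of the Poisson kernel. -/
theorem integral_pKer_mul_pKer (hn : 0 < n) (hx : ‖x‖ < 1) {ζ : EuclideanSpace ℝ (Fin n)}
    (hζ : ‖ζ‖ = 1) {b : ℝ} (hb0 : 0 ≤ b) (hb : b < 1) :
    ∫ η : USphere n, pKer x (η : EuclideanSpace ℝ (Fin n)) *
      pKer (b • (η : EuclideanSpace ℝ (Fin n))) ζ ∂(surf n) = area n * pKer (b • x) ζ := by
  have hlt : ∀ z : EuclideanSpace ℝ (Fin n), ‖z‖ ≤ 1 → ‖b • z‖ < 1 := fun z hz => by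
    rw [norm_smul, Real.norm_of_nonneg hb0]; nlinarith [norm_nonneg z]
  -- Since b < 1, the dilated kernel is harmonic and continuous up to the boundary, so it is
  -- reproduced by its own boundary values.
  refine poissonInt_eq_of_isDiscHarmonicAt hn (u := fun z => pKer (b • z) ζ) ?_ ?_ hx
  · unfold pKer
    refine ContinuousOn.div (by fun_prop) (by fun_prop) fun z hz => ?_
    have := one_sub_le_norm_sub (x := b • z) hζ
    exact pow_ne_zero _ (by linarith [hlt z (mem_closedBall_zero_iff.1 hz)])
  · exact fun z hz => IsDiscHarmonicAt.comp_smul (V := fun z => pKer z ζ) hb0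
      (pKer_isDiscHarmonicAt hζ (hlt z hz.le))

end


/-! ### The maximal ergodic theorem -/

section hopf
variable {X : Type*}

/-- The recursive majorant of the partial sums `∑_{k < N} T^k g` for `N ≤ K`. -/
def hopfMax (T : (X → ℝ) → X → ℝ) (g : X → ℝ) : ℕ → X → ℝ
  | 0 => fun _ => 0
  | K + 1 => fun x => max 0 (g x + T (hopfMax T g K) x)

variable {T : (X → ℝ) → X → ℝ} {g : X → ℝ}

theorem hopfMax_nonneg (K : ℕ) (x : X) : 0 ≤ hopfMax T g K x := by
  cases K with
  | zero => exact le_rfl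
  | succ K => exact le_max_left _ _

variable [MeasurableSpace X] {μ : Measure X}

theorem hopfMax_integrable (hi : ∀ f, Integrable f μ → Integrable (T f) μ) (hg : Integrable g μ)
    (K : ℕ) : Integrable (hopfMax T g K) μ := by
  induction K with
  | zero => exact integrable_zero _ _ _
  | succ K ih => exact (integrable_zero _ _ _).sup (hg.add (hi _ ih))

theorem hopfMax_mono (hi : ∀ f, Integrable f μ → Integrable (T f) μ)
    (hm : ∀ f h, Integrable f μ → Integrable h μ → (∀ x, f x ≤ h x) → ∀ x, T f x ≤ T h x)
    (hg : Integrable g μ) (K : ℕ) (x : X) : hopfMax T g K x ≤ hopfMax T g (K + 1) x := by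
  induction K generalizing x with
  | zero => exact hopfMax_nonneg _ _
  | succ K ih =>
    exact max_le_max le_rfl (add_le_add le_rfl
      (hm _ _ (hopfMax_integrable hi hg _) (hopfMax_integrable hi hg _) ih x))

/-- The partial sums enter only through their recursion, so monotonicity of T is enough and its
linearity plays no role here. -/
theorem partialSum_le_hopfMax {S : ℕ → X → ℝ} (hi : ∀ f, Integrable f μ → Integrable (T f) μ)
    (hm : ∀ f h, Integrable f μ → Integrable h μ → (∀ x, f x ≤ h x) → ∀ x, T f x ≤ T h x)
    (hg : Integrable g μ) (hS : ∀ N, Integrable (S N) μ) (h0 : ∀ x, S 0 x = 0)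
    (hsucc : ∀ N x, S (N + 1) x = g x + T (S N) x) (N : ℕ) (x : X) :
    S N x ≤ hopfMax T g N x := by
  induction N generalizing x with
  | zero => exact (h0 x).le
  | succ N ih =>
    rw [hsucc]
    exact (add_le_add le_rfl (hm _ _ (hS N) (hopfMax_integrable hi hg _) ih x)).trans
      (le_max_right _ _)

/-- Garsia's proof of Hopf's lemma. Let M_K be the majorants. On the set where M_(K+1) > 0 one has g
= M_(K+1) - T M_K; off it M_(K+1) vanishes while T M_K ≥ 0. So the integral of g is at least that of
M_(K+1) - T M_K over the whole space, which is nonnegative because T preserves integrals and M_K ≤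
M_(K+1). -/
theorem integral_hopfMax_pos_nonneg (hi : ∀ f, Integrable f μ → Integrable (T f) μ)
    (hm : ∀ f h, Integrable f μ → Integrable h μ → (∀ x, f x ≤ h x) → ∀ x, T f x ≤ T h x)
    (hnn : ∀ f, (∀ x, 0 ≤ f x) → ∀ x, 0 ≤ T f x)
    (hint : ∀ f, Integrable f μ → ∫ x, T f x ∂μ = ∫ x, f x ∂μ)
    (hg : Integrable g μ) (hgm : ∀ K, Measurable (hopfMax T g K)) (K : ℕ) :
    0 ≤ ∫ x in {x | 0 < hopfMax T g (K + 1) x}, g x ∂μ := by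
  set E := {x | 0 < hopfMax T g (K + 1) x} with hE
  have hEm : MeasurableSet E := measurableSet_lt measurable_const (hgm _)
  have i1 := hopfMax_integrable hi hg (K + 1)
  have i0 := hopfMax_integrable hi hg K
  have e1 : ∫ x in E, g x ∂μ = ∫ x in E, hopfMax T g (K + 1) x ∂μ -
      ∫ x in E, T (hopfMax T g K) x ∂μ := by
    rw [← integral_sub i1.integrableOn (hi _ i0).integrableOn]
    refine setIntegral_congr_fun hEm fun x hx => ?_
    have hx : 0 < hopfMax T g (K + 1) x := hx
    change 0 < max 0 (g x + T (hopfMax T g K) x) at hx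
    change g x = max 0 (g x + T (hopfMax T g K) x) - _
    have : 0 < g x + T (hopfMax T g K) x := by
      rcases lt_max_iff.1 hx with h | h
      · exact absurd h (lt_irrefl _)
      · exact h
    rw [max_eq_right this.le]; ring
  have e2 : ∫ x in E, hopfMax T g (K + 1) x ∂μ = ∫ x, hopfMax T g (K + 1) x ∂μ :=
    setIntegral_eq_integral_of_forall_compl_eq_zero fun x hx =>
      le_antisymm (not_lt.1 hx) (hopfMax_nonneg _ _)
  have e3 : ∫ x in E, T (hopfMax T g K) x ∂μ ≤ ∫ x, T (hopfMax T g K) x ∂μ :=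
    setIntegral_le_integral (hi _ i0) (Eventually.of_forall fun x => hnn _ (hopfMax_nonneg K) x)
  have e4 : ∫ x, hopfMax T g K x ∂μ ≤ ∫ x, hopfMax T g (K + 1) x ∂μ :=
    integral_mono i0 i1 fun x => hopfMax_mono hi hm hg K x
  rw [hint _ i0] at e3
  linarith

end hopf

/-! ### The normalized Poisson kernel on the sphere -/

/-- The Poisson kernel of the sphere. -/
noncomputable def poissonK {n : ℕ} (r : ℝ) (ξ η : USphere n) : ℝ :=
  pKer (r • (ξ : EuclideanSpace ℝ (Fin n))) (η : EuclideanSpace ℝ (Fin n)) / area n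

/-- The Poisson integral of a nonnegative function. -/
noncomputable def lPoisson {n : ℕ} (r : ℝ) (f : USphere n → ℝ≥0∞) (ξ : USphere n) : ℝ≥0∞ :=
  ∫⁻ η, ENNReal.ofReal (poissonK r ξ η) * f η ∂(surf n)

section
variable {n : ℕ}

@[fun_prop]
theorem measurable_poissonK {X : Type*} [MeasurableSpace X] {r : X → ℝ} {ξ η : X → USphere n}
    (hr : Measurable r) (hξ : Measurable ξ) (hη : Measurable η) :
    Measurable fun x => poissonK (r x) (ξ x) (η x) := by
  unfold poissonK pKer
  fun_prop

theorem norm_smul_sphere {r : ℝ} (hr : 0 ≤ r) (ξ : USphere n) :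
    ‖r • (ξ : EuclideanSpace ℝ (Fin n))‖ = r := by
  rw [norm_smul, ξ.norm_eq, mul_one, Real.norm_of_nonneg hr]

theorem poissonK_nonneg (hn : 0 < n) {r : ℝ} (h0 : 0 ≤ r) (h1 : r < 1) (ξ η : USphere n) :
    0 ≤ poissonK r ξ η :=
  div_nonneg (pKer_nonneg (by rw [norm_smul_sphere h0]; exact h1.le)) (area_pos hn).le

theorem poissonK_comm (r : ℝ) (ξ η : USphere n) : poissonK r ξ η = poissonK r η ξ := by
  rw [poissonK, pKer_smul_comm ξ.norm_eq η.norm_eq, poissonK]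

theorem poissonK_le (hn : 0 < n) {r : ℝ} (h0 : 0 ≤ r) (h1 : r < 1) (ξ η : USphere n) :
    poissonK r ξ η ≤ 1 / (1 - r) ^ n / area n := by
  have := area_pos hn
  unfold poissonK
  gcongr
  exact pKer_le_of_norm_le h1 (norm_smul_sphere h0 ξ).le η.norm_eq

theorem integrable_poissonK (hn : 0 < n) {r : ℝ} (h0 : 0 ≤ r) (h1 : r < 1) (ξ : USphere n) :
    Integrable (poissonK r ξ) (surf n) := by
  refine Integrable.of_bound (by fun_prop) (1 / (1 - r) ^ n / area n)
    (Eventually.of_forall fun η => ?_)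
  rw [Real.norm_of_nonneg (poissonK_nonneg hn h0 h1 ξ η)]
  exact poissonK_le hn h0 h1 ξ η

theorem integral_poissonK (hn : 0 < n) {r : ℝ} (h0 : 0 ≤ r) (h1 : r < 1) (ξ : USphere n) :
    ∫ η, poissonK r ξ η ∂(surf n) = 1 := by
  unfold poissonK
  rw [integral_div, integral_pKer hn (by rw [norm_smul_sphere h0]; exact h1),
    div_self (area_pos hn).ne']

theorem lintegral_poissonK (hn : 0 < n) {r : ℝ} (h0 : 0 ≤ r) (h1 : r < 1) (ξ : USphere n) :
    ∫⁻ η, ENNReal.ofReal (poissonK r ξ η) ∂(surf n) = 1 := by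
  rw [← ofReal_integral_eq_lintegral_ofReal (integrable_poissonK hn h0 h1 ξ)
    (Eventually.of_forall (poissonK_nonneg hn h0 h1 ξ)), integral_poissonK hn h0 h1,
    ENNReal.ofReal_one]

theorem integral_poissonK_mul_poissonK (hn : 0 < n) {a b : ℝ} (a0 : 0 ≤ a) (a1 : a < 1)
    (b0 : 0 ≤ b) (b1 : b < 1) (ξ ζ : USphere n) :
    ∫ η, poissonK a ξ η * poissonK b η ζ ∂(surf n) = poissonK (a * b) ξ ζ := by
  have hA := (area_pos hn).ne'
  have := integral_pKer_mul_pKer (x := a • (ξ : EuclideanSpace ℝ (Fin n))) hn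
    (by rw [norm_smul_sphere a0]; exact a1) ζ.norm_eq b0 b1
  simp only [poissonK, div_mul_div_comm]
  rw [integral_div, this, smul_smul, mul_comm b a]
  field_simp

theorem lintegral_poissonK_mul_poissonK (hn : 0 < n) {a b : ℝ} (a0 : 0 ≤ a) (a1 : a < 1)
    (b0 : 0 ≤ b) (b1 : b < 1) (ξ ζ : USphere n) :
    ∫⁻ η, ENNReal.ofReal (poissonK a ξ η) * ENNReal.ofReal (poissonK b η ζ) ∂(surf n) =
      ENNReal.ofReal (poissonK (a * b) ξ ζ) := by
  rw [← integral_poissonK_mul_poissonK hn a0 a1 b0 b1, ofReal_integral_eq_lintegral_ofReal]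
  · simp_rw [ENNReal.ofReal_mul (poissonK_nonneg hn a0 a1 ξ _)]
  · refine (integrable_poissonK hn a0 a1 ξ).mul_bdd (c := 1 / (1 - b) ^ n / area n)
      (Measurable.aestronglyMeasurable (by fun_prop)) (Eventually.of_forall fun η => ?_)
    rw [Real.norm_of_nonneg (poissonK_nonneg hn b0 b1 _ _)]
    exact poissonK_le hn b0 b1 _ _
  · exact Eventually.of_forall fun η =>
      mul_nonneg (poissonK_nonneg hn a0 a1 _ _) (poissonK_nonneg hn b0 b1 _ _)

/-- Harnack's inequality for the Poisson kernel. -/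
theorem poissonK_harnack (hn : 0 < n) {r r' : ℝ} (h0 : 0 ≤ r) (hr : r ≤ r') (h1 : r' < 1)
    (h2 : 1 - r ≤ 2 * (1 - r')) (ξ η : USphere n) :
    poissonK r ξ η ≤ 2 ^ (n + 1) * poissonK r' ξ η := by
  have hA := area_pos hn
  have h0' : 0 ≤ r' := h0.trans hr
  unfold poissonK
  rw [← mul_div_assoc]
  gcongr
  unfold pKer
  rw [norm_smul_sphere h0, norm_smul_sphere h0', ← mul_div_assoc]
  have d1 : 1 - r ≤ ‖r • (ξ : EuclideanSpace ℝ (Fin n)) - η‖ := by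
    have := one_sub_le_norm_sub (x := r • (ξ : EuclideanSpace ℝ (Fin n))) η.norm_eq
    rwa [norm_smul_sphere h0] at this
  have d1' : 1 - r' ≤ ‖r' • (ξ : EuclideanSpace ℝ (Fin n)) - η‖ := by
    have := one_sub_le_norm_sub (x := r' • (ξ : EuclideanSpace ℝ (Fin n))) η.norm_eq
    rwa [norm_smul_sphere h0'] at this
  -- The two centres differ by r' - r ≤ 1 - r ≤ ‖rξ - η‖. The n-th power of this factor 2 and
  -- another factor 2 from the numerators make up 2^(n+1).
  have d2 : ‖r' • (ξ : EuclideanSpace ℝ (Fin n)) - η‖ ≤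
      2 * ‖r • (ξ : EuclideanSpace ℝ (Fin n)) - η‖ := by
    have e : r' • (ξ : EuclideanSpace ℝ (Fin n)) - η =
        (r' - r) • (ξ : EuclideanSpace ℝ (Fin n)) + (r • (ξ : EuclideanSpace ℝ (Fin n)) - η) := by
      rw [sub_smul]; abel
    rw [e]
    refine (norm_add_le _ _).trans ?_
    rw [norm_smul_sphere (sub_nonneg.2 hr)]
    linarith
  have p1 : 0 < ‖r • (ξ : EuclideanSpace ℝ (Fin n)) - η‖ := by linarith
  have p2 : 0 < ‖r' • (ξ : EuclideanSpace ℝ (Fin n)) - η‖ := by linarith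
  rw [div_le_div_iff₀ (pow_pos p1 n) (pow_pos p2 n)]
  have hpow : ‖r' • (ξ : EuclideanSpace ℝ (Fin n)) - η‖ ^ n ≤
      2 ^ n * ‖r • (ξ : EuclideanSpace ℝ (Fin n)) - η‖ ^ n := by
    rw [← mul_pow]; gcongr
  have hf : 1 - r ^ 2 ≤ 2 * (1 - r' ^ 2) := by nlinarith
  have hf0 : 0 ≤ 1 - r ^ 2 := by nlinarith
  calc (1 - r ^ 2) * ‖r' • (ξ : EuclideanSpace ℝ (Fin n)) - η‖ ^ n
      ≤ (2 * (1 - r' ^ 2)) * (2 ^ n * ‖r • (ξ : EuclideanSpace ℝ (Fin n)) - η‖ ^ n) :=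
        mul_le_mul hf hpow (by positivity) (hf0.trans hf)
    _ = _ := by ring

theorem measurable_lPoisson {r : ℝ} {f : USphere n → ℝ≥0∞} (hf : Measurable f) :
    Measurable (lPoisson r f) := by
  unfold lPoisson
  exact Measurable.lintegral_prod_right (by fun_prop)

theorem lPoisson_mono {r : ℝ} {f g : USphere n → ℝ≥0∞} (h : ∀ η, f η ≤ g η) (ξ : USphere n) :
    lPoisson r f ξ ≤ lPoisson r g ξ :=
  lintegral_mono fun η => mul_le_mul_right (h η) _

theorem lPoisson_harnack (hn : 0 < n) {r r' : ℝ} (h0 : 0 ≤ r) (hr : r ≤ r') (h1 : r' < 1)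
    (h2 : 1 - r ≤ 2 * (1 - r')) {f : USphere n → ℝ≥0∞} (hf : Measurable f) (ξ : USphere n) :
    lPoisson r f ξ ≤ 2 ^ (n + 1) * lPoisson r' f ξ := by
  unfold lPoisson
  rw [← lintegral_const_mul _ (by fun_prop)]
  refine lintegral_mono fun η => ?_
  rw [← mul_assoc]
  gcongr
  refine (ENNReal.ofReal_le_ofReal (poissonK_harnack hn h0 hr h1 h2 ξ η)).trans ?_
  rw [ENNReal.ofReal_mul (by positivity), ENNReal.ofReal_pow (by norm_num)]
  simp

theorem lPoisson_const (hn : 0 < n) {r : ℝ} (h0 : 0 ≤ r) (h1 : r < 1) (c : ℝ≥0∞)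
    (ξ : USphere n) : lPoisson r (fun _ => c) ξ = c := by
  unfold lPoisson
  rw [lintegral_mul_const _ (by fun_prop), lintegral_poissonK hn h0 h1, one_mul]

theorem lPoisson_add {r : ℝ} {f g : USphere n → ℝ≥0∞} (hf : Measurable f) (ξ : USphere n) :
    lPoisson r (fun η => f η + g η) ξ = lPoisson r f ξ + lPoisson r g ξ := by
  unfold lPoisson
  rw [← lintegral_add_left (by fun_prop)]
  simp_rw [mul_add]

theorem lPoisson_const_mul {r : ℝ} (c : ℝ≥0∞) {f : USphere n → ℝ≥0∞} (hf : Measurable f)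
    (ξ : USphere n) : lPoisson r (fun η => c * f η) ξ = c * lPoisson r f ξ := by
  unfold lPoisson
  rw [← lintegral_const_mul _ (by fun_prop)]
  simp_rw [mul_left_comm]

theorem lPoisson_congr_ae {r : ℝ} {f g : USphere n → ℝ≥0∞} (h : f =ᵐ[surf n] g) (ξ : USphere n) :
    lPoisson r f ξ = lPoisson r g ξ :=
  lintegral_congr_ae (by filter_upwards [h] with η hη; rw [hη])

/-- The Poisson integral of a real function. -/
noncomputable def rPoisson (r : ℝ) (f : USphere n → ℝ) (ξ : USphere n) : ℝ :=
  ∫ η, poissonK r ξ η * f η ∂(surf n)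

theorem integrable_poissonK_mul (hn : 0 < n) {r : ℝ} (h0 : 0 ≤ r) (h1 : r < 1)
    {f : USphere n → ℝ} (hf : Integrable f (surf n)) (ξ : USphere n) :
    Integrable (fun η => poissonK r ξ η * f η) (surf n) := by
  refine hf.bdd_mul (c := 1 / (1 - r) ^ n / area n) (by fun_prop)
    (Eventually.of_forall fun η => ?_)
  rw [Real.norm_of_nonneg (poissonK_nonneg hn h0 h1 _ _)]
  exact poissonK_le hn h0 h1 _ _

theorem integrable_poissonK_mul_prod (hn : 0 < n) {r : ℝ} (h0 : 0 ≤ r) (h1 : r < 1)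
    {f : USphere n → ℝ} (hf : Integrable f (surf n)) :
    Integrable (fun p : USphere n × USphere n => poissonK r p.1 p.2 * f p.2)
      ((surf n).prod (surf n)) := by
  refine (hf.comp_snd (surf n)).bdd_mul (c := 1 / (1 - r) ^ n / area n)
    (by fun_prop) (Eventually.of_forall fun η => ?_)
  rw [Real.norm_of_nonneg (poissonK_nonneg hn h0 h1 _ _)]
  exact poissonK_le hn h0 h1 _ _

theorem integrable_rPoisson (hn : 0 < n) {r : ℝ} (h0 : 0 ≤ r) (h1 : r < 1)
    {f : USphere n → ℝ} (hf : Integrable f (surf n)) : Integrable (rPoisson r f) (surf n) :=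
  (integrable_poissonK_mul_prod hn h0 h1 hf).integral_prod_left

theorem integral_rPoisson (hn : 0 < n) {r : ℝ} (h0 : 0 ≤ r) (h1 : r < 1)
    {f : USphere n → ℝ} (hf : Integrable f (surf n)) :
    ∫ ξ, rPoisson r f ξ ∂(surf n) = ∫ η, f η ∂(surf n) := by
  unfold rPoisson
  rw [integral_integral_swap (integrable_poissonK_mul_prod hn h0 h1 hf)]
  refine integral_congr_ae (Eventually.of_forall fun η => ?_)
  simp only [integral_mul_const, poissonK_comm r _ η, integral_poissonK hn h0 h1, one_mul]

theorem rPoisson_mono (hn : 0 < n) {r : ℝ} (h0 : 0 ≤ r) (h1 : r < 1)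
    {f g : USphere n → ℝ} (hf : Integrable f (surf n)) (hg : Integrable g (surf n))
    (h : ∀ x, f x ≤ g x) (ξ : USphere n) : rPoisson r f ξ ≤ rPoisson r g ξ :=
  integral_mono (integrable_poissonK_mul hn h0 h1 hf ξ) (integrable_poissonK_mul hn h0 h1 hg ξ)
    fun η => mul_le_mul_of_nonneg_left (h η) (poissonK_nonneg hn h0 h1 _ _)

theorem rPoisson_nonneg (hn : 0 < n) {r : ℝ} (h0 : 0 ≤ r) (h1 : r < 1)
    {f : USphere n → ℝ} (h : ∀ x, 0 ≤ f x) (ξ : USphere n) : 0 ≤ rPoisson r f ξ :=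
  integral_nonneg fun η => mul_nonneg (poissonK_nonneg hn h0 h1 _ _) (h η)

theorem measurable_rPoisson {r : ℝ} {f : USphere n → ℝ} (hf : Measurable f) :
    Measurable (rPoisson r f) := by
  unfold rPoisson
  exact (StronglyMeasurable.integral_prod_right (f := fun ξ η : USphere n => poissonK r ξ η * f η)
    (Measurable.stronglyMeasurable (by unfold Function.uncurry; fun_prop))).measurable

theorem rPoisson_rPoisson (hn : 0 < n) {a b : ℝ} (a0 : 0 ≤ a) (a1 : a < 1)
    (b0 : 0 ≤ b) (b1 : b < 1) {f : USphere n → ℝ} (hf : Integrable f (surf n)) (ξ : USphere n) :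
    rPoisson a (rPoisson b f) ξ = rPoisson (a * b) f ξ := by
  unfold rPoisson
  simp_rw [← integral_const_mul]
  rw [integral_integral_swap]
  · refine integral_congr_ae (Eventually.of_forall fun ζ => ?_)
    simp only [← mul_assoc, integral_mul_const]
    rw [integral_poissonK_mul_poissonK hn a0 a1 b0 b1]
  · refine (integrable_poissonK_mul_prod hn b0 b1 hf).bdd_mul (c := 1 / (1 - a) ^ n / area n)
      (Measurable.aestronglyMeasurable (by fun_prop)) (Eventually.of_forall fun η => ?_)
    rw [Real.norm_of_nonneg (poissonK_nonneg hn a0 a1 _ _)]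
    exact poissonK_le hn a0 a1 _ _

theorem rPoisson_sub_const (hn : 0 < n) {r : ℝ} (h0 : 0 ≤ r) (h1 : r < 1)
    {f : USphere n → ℝ} (hf : Integrable f (surf n)) (c : ℝ) (ξ : USphere n) :
    rPoisson r (fun x => f x - c) ξ = rPoisson r f ξ - c := by
  unfold rPoisson
  simp_rw [mul_sub]
  rw [integral_sub (integrable_poissonK_mul hn h0 h1 hf ξ)
    ((integrable_poissonK hn h0 h1 ξ).mul_const c), integral_mul_const,
    integral_poissonK hn h0 h1, one_mul]

theorem lPoisson_ofReal (hn : 0 < n) {r : ℝ} (h0 : 0 ≤ r) (h1 : r < 1)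
    {f : USphere n → ℝ} (hf : Integrable f (surf n)) (hf0 : ∀ x, 0 ≤ f x) (ξ : USphere n) :
    lPoisson r (fun η => ENNReal.ofReal (f η)) ξ = ENNReal.ofReal (rPoisson r f ξ) := by
  unfold lPoisson rPoisson
  rw [ofReal_integral_eq_lintegral_ofReal (integrable_poissonK_mul hn h0 h1 hf ξ)
    (Eventually.of_forall fun η => mul_nonneg (poissonK_nonneg hn h0 h1 _ _) (hf0 η))]
  simp_rw [ENNReal.ofReal_mul (poissonK_nonneg hn h0 h1 ξ _)]

end


section
variable {n : ℕ}

/-! ### The radial maximal function -/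

/-- The radii `exp (-2^(-j))` used in the definition of the radial maximal function. -/
noncomputable def maxRadius (j : ℕ) : ℝ := Real.exp (-(1 / 2) ^ j)

/-- The radial maximal function of the Poisson integral. -/
noncomputable def poissonMax (f : USphere n → ℝ≥0∞) (ξ : USphere n) : ℝ≥0∞ :=
  ⨆ j, lPoisson (maxRadius j) f ξ

theorem maxRadius_pos (j : ℕ) : 0 < maxRadius j := Real.exp_pos _

theorem maxRadius_lt_one (j : ℕ) : maxRadius j < 1 := by
  rw [maxRadius, Real.exp_lt_one_iff]; simp

/-- Squaring moves one step down the sequence of radii. All radii with index up to J + 1 are thus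
powers of the last one, which relates the radial maximal function to ergodic averages of a single
operator. -/
theorem maxRadius_pow (j k : ℕ) : maxRadius (j + k) ^ 2 ^ k = maxRadius j := by
  rw [maxRadius, maxRadius, ← Real.exp_nat_mul]
  congr 1
  push_cast
  rw [pow_add, mul_neg, mul_left_comm, ← mul_pow]
  norm_num

theorem tendsto_maxRadius : Tendsto maxRadius atTop (𝓝 1) := by
  have h1 : Tendsto (fun j : ℕ => ((1 : ℝ) / 2) ^ j) atTop (𝓝 0) :=
    tendsto_pow_atTop_nhds_zero_of_lt_one (by norm_num) (by norm_num)
  have := (Real.continuous_exp.tendsto (-0)).comp h1.neg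
  rwa [neg_zero, Real.exp_zero] at this

/-- The special radii are dense enough for Harnack's inequality: the first one that is at least r
has 1 - r at most twice its distance to 1. -/
theorem lPoisson_le_poissonMax (hn : 0 < n) {r : ℝ} (h0 : 0 ≤ r) (h1 : r < 1)
    {f : USphere n → ℝ≥0∞} (hf : Measurable f) (ξ : USphere n) :
    lPoisson r f ξ ≤ 2 ^ (n + 1) * poissonMax f ξ := by
  have hex : ∃ j, r ≤ maxRadius j := by
    obtain ⟨j, hj⟩ := (tendsto_maxRadius.eventually (eventually_gt_nhds h1)).exists
    exact ⟨j, hj.le⟩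
  classical
  have key : ∃ j, r ≤ maxRadius j ∧ 1 - r ≤ 2 * (1 - maxRadius j) := by
    refine ⟨Nat.find hex, Nat.find_spec hex, ?_⟩
    -- If the first such radius is r₀ = 1/e, then 2(1 - r₀) ≥ 1. Otherwise the preceding radius is
    -- the square of the chosen one R and is below r, so 1 - r < 1 - R² ≤ 2(1 - R).
    rcases hj : Nat.find hex with _ | i
    · have : maxRadius 0 ≤ 1 / 2 := by
        have := Real.exp_neg_one_lt_half
        simp only [maxRadius, pow_zero]
        exact (this.trans_eq (by norm_num)).le
      linarith
    · have hi : maxRadius i < r := not_le.1 (Nat.find_min hex (by omega))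
      have e := maxRadius_pow i 1
      have := maxRadius_pos (i + 1)
      have := maxRadius_lt_one (i + 1)
      norm_num at e
      nlinarith
  obtain ⟨j, hj1, hj2⟩ := key
  refine (lPoisson_harnack hn h0 hj1 (maxRadius_lt_one j) hj2 hf ξ).trans ?_
  gcongr
  exact le_iSup (fun j => lPoisson (maxRadius j) f ξ) j

theorem measurable_poissonMax {f : USphere n → ℝ≥0∞} (hf : Measurable f) :
    Measurable (poissonMax f) :=
  Measurable.iSup fun _ => measurable_lPoisson hf

theorem rPoisson_harnack (hn : 0 < n) {r r' : ℝ} (h0 : 0 ≤ r) (hr : r ≤ r') (h1 : r' < 1)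
    (h2 : 1 - r ≤ 2 * (1 - r')) {f : USphere n → ℝ} (hf : Integrable f (surf n))
    (hf0 : ∀ x, 0 ≤ f x) (ξ : USphere n) :
    rPoisson r f ξ ≤ 2 ^ (n + 1) * rPoisson r' f ξ := by
  unfold rPoisson
  rw [← integral_const_mul]
  refine integral_mono (integrable_poissonK_mul hn h0 (hr.trans_lt h1) hf ξ)
    ((integrable_poissonK_mul hn (h0.trans hr) h1 hf ξ).const_mul _) fun η => ?_
  simp only [← mul_assoc]
  exact mul_le_mul_of_nonneg_right (poissonK_harnack hn h0 hr h1 h2 ξ η) (hf0 η)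

/-- The iterates of the Poisson operator with parameter `ρ`. -/
noncomputable def poissonIter (ρ : ℝ) (f : USphere n → ℝ) (k : ℕ) : USphere n → ℝ :=
  -- At radius 1 the kernel formula has numerator 0 and would give the zero operator instead of the
  -- identity.
  if k = 0 then f else rPoisson (ρ ^ k) f

theorem integrable_poissonIter (hn : 0 < n) {ρ : ℝ} (h0 : 0 ≤ ρ) (h1 : ρ < 1)
    {f : USphere n → ℝ} (hf : Integrable f (surf n)) (k : ℕ) :
    Integrable (poissonIter ρ f k) (surf n) := by
  unfold poissonIter
  split_ifs with h
  · exact hf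
  · exact integrable_rPoisson hn (pow_nonneg h0 k) (pow_lt_one₀ h0 h1 h) hf

theorem rPoisson_poissonIter (hn : 0 < n) {ρ : ℝ} (h0 : 0 ≤ ρ) (h1 : ρ < 1)
    {f : USphere n → ℝ} (hf : Integrable f (surf n)) (k : ℕ) (ξ : USphere n) :
    rPoisson ρ (poissonIter ρ f k) ξ = poissonIter ρ f (k + 1) ξ := by
  unfold poissonIter
  rcases eq_or_ne k 0 with rfl | h
  · simp
  · rw [if_neg h, if_neg (Nat.succ_ne_zero k), rPoisson_rPoisson hn h0 h1 (pow_nonneg h0 k)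
      (pow_lt_one₀ h0 h1 h) hf, pow_succ']

/-- Hopf's inequality for g = f - λ on the set E where the majorant is positive: λ|E| is at most the
integral of f over E. -/
theorem lambda_measureReal_hopf_le (hn : 0 < n) {ρ lam : ℝ} (h0 : 0 ≤ ρ) (h1 : ρ < 1)
    {f : USphere n → ℝ} (hfm : Measurable f) (hf : Integrable f (surf n))
    (hf0 : ∀ x, 0 ≤ f x) (K : ℕ) :
    lam * (surf n).real {x | 0 < hopfMax (rPoisson ρ) (fun x => f x - lam) (K + 1) x} ≤
      ∫ x, f x ∂(surf n) := by
  have hg : Integrable (fun x => f x - lam) (surf n) := hf.sub (integrable_const _)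
  have hgm : ∀ K, Measurable (hopfMax (rPoisson ρ) (fun x => f x - lam) K) := by
    intro K
    induction K with
    | zero => exact measurable_const
    | succ K ih => exact measurable_const.max ((hfm.sub_const _).add (measurable_rPoisson ih))
  have := integral_hopfMax_pos_nonneg (μ := surf n) (T := rPoisson ρ)
    (g := fun x => f x - lam)
    (fun f hf => integrable_rPoisson hn h0 h1 hf)
    (fun f g hf hg => rPoisson_mono hn h0 h1 hf hg) (fun f hf => rPoisson_nonneg hn h0 h1 hf)
    (fun f hf => integral_rPoisson hn h0 h1 hf) hg hgm K
  rw [integral_sub hf.integrableOn (integrable_const _), integral_const, smul_eq_mul,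
    measureReal_restrict_apply_univ] at this
  have h2 := setIntegral_le_integral (s :=
    {x | 0 < hopfMax (rPoisson ρ) (fun x => f x - lam) (K + 1) x}) hf
    (Eventually.of_forall hf0)
  linarith

/-- The operator fixes constants, so the ergodic sums of f - λ are those of f minus Nλ. -/
theorem sum_poissonIter_le_hopfMax (hn : 0 < n) {ρ lam : ℝ} (h0 : 0 ≤ ρ) (h1 : ρ < 1)
    {f : USphere n → ℝ} (hf : Integrable f (surf n)) (N : ℕ) (x : USphere n) :
    ∑ k ∈ Finset.range N, poissonIter ρ f k x - N * lam ≤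
      hopfMax (rPoisson ρ) (fun x => f x - lam) N x := by
  have hi : ∀ N : ℕ, Integrable
      (fun x => ∑ k ∈ Finset.range N, poissonIter ρ f k x) (surf n) := fun N =>
    integrable_finsetSum _ fun k _ => integrable_poissonIter hn h0 h1 hf k
  refine partialSum_le_hopfMax (μ := surf n) (g := fun x => f x - lam)
    (S := fun N x => ∑ k ∈ Finset.range N, poissonIter ρ f k x - N * lam)
    (fun f hf => integrable_rPoisson hn h0 h1 hf)
    (fun f g hf hg => rPoisson_mono hn h0 h1 hf hg) (hf.sub (integrable_const _))
    (fun N => (hi N).sub (integrable_const _)) (by simp) ?_ N x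
  intro N x
  rw [rPoisson_sub_const hn h0 h1 (hi N), Finset.sum_range_succ']
  have : rPoisson ρ (fun x => ∑ k ∈ Finset.range N, poissonIter ρ f k x) x =
      ∑ k ∈ Finset.range N, poissonIter ρ f (k + 1) x := by
    simp_rw [← rPoisson_poissonIter hn h0 h1 hf]
    unfold rPoisson
    simp_rw [Finset.mul_sum]
    rw [integral_finsetSum]
    exact fun k _ => integrable_poissonK_mul hn h0 h1 (integrable_poissonIter hn h0 h1 hf k) x
  rw [this]
  have e0 : poissonIter ρ f 0 x = f x := by simp [poissonIter]
  rw [e0]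
  push_cast
  ring

/-- With ρ the radius of index J + 1, the radius of index j ≤ J is ρ^(2M), where M = 2^(J-j). If the
Poisson integral at this radius exceeds 2^(n+1)·2λ, Harnack's inequality makes it exceed 2λ at every
radius ρ^k with M ≤ k < 2M. These M terms alone push the ergodic sum of length 2M above 2Mλ, so the
point lies in the set controlled by Hopf's inequality. -/
theorem measure_exists_rPoisson_gt_le (hn : 0 < n) {lam : ℝ} (hlam : 0 < lam)
    {f : USphere n → ℝ} (hfm : Measurable f) (hf : Integrable f (surf n))
    (hf0 : ∀ x, 0 ≤ f x) (J : ℕ) :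
    surf n {ξ | ∃ j ≤ J, 2 ^ (n + 2) * lam < rPoisson (maxRadius j) f ξ} ≤
      ENNReal.ofReal (lam⁻¹ * ∫ x, f x ∂(surf n)) := by
  set ρ := maxRadius (J + 1) with hρ
  have h0 : 0 ≤ ρ := (maxRadius_pos _).le
  have h1 : ρ < 1 := maxRadius_lt_one _
  have hg : Integrable (fun x => f x - lam) (surf n) := hf.sub (integrable_const _)
  -- One ergodic majorant of length 2^(J+1) serves all j ≤ J, because 2M ≤ 2^(J+1) and the majorants
  -- increase.
  obtain ⟨K, hK⟩ : ∃ K, 2 ^ (J + 1) = K + 1 := ⟨2 ^ (J + 1) - 1, by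
    have : 0 < 2 ^ (J + 1) := by positivity
    omega⟩
  have hsub : {ξ | ∃ j ≤ J, 2 ^ (n + 2) * lam < rPoisson (maxRadius j) f ξ} ⊆
      {x | 0 < hopfMax (rPoisson ρ) (fun x => f x - lam) (K + 1) x} := by
    rintro ξ ⟨j, hj, hξ⟩
    set M := 2 ^ (J - j) with hM
    have hMpos : 0 < M := by positivity
    have hr : maxRadius j = ρ ^ (2 * M) := by
      rw [← maxRadius_pow j (J - j + 1), hρ, hM, pow_succ']
      congr 2; omega
    have hterm : ∀ k ∈ Finset.Ico M (2 * M), 2 * lam < poissonIter ρ f k ξ := by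
      intro k hk
      rw [Finset.mem_Ico] at hk
      have hk0 : k ≠ 0 := by omega
      have hp0 : 0 ≤ ρ ^ k := pow_nonneg h0 k
      have hp1 : ρ ^ k < 1 := pow_lt_one₀ h0 h1 hk0
      rw [poissonIter, if_neg hk0]
      have hle : ρ ^ (2 * M) ≤ ρ ^ k := pow_le_pow_of_le_one h0 h1.le hk.2.le
      have hle2 : (ρ ^ k) ^ 2 ≤ ρ ^ (2 * M) := by
        rw [← pow_mul]; exact pow_le_pow_of_le_one h0 h1.le (by omega)
      have hH := rPoisson_harnack hn (pow_nonneg h0 (2 * M)) hle hp1 (by nlinarith) hf hf0 ξ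
      rw [hr] at hξ
      have h3 := hξ.trans_le hH
      rw [pow_succ _ (n + 1), mul_assoc] at h3
      exact lt_of_mul_lt_mul_left h3 (by positivity)
    have hsum : 2 * M * lam < ∑ k ∈ Finset.range (2 * M), poissonIter ρ f k ξ := by
      have e1 := Finset.sum_lt_sum_of_nonempty (Finset.nonempty_Ico.2 (by omega)) hterm
      rw [Finset.sum_const, Nat.card_Ico, nsmul_eq_mul, show 2 * M - M = M by omega] at e1
      have e2 : ∑ k ∈ Finset.Ico M (2 * M), poissonIter ρ f k ξ ≤
          ∑ k ∈ Finset.range (2 * M), poissonIter ρ f k ξ := by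
        refine Finset.sum_le_sum_of_subset_of_nonneg ?_ fun k _ _ => ?_
        · intro k hk
          rw [Finset.mem_Ico] at hk
          exact Finset.mem_range.2 hk.2
        · unfold poissonIter
          split_ifs with h
          · exact hf0 ξ
          · exact rPoisson_nonneg hn (pow_nonneg h0 k) (pow_lt_one₀ h0 h1 h) hf0 ξ
      linarith
    have h4 := sum_poissonIter_le_hopfMax hn (lam := lam) h0 h1 hf (2 * M) ξ
    have h5 := monotone_nat_of_le_succ (f := fun N => hopfMax (rPoisson ρ) (fun x => f x - lam) N ξ)
      (fun N => hopfMax_mono (μ := surf n) (fun f hf => integrable_rPoisson hn h0 h1 hf)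
        (fun f g hf hg => rPoisson_mono hn h0 h1 hf hg) hg N ξ)
    have h6 : 2 * M ≤ K + 1 := by
      rw [← hK, hM, ← pow_succ']
      exact Nat.pow_le_pow_right (by norm_num) (by omega)
    have h7 := h5 h6
    push_cast at h4
    exact lt_of_lt_of_le (by linarith) h7
  have hmeas := lambda_measureReal_hopf_le hn (lam := lam) h0 h1 hfm hf hf0 K
  refine (measure_mono hsub).trans ?_
  rw [← ofReal_measureReal]
  refine ENNReal.ofReal_le_ofReal ?_
  rw [← div_eq_inv_mul, le_div_iff₀ hlam, mul_comm]
  exact hmeas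

/-- The weak type estimate for the radial maximal function. -/
theorem measure_poissonMax_gt_le (hn : 0 < n) {lam : ℝ} (hlam : 0 < lam)
    {f : USphere n → ℝ≥0∞} (hf : Measurable f) :
    surf n {ξ | ENNReal.ofReal (2 ^ (n + 2) * lam) < poissonMax f ξ} ≤
      ENNReal.ofReal lam⁻¹ * ∫⁻ x, f x ∂(surf n) := by
  by_cases hfin : ∫⁻ x, f x ∂(surf n) = ∞
  · rw [hfin, ENNReal.mul_top (by simpa using hlam)]
    exact le_top
  have hae : (fun x => ENNReal.ofReal (f x).toReal) =ᵐ[surf n] f := by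
    filter_upwards [ae_lt_top hf hfin] with x hx using ENNReal.ofReal_toReal hx.ne
  have hfi : Integrable (fun x => (f x).toReal) (surf n) :=
    integrable_toReal_of_lintegral_ne_top hf.aemeasurable hfin
  have hcon : ∀ j ξ, lPoisson (maxRadius j) f ξ =
      ENNReal.ofReal (rPoisson (maxRadius j) (fun x => (f x).toReal) ξ) := fun j ξ => by
    rw [← lPoisson_congr_ae hae, lPoisson_ofReal hn (maxRadius_pos j).le (maxRadius_lt_one j) hfi
      (fun _ => ENNReal.toReal_nonneg)]
  have hunion : {ξ | ENNReal.ofReal (2 ^ (n + 2) * lam) < poissonMax f ξ} =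
      ⋃ J : ℕ, {ξ | ∃ j ≤ J, 2 ^ (n + 2) * lam <
        rPoisson (maxRadius j) (fun x => (f x).toReal) ξ} := by
    ext ξ
    simp only [mem_ofPred_eq, mem_iUnion, poissonMax, lt_iSup_iff, hcon]
    constructor
    · rintro ⟨j, hj⟩
      exact ⟨j, j, le_rfl, (ENNReal.ofReal_lt_ofReal_iff_of_nonneg (by positivity)).1 hj⟩
    · rintro ⟨_, j, _, hj⟩
      exact ⟨j, (ENNReal.ofReal_lt_ofReal_iff_of_nonneg (by positivity)).2 hj⟩
  -- The bound does not depend on J, so it survives the increasing union.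
  rw [hunion, Monotone.measure_iUnion]
  · refine iSup_le fun J => (measure_exists_rPoisson_gt_le hn hlam hf.ennreal_toReal hfi
      (fun _ => ENNReal.toReal_nonneg) J).trans ?_
    rw [ENNReal.ofReal_mul (by positivity), integral_toReal hf.aemeasurable (ae_lt_top hf hfin),
      ENNReal.ofReal_toReal hfin]
  · rintro J J' hJ ξ ⟨j, hj, h⟩
    exact ⟨j, hj.trans hJ, h⟩

/-- Above L one has x = x^(1-p) x^p ≤ L^(1-p) x^p. This splits a function into a bounded part and a
multiple of its p-th power, to which weak type (1,1) applies. -/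
theorem le_add_rpow_mul {p L : ℝ} (hp : 1 < p) (hL : 0 < L) (x : ℝ≥0∞) :
    x ≤ ENNReal.ofReal L + ENNReal.ofReal (L ^ (1 - p)) * x ^ p := by
  rcases le_or_gt x (ENNReal.ofReal L) with h | h
  · exact h.trans le_self_add
  · refine le_trans ?_ le_add_self
    rcases eq_or_ne x ∞ with rfl | hx
    · rw [ENNReal.top_rpow_of_pos (by linarith), ENNReal.mul_top]
      simpa using Real.rpow_pos_of_pos hL _
    · lift x to NNReal using hx
      rw [← ENNReal.ofReal_coe_nnreal, ENNReal.ofReal_rpow_of_nonneg x.coe_nonneg (by linarith),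
        ← ENNReal.ofReal_mul (by positivity)]
      refine ENNReal.ofReal_le_ofReal ?_
      rw [← ENNReal.ofReal_coe_nnreal, ENNReal.ofReal_lt_ofReal_iff_of_nonneg hL.le] at h
      have hx0 : (0 : ℝ) < x := hL.trans h
      calc (x : ℝ) = x ^ (1 - p) * x ^ p := by
            rw [← Real.rpow_add hx0]; simp
        _ ≤ L ^ (1 - p) * x ^ p := by
            gcongr ?_ * _
            exact Real.rpow_le_rpow_of_nonpos hL h.le (by linarith)

theorem poissonMax_le_add (hn : 0 < n) {p L : ℝ} (hp : 1 < p) (hL : 0 < L)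
    {f : USphere n → ℝ≥0∞} (hf : Measurable f) (ξ : USphere n) :
    poissonMax f ξ ≤ ENNReal.ofReal L +
      ENNReal.ofReal (L ^ (1 - p)) * poissonMax (fun x => f x ^ p) ξ := by
  refine iSup_le fun j => ?_
  refine (lPoisson_mono (fun η => le_add_rpow_mul hp hL (f η)) ξ).trans ?_
  rw [lPoisson_add measurable_const, lPoisson_const hn (maxRadius_pos j).le (maxRadius_lt_one j),
    lPoisson_const_mul _ (hf.pow_const p)]
  gcongr
  exact le_iSup (fun j => lPoisson (maxRadius j) (fun x => f x ^ p) ξ) j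

/-- Splitting at height L/2, the maximal function of f can exceed L only where that of f^p exceeds
(L/2)^p. Weak type (1,1) for f^p then gives decay L^(-p). -/
theorem measure_poissonMax_gt_le_rpow (hn : 0 < n) {p L : ℝ} (hp : 1 < p) (hL : 0 < L)
    {f : USphere n → ℝ≥0∞} (hf : Measurable f) :
    surf n {ξ | ENNReal.ofReal L < poissonMax f ξ} ≤
      ENNReal.ofReal (2 ^ (n + 2) * 2 ^ p * L ^ (-p)) * ∫⁻ x, f x ^ p ∂(surf n) := by
  have h := measure_poissonMax_gt_le hn (lam := (L / 2) ^ p / 2 ^ (n + 2)) (by positivity)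
    (hf.pow_const p)
  have e : ((L / 2) ^ p / 2 ^ (n + 2))⁻¹ = 2 ^ (n + 2) * 2 ^ p * L ^ (-p) := by
    rw [Real.div_rpow hL.le zero_le_two, Real.rpow_neg hL.le]
    field_simp
  rw [e, mul_div_cancel₀ _ (by positivity)] at h
  refine (measure_mono fun ξ hξ => ?_).trans h
  by_contra hcon
  have hcon : poissonMax (fun x => f x ^ p) ξ ≤ ENNReal.ofReal ((L / 2) ^ p) := not_lt.1 hcon
  have h1 := poissonMax_le_add hn hp (half_pos hL) hf ξ
  have h2 : ENNReal.ofReal (L / 2) + ENNReal.ofReal ((L / 2) ^ (1 - p)) *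
      ENNReal.ofReal ((L / 2) ^ p) = ENNReal.ofReal L := by
    rw [← ENNReal.ofReal_mul (by positivity), ← Real.rpow_add (by positivity),
      ← ENNReal.ofReal_add (by positivity) (by positivity)]
    simp
  have h3 : ENNReal.ofReal L < poissonMax f ξ := hξ
  refine absurd (h1.trans ?_) (not_le.2 h3)
  rw [← h2]
  gcongr

/-- Dyadic layers: if δ2^i < x ≤ δ2^(i+1), the i-th term alone dominates x. For infinite x every
term is at least δ, so the series diverges. -/
theorem le_add_tsum_indicator {δ : ℝ} (hδ : 0 < δ) (x : ℝ≥0∞) :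
    x ≤ ENNReal.ofReal δ + ∑' i : ℕ, ENNReal.ofReal (δ * 2 ^ (i + 1)) *
      (Ioi (ENNReal.ofReal (δ * 2 ^ i))).indicator 1 x := by
  classical
  rcases eq_or_ne x ∞ with rfl | hx
  · have : ∀ i : ℕ, ENNReal.ofReal δ ≤ ENNReal.ofReal (δ * 2 ^ (i + 1)) *
      (Ioi (ENNReal.ofReal (δ * 2 ^ i))).indicator 1 ∞ := fun i => by
      rw [indicator_of_mem (by simp), Pi.one_apply, mul_one]
      exact ENNReal.ofReal_le_ofReal (le_mul_of_one_le_right hδ.le (one_le_pow₀ (by norm_num)))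
    have h2 := ENNReal.tsum_le_tsum this
    rw [ENNReal.tsum_const_eq_top_of_ne_zero (by simpa using hδ)] at h2
    exact h2.trans le_add_self
  · have hex : ∃ i : ℕ, x ≤ ENNReal.ofReal (δ * 2 ^ i) := by
      have : Tendsto (fun i : ℕ => δ * (2 : ℝ) ^ i) atTop atTop :=
        (tendsto_pow_atTop_atTop_of_one_lt (by norm_num)).const_mul_atTop hδ
      obtain ⟨i, hi⟩ := (this.eventually (eventually_ge_atTop x.toReal)).exists
      exact ⟨i, ENNReal.le_ofReal_iff_toReal_le hx (by positivity) |>.2 hi⟩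
    rcases hj : Nat.find hex with _ | i
    · have := Nat.find_spec hex
      rw [hj, pow_zero, mul_one] at this
      exact this.trans le_self_add
    · have h1 := Nat.find_spec hex
      have h2 := Nat.find_min hex (m := i) (by omega)
      rw [hj] at h1
      refine le_trans ?_ le_add_self
      refine le_trans ?_ (ENNReal.le_tsum i)
      rw [indicator_of_mem (show x ∈ Ioi _ from not_le.1 h2), Pi.one_apply, mul_one]
      exact h1

/-- The radial maximal function of an `L^p` function is integrable. -/
theorem exists_lintegral_poissonMax_le (hn : 0 < n) {p δ : ℝ} (hp : 1 < p) (hδ : 0 < δ) :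
    ∃ C : ℝ≥0∞, C ≠ ∞ ∧ ∀ f : USphere n → ℝ≥0∞, Measurable f →
      ∫⁻ ξ, poissonMax f ξ ∂(surf n) ≤
        ENNReal.ofReal δ * surf n univ + C * ∫⁻ x, f x ^ p ∂(surf n) := by
  -- The height δ2^(i+1) of a layer times the weak type constant at δ2^i. The ratio of the series is
  -- 2^(1-p), below 1 as p > 1. The free parameter δ makes the term without f as small as desired.
  set c : ℕ → ℝ := fun i => 2 ^ (n + 2) * 2 ^ p * (δ ^ (1 - p) * 2) * ((2 : ℝ) ^ (1 - p)) ^ i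
    with hc
  have hc0 : ∀ i, 0 ≤ c i := fun i => by positivity
  have hsum : Summable c := by
    refine Summable.mul_left _ (summable_geometric_of_lt_one (by positivity) ?_)
    exact Real.rpow_lt_one_of_one_lt_of_neg (by norm_num) (by linarith)
  refine ⟨∑' i, ENNReal.ofReal (c i), ?_, fun f hf => ?_⟩
  · rw [← ENNReal.ofReal_tsum_of_nonneg hc0 hsum]
    exact ENNReal.ofReal_ne_top
  have hM := measurable_poissonMax hf
  calc ∫⁻ ξ, poissonMax f ξ ∂(surf n)
      ≤ ∫⁻ ξ, (ENNReal.ofReal δ + ∑' i : ℕ, ENNReal.ofReal (δ * 2 ^ (i + 1)) *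
        (Ioi (ENNReal.ofReal (δ * 2 ^ i))).indicator 1 (poissonMax f ξ)) ∂(surf n) :=
        lintegral_mono fun ξ => le_add_tsum_indicator hδ _
    _ = ENNReal.ofReal δ * surf n univ + ∑' i : ℕ, ENNReal.ofReal (δ * 2 ^ (i + 1)) *
        surf n {ξ | ENNReal.ofReal (δ * 2 ^ i) < poissonMax f ξ} := by
        have hind : ∀ i : ℕ, Measurable fun ξ =>
            (Ioi (ENNReal.ofReal (δ * 2 ^ i))).indicator (1 : ℝ≥0∞ → ℝ≥0∞) (poissonMax f ξ) :=
          fun i => (measurable_one.indicator measurableSet_Ioi).comp hM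
        rw [lintegral_add_left measurable_const, lintegral_const, lintegral_tsum]
        · congr 2
          funext i
          rw [lintegral_const_mul _ (hind i)]
          congr 1
          rw [← lintegral_indicator_one (measurableSet_lt measurable_const hM)]
          rfl
        · exact fun i => ((hind i).const_mul _).aemeasurable
    _ ≤ ENNReal.ofReal δ * surf n univ + ∑' i : ℕ, ENNReal.ofReal (c i) *
        ∫⁻ x, f x ^ p ∂(surf n) := by
        refine add_le_add le_rfl (ENNReal.tsum_le_tsum fun i => ?_)
        refine (mul_le_mul_right (measure_poissonMax_gt_le_rpow hn hp
          (by positivity : 0 < δ * 2 ^ i) hf) _).trans ?_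
        rw [← mul_assoc, ← ENNReal.ofReal_mul (by positivity)]
        gcongr
        refine le_of_eq ?_
        simp only [hc]
        have e1 : (δ * 2 ^ i) ^ (-p) = δ ^ (-p) * ((2 : ℝ) ^ (-p)) ^ i := by
          rw [Real.mul_rpow hδ.le (by positivity), ← Real.rpow_natCast_mul zero_le_two,
            mul_comm (i : ℝ), Real.rpow_mul_natCast zero_le_two]
        have e2 : δ ^ (1 - p) = δ * δ ^ (-p) := by
          rw [sub_eq_add_neg, Real.rpow_add hδ, Real.rpow_one]
        have e3 : (2 : ℝ) ^ (1 - p) = 2 * 2 ^ (-p) := by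
          rw [sub_eq_add_neg, Real.rpow_add two_pos, Real.rpow_one]
        rw [e1, e2, e3, mul_pow, pow_succ]
        ring
    _ = _ := by rw [ENNReal.tsum_mul_right]

end


/-! ### Finite differences of powers -/

theorem hasDerivAt_fwdDiff_iter_rpow (l : ℕ) (β y : ℝ) (hy : (l : ℝ) < y) :
    HasDerivAt ((fwdDiff (-1 : ℝ))^[l] fun u : ℝ => u ^ β)
      (β * ((fwdDiff (-1 : ℝ))^[l] fun u : ℝ => u ^ (β - 1)) y) y := by
  induction l generalizing y with
  | zero =>
    simpa using Real.hasDerivAt_rpow_const (p := β) (Or.inl (by simpa using hy.ne' : y ≠ 0))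
  | succ l ih =>
    push_cast at hy
    simp only [Function.iterate_succ_apply']
    have h1 := ih (y + -1) (by linarith)
    have h2 := ih y (by linarith)
    have h3 := (h1.comp_add_const y (-1)).sub h2
    exact h3.congr_deriv (by rw [fwdDiff, mul_sub])

theorem rpow_le_two_rpow_abs_mul {u y γ : ℝ} (hy : 0 < y) (h1 : y / 2 ≤ u) (h2 : u ≤ 2 * y) :
    u ^ γ ≤ 2 ^ |γ| * y ^ γ := by
  have hu : 0 < u := by linarith
  rcases le_total 0 γ with h | h
  · rw [abs_of_nonneg h, ← Real.mul_rpow zero_le_two hy.le]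
    exact Real.rpow_le_rpow hu.le h2 h
  · rw [abs_of_nonpos h, Real.rpow_neg zero_le_two, ← Real.inv_rpow zero_le_two,
      ← Real.mul_rpow (by norm_num) hy.le]
    refine Real.rpow_le_rpow_of_nonpos (by positivity) ?_ h
    linarith

/-- Each difference gains one negative power by the mean value inequality, the derivative of the
difference of u^β being β times that of u^(β-1). For y ≥ l + 1 all the nodes stay positive, and in
the inductive step y ≥ 2, so y and y - 1 are comparable. -/
theorem exists_abs_fwdDiff_iter_rpow_le (l : ℕ) (β : ℝ) :
    ∃ C : ℝ, 0 ≤ C ∧ ∀ y : ℝ, (l : ℝ) + 1 ≤ y →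
      |((fwdDiff (-1 : ℝ))^[l] fun u : ℝ => u ^ β) y| ≤ C * y ^ (β - l) := by
  induction l generalizing β with
  | zero =>
    refine ⟨1, zero_le_one, fun y hy => ?_⟩
    have : 0 ≤ y := by simp at hy; linarith
    simp [abs_of_nonneg (Real.rpow_nonneg this β)]
  | succ l ih =>
    obtain ⟨C, hC0, hC⟩ := ih (β - 1)
    refine ⟨|β| * (C * 2 ^ |β - 1 - l|), by positivity, fun y hy => ?_⟩
    push_cast at hy
    have hl : (0 : ℝ) ≤ l := by positivity
    rw [Function.iterate_succ_apply', fwdDiff]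
    have := (convex_Icc (y - 1) y).norm_image_sub_le_of_norm_hasDerivWithin_le
      (f := (fwdDiff (-1 : ℝ))^[l] fun u : ℝ => u ^ β) (C := |β| * (C * (2 ^ |β - 1 - l| * y ^ (β - 1 - l))))
      (fun u hu => (hasDerivAt_fwdDiff_iter_rpow l β u (by linarith [hu.1])).hasDerivWithinAt)
      (fun u hu => by
        rw [norm_mul, Real.norm_eq_abs, Real.norm_eq_abs]
        gcongr
        refine (hC u (by linarith [hu.1])).trans ?_
        gcongr
        exact rpow_le_two_rpow_abs_mul (by linarith) (by linarith [hu.1]) (by linarith [hu.2]))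
      (x := y) (y := y + -1) ⟨by linarith, le_rfl⟩ ⟨by linarith, by linarith⟩
    rw [← Real.norm_eq_abs]
    refine this.trans (le_of_eq ?_)
    rw [show y + -1 - y = -1 by ring, norm_neg, norm_one, mul_one]
    push_cast
    rw [show β - 1 - (l : ℝ) = β - (l + 1) by ring]
    ring

/-! ### The averaging kernel of the truncated Marchaud derivative -/

/-- The truncated power difference `∑ (-1)^j C(l,j) (y - j)₊^α`. -/
noncomputable def powerDiff (α : ℝ) (l : ℕ) (y : ℝ) : ℝ :=
  ∑ j ∈ Finset.range (l + 1), (l.choose j : ℝ) * (-1) ^ j * (max (y - j) 0) ^ α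

/-- The (unnormalized) averaging kernel of the truncated Marchaud derivative. -/
noncomputable def avgKernel (α : ℝ) (l : ℕ) (y : ℝ) : ℝ :=
  powerDiff α l y / (y * Real.Gamma (α + 1))

theorem measurable_powerDiff (α : ℝ) (l : ℕ) : Measurable (powerDiff α l) := by
  unfold powerDiff
  fun_prop

theorem measurable_avgKernel (α : ℝ) (l : ℕ) : Measurable (avgKernel α l) :=
  (measurable_powerDiff α l).div (measurable_id.mul_const _)

theorem abs_powerDiff_le {α : ℝ} (hα : 0 < α) (l : ℕ) {y : ℝ} (hy : 0 ≤ y) :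
    |powerDiff α l y| ≤ 2 ^ l * y ^ α := by
  refine (Finset.abs_sum_le_sum_abs _ _).trans ?_
  have : ((2 : ℝ) ^ l) = ∑ j ∈ Finset.range (l + 1), (l.choose j : ℝ) := by
    rw [← Nat.cast_sum, Nat.sum_range_choose]; norm_num
  rw [this, Finset.sum_mul]
  refine Finset.sum_le_sum fun j _ => ?_
  rw [abs_mul, abs_mul, abs_pow, abs_neg, abs_one, one_pow, mul_one, Nat.abs_cast,
    abs_of_nonneg (Real.rpow_nonneg (le_max_right _ _) _)]
  gcongr
  exact max_le (by linarith [(Nat.cast_nonneg j : (0 : ℝ) ≤ j)]) hy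

/-- Beyond l + 1 the positive parts are inactive, and the sum is an l-th difference of u^α up to
sign. -/
theorem exists_abs_powerDiff_le (α : ℝ) (l : ℕ) :
    ∃ C : ℝ, 0 ≤ C ∧ ∀ y : ℝ, (l : ℝ) + 1 ≤ y → |powerDiff α l y| ≤ C * y ^ (α - l) := by
  obtain ⟨C, hC0, hC⟩ := exists_abs_fwdDiff_iter_rpow_le l α
  refine ⟨C, hC0, fun y hy => ?_⟩
  refine le_trans (le_of_eq ?_) (hC y hy)
  rw [fwdDiff_iter_eq_sum_shift]
  have : powerDiff α l y = (-1) ^ l * ∑ k ∈ Finset.range (l + 1),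
      ((-1 : ℤ) ^ (l - k) * l.choose k) • (y + k • (-1 : ℝ)) ^ α := by
    rw [powerDiff, Finset.mul_sum]
    refine Finset.sum_congr rfl fun j hj => ?_
    have hj : j ≤ l := by simpa [Nat.lt_succ_iff] using hj
    have hjl : (j : ℝ) ≤ l := by exact_mod_cast hj
    have e : ((-1 : ℝ) ^ l) * (-1) ^ (l - j) = (-1) ^ j := by
      rw [← pow_add, show l + (l - j) = j + 2 * (l - j) by omega, pow_add, pow_mul]
      simp
    rw [max_eq_left (by linarith), zsmul_eq_mul]
    push_cast
    rw [nsmul_eq_mul, ← e, show y + (j : ℝ) * -1 = y - j by ring]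
    ring
  rw [this, abs_mul, abs_pow, abs_neg, abs_one, one_pow, one_mul]

/-- The averaging kernel is dominated by an integrable function on dyadic intervals. -/
theorem exists_avgKernel_majorant {α : ℝ} (hα : 0 < α) {l : ℕ} (hl : α < l) :
    ∃ κ : ℝ → ℝ, Measurable κ ∧ (∀ y, 0 ≤ κ y) ∧ IntegrableOn κ (Ioi 0) ∧
      ∀ y > 0, ∀ ρ ∈ Icc y (2 * y), |avgKernel α l y| ≤ κ ρ := by
  obtain ⟨C, hC0, hC⟩ := exists_abs_powerDiff_le α l
  have hG := Real.Gamma_pos_of_pos (by linarith : 0 < α + 1)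
  set G := Real.Gamma (α + 1)
  set L : ℝ := l + 1 with hL
  have hL0 : 0 < L := by positivity
  -- The two powers match the behaviour y^(α-1) of the kernel near 0 and y^(α-l-1) at infinity,
  -- integrable since 0 < α < l. The first piece reaches to 2L because y < L allows ρ up to 2L.
  set κ : ℝ → ℝ := fun ρ => (Ioo 0 (2 * L)).indicator (fun ρ => 2 ^ l / G * 2 ^ |α - 1| * ρ ^ (α - 1)) ρ
    + (Ici L).indicator (fun ρ => C / G * 2 ^ |α - l - 1| * ρ ^ (α - l - 1)) ρ with hκ
  have i1 : ∀ ρ : ℝ, 0 ≤ (Ioo 0 (2 * L)).indicator (fun ρ => 2 ^ l / G * 2 ^ |α - 1| * ρ ^ (α - 1)) ρ :=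
    fun ρ => indicator_nonneg (fun ρ hρ => by have := hρ.1; positivity) ρ
  have i2 : ∀ ρ : ℝ, 0 ≤ (Ici L).indicator (fun ρ => C / G * 2 ^ |α - l - 1| * ρ ^ (α - l - 1)) ρ :=
    fun ρ => indicator_nonneg (fun ρ hρ => by have : 0 < ρ := hL0.trans_le hρ; positivity) ρ
  have hsymm : ∀ {y ρ γ : ℝ}, 0 < y → ρ ∈ Icc y (2 * y) → y ^ γ ≤ 2 ^ |γ| * ρ ^ γ := by
    intro y ρ γ hy hρ
    exact rpow_le_two_rpow_abs_mul (hy.trans_le hρ.1) (by linarith [hρ.2]) (by linarith [hρ.1])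
  refine ⟨κ, ?_, fun y => add_nonneg (i1 y) (i2 y), ?_, ?_⟩
  · exact (Measurable.indicator (by fun_prop) measurableSet_Ioo).add
      (Measurable.indicator (by fun_prop) measurableSet_Ici)
  · refine Integrable.add ?_ ?_
    · refine Integrable.mono_measure (ν := volume) ?_ Measure.restrict_le_self
      rw [integrable_indicator_iff measurableSet_Ioo]
      refine Integrable.const_mul ?_ _
      exact (intervalIntegral.integrableOn_Ioo_rpow_iff (by positivity)).2 (by linarith)
    · refine Integrable.mono_measure (ν := volume) ?_ Measure.restrict_le_self
      rw [integrable_indicator_iff measurableSet_Ici]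
      refine Integrable.const_mul ?_ _
      have := (integrableOn_Ici_iff_integrableOn_Ioi (μ := volume)
        (f := fun ρ : ℝ => ρ ^ (α - l - 1)) (b := L)).2
        (integrableOn_Ioi_rpow_of_lt (by linarith) hL0)
      exact this
  · intro y hy ρ hρ
    have hab : |avgKernel α l y| = |powerDiff α l y| / G * y⁻¹ := by
      rw [avgKernel, abs_div, abs_of_pos (by positivity : 0 < y * G)]
      field_simp
    rw [hab]
    rcases lt_or_ge y L with h | h
    · refine le_trans ?_ (le_add_of_nonneg_right (i2 ρ))
      rcases lt_or_ge ρ (2 * L) with h' | h'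
      · rw [indicator_of_mem (show ρ ∈ Ioo 0 (2 * L) from ⟨hy.trans_le hρ.1, h'⟩)]
        calc |powerDiff α l y| / G * y⁻¹ ≤ 2 ^ l * y ^ α / G * y⁻¹ := by
              gcongr; exact abs_powerDiff_le hα l hy.le
          _ = 2 ^ l / G * y ^ (α - 1) := by
              rw [Real.rpow_sub_one hy.ne']; field_simp
          _ ≤ 2 ^ l / G * (2 ^ |α - 1| * ρ ^ (α - 1)) := by
              gcongr; exact hsymm hy hρ
          _ = _ := by ring
      · linarith [hρ.2]
    · refine le_trans ?_ (le_add_of_nonneg_left (i1 ρ))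
      rw [indicator_of_mem (show ρ ∈ Ici L from h.trans hρ.1)]
      calc |powerDiff α l y| / G * y⁻¹ ≤ C * y ^ (α - l) / G * y⁻¹ := by
            gcongr; exact hC y h
        _ = C / G * y ^ (α - l - 1) := by
            rw [Real.rpow_sub_one hy.ne']; field_simp
        _ ≤ C / G * (2 ^ |α - l - 1| * ρ ^ (α - l - 1)) := by
            gcongr; exact hsymm hy hρ
        _ = _ := by ring

theorem integrableOn_avgKernel {α : ℝ} (hα : 0 < α) {l : ℕ} (hl : α < l) :
    IntegrableOn (avgKernel α l) (Ioi 0) := by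
  obtain ⟨κ, _, _, hκ, h⟩ := exists_avgKernel_majorant hα hl
  refine hκ.mono' (measurable_avgKernel α l).aestronglyMeasurable ?_
  filter_upwards [ae_restrict_mem measurableSet_Ioi] with y hy
  have hy : 0 < y := hy
  exact h y hy y ⟨le_rfl, by linarith⟩


/-! ### Truncated Marchaud derivatives of Riemann–Liouville integrals -/

/-- The kernel of the truncated Marchaud derivative of a fractional integral, one step. -/
noncomputable def stepKernel (α : ℝ) (j : ℕ) (τ t : ℝ) : ℝ :=
  if j * τ < t then (t - j * τ) ^ (α - 1) / τ ^ (1 + α) else 0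

theorem stepKernel_nonneg (α : ℝ) (j : ℕ) {τ : ℝ} (hτ : 0 ≤ τ) (t : ℝ) :
    0 ≤ stepKernel α j τ t := by
  unfold stepKernel
  split_ifs with h
  · have : 0 ≤ t - j * τ := by linarith
    positivity
  · exact le_rfl

theorem measurable_stepKernel (α : ℝ) (j : ℕ) :
    Measurable fun p : ℝ × ℝ => stepKernel α j p.1 p.2 := by
  unfold stepKernel
  exact Measurable.ite (measurableSet_lt (by fun_prop) (by fun_prop)) (by fun_prop) (by fun_prop)

/-- As a function of τ the kernel is the derivative of -(t/τ - j)^α/(αt) up to τ = t/j, and it is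
zero afterwards. -/
theorem integral_stepKernel {α ε t : ℝ} (hα : 0 < α) (hε : 0 < ε) (ht : 0 < t) (j : ℕ) :
    IntegrableOn (fun τ => stepKernel α j τ t) (Ioi ε) ∧
      ∫ τ in Ioi ε, stepKernel α j τ t = (max (t / ε - j) 0) ^ α / (α * t) := by
  rcases Nat.eq_zero_or_pos j with rfl | hj
  · have e : ∀ τ ∈ Ioi ε, stepKernel α 0 τ t = t ^ (α - 1) * τ ^ (-(1 + α)) := fun τ hτ => by
      have hτ : 0 < τ := hε.trans hτ
      rw [stepKernel, if_pos (by simpa using ht), Real.rpow_neg hτ.le]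
      simp [div_eq_mul_inv]
    constructor
    · rw [integrableOn_congr_fun e measurableSet_Ioi]
      exact (integrableOn_Ioi_rpow_of_lt (by linarith) hε).const_mul _
    · rw [setIntegral_congr_fun measurableSet_Ioi e, integral_const_mul,
        integral_Ioi_rpow_of_lt (by linarith) hε]
      have h1 : -(1 + α) + 1 = -α := by ring
      rw [h1, Nat.cast_zero, sub_zero, max_eq_left (by positivity), Real.div_rpow ht.le hε.le,
        Real.rpow_neg hε.le, Real.rpow_sub_one ht.ne']
      have := Real.rpow_pos_of_pos hε α
      field_simp
  · have hj0 : (0 : ℝ) < j := by exact_mod_cast hj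
    rcases le_or_gt t (j * ε) with h | h
    · have e : ∀ τ ∈ Ioi ε, stepKernel α j τ t = 0 := fun τ hτ => by
        have hτ : ε < τ := hτ
        rw [stepKernel, if_neg (by nlinarith)]
      constructor
      · rw [integrableOn_congr_fun e measurableSet_Ioi]
        exact integrableOn_zero
      · rw [setIntegral_congr_fun measurableSet_Ioi e, integral_zero, max_eq_right,
          Real.zero_rpow hα.ne', zero_div]
        rw [sub_nonpos, div_le_iff₀ hε]; exact h
    · have hlt : ε < t / j := by rw [lt_div_iff₀ hj0]; linarith
      set F : ℝ → ℝ := fun τ => -((t / τ - j) ^ α / (α * t)) with hF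
      have hcont : ContinuousOn F (Icc ε (t / j)) := by
        refine ContinuousOn.neg (ContinuousOn.div_const ?_ _)
        refine ContinuousOn.rpow_const ?_ fun _ _ => Or.inr hα.le
        exact (continuousOn_const.div continuousOn_id fun τ hτ => (hε.trans_le hτ.1).ne').sub
          continuousOn_const
      have hder : ∀ τ ∈ Ioo ε (t / j), HasDerivAt F (stepKernel α j τ t) τ := by
        intro τ hτ
        have hτ0 : 0 < τ := hε.trans hτ.1
        have hτ1 : j * τ < t := by
          have := hτ.2
          rw [lt_div_iff₀ hj0] at this; linarith
        have hpos : 0 < t / τ - j := by rw [sub_pos, lt_div_iff₀ hτ0]; exact hτ1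
        have h1 : HasDerivAt (fun τ => t / τ - j) (-t / τ ^ 2) τ := by
          have := ((hasDerivAt_inv hτ0.ne').const_mul t).sub_const (j : ℝ)
          simpa [div_eq_mul_inv] using this
        have h2 := ((h1.rpow_const (p := α) (Or.inl hpos.ne')).div_const (α * t)).neg
        refine h2.congr_deriv ?_
        rw [stepKernel, if_pos hτ1]
        have e1 : t / τ - j = (t - j * τ) / τ := by field_simp
        rw [e1, Real.div_rpow (by linarith) hτ0.le, Real.rpow_sub_one hτ0.ne', Real.rpow_add hτ0,
          Real.rpow_one]
        have := Real.rpow_pos_of_pos hτ0 α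
        field_simp
      have hnn : ∀ τ ∈ Ioo ε (t / j), 0 ≤ stepKernel α j τ t := fun τ hτ =>
        stepKernel_nonneg α j (hε.trans hτ.1).le t
      -- For α < 1 the kernel is singular at t/j; integrability follows from nonnegativity and the
      -- continuity of the antiderivative up to that endpoint.
      have hint := intervalIntegral.integrableOn_deriv_of_nonneg hcont hder hnn
      have hval := intervalIntegral.integral_eq_sub_of_hasDerivAt_of_le hlt.le hcont hder
        ((intervalIntegrable_iff_integrableOn_Ioc_of_le hlt.le).2 hint)
      have hsplit : Ioi ε = Ioc ε (t / j) ∪ Ioi (t / j) := (Ioc_union_Ioi_eq_Ioi hlt.le).symm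
      have e : ∀ τ ∈ Ioi (t / j), stepKernel α j τ t = 0 := fun τ hτ => by
        have hτ : t / j < τ := hτ
        rw [div_lt_iff₀ hj0] at hτ
        rw [stepKernel, if_neg (by linarith)]
      have hint2 : IntegrableOn (fun τ => stepKernel α j τ t) (Ioi (t / j)) := by
        rw [integrableOn_congr_fun e measurableSet_Ioi]
        exact integrableOn_zero
      constructor
      · rw [hsplit]
        exact hint.union hint2
      · rw [hsplit, setIntegral_union (Ioc_disjoint_Ioi le_rfl) measurableSet_Ioi hint hint2,
          setIntegral_congr_fun measurableSet_Ioi e, integral_zero, add_zero,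
          ← intervalIntegral.integral_of_le hlt.le, hval]
        have e0 : t / (t / j) - j = 0 := by field_simp; ring
        have e1 : 0 < t / ε - j := by rw [sub_pos, lt_div_iff₀ hε]; exact h
        simp only [hF]
        rw [e0, Real.zero_rpow hα.ne', max_eq_left e1.le]
        ring

/-- The right-sided Riemann–Liouville integral of order `α`. -/
noncomputable def rlInt (α : ℝ) (h : ℝ → ℂ) (v : ℝ) : ℂ :=
  ((Real.Gamma α)⁻¹ : ℝ) * ∫ t in Ioi v, (((t - v) ^ (α - 1) : ℝ) : ℂ) * h t

/-- The hypothesis for Fubini: integrating the kernel over τ > ε leaves at most ε^(-α)/α times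
t^(α-1), which is the assumed weight on h. -/
theorem integrable_stepKernel_prod {α ε : ℝ} (hα : 0 < α) (hε : 0 < ε) {h : ℝ → ℂ}
    (hm : Measurable h)
    (hh : IntegrableOn (fun t => ((t ^ (α - 1) : ℝ) : ℂ) * h t) (Ioi 0)) (j : ℕ) :
    Integrable (fun p : ℝ × ℝ => ((stepKernel α j p.1 p.2 : ℝ) : ℂ) * h p.2)
      ((volume.restrict (Ioi ε)).prod (volume.restrict (Ioi 0))) := by
  have hmeas : Measurable (fun p : ℝ × ℝ => ((stepKernel α j p.1 p.2 : ℝ) : ℂ) * h p.2) :=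
    (Complex.measurable_ofReal.comp (measurable_stepKernel α j)).mul (hm.comp measurable_snd)
  rw [integrable_prod_iff' hmeas.aestronglyMeasurable]
  constructor
  · filter_upwards [ae_restrict_mem measurableSet_Ioi] with t ht
    exact ((integral_stepKernel hα hε ht j).1.ofReal).mul_const _
  · refine Integrable.mono' (hh.norm.const_mul (ε ^ (-α) / α)) ?_ ?_
    · have : StronglyMeasurable (Function.uncurry fun t τ : ℝ =>
          ‖((stepKernel α j τ t : ℝ) : ℂ) * h t‖) :=
        (hmeas.comp measurable_swap).norm.stronglyMeasurable
      exact this.integral_prod_right.aestronglyMeasurable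
    · filter_upwards [ae_restrict_mem measurableSet_Ioi] with t ht
      have ht : 0 < t := ht
      have e : ∫ τ in Ioi ε, ‖((stepKernel α j τ t : ℝ) : ℂ) * h t‖ =
          (∫ τ in Ioi ε, stepKernel α j τ t) * ‖h t‖ := by
        rw [← integral_mul_const]
        refine setIntegral_congr_fun measurableSet_Ioi fun τ hτ => ?_
        have hτ : 0 < τ := hε.trans hτ
        simp only [norm_mul, Complex.norm_real,
          Real.norm_of_nonneg (stepKernel_nonneg α j hτ.le t)]
      rw [e, (integral_stepKernel hα hε ht j).2, norm_mul, norm_mul, norm_norm, Complex.norm_real,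
        Real.norm_of_nonneg (by positivity), Real.norm_of_nonneg (by positivity), ← mul_assoc]
      gcongr
      calc (max (t / ε - j) 0) ^ α / (α * t) ≤ (t / ε) ^ α / (α * t) := by
            gcongr
            exact max_le (by linarith [(Nat.cast_nonneg j : (0 : ℝ) ≤ j)]) (by positivity)
        _ = ε ^ (-α) / α * t ^ (α - 1) := by
            rw [Real.div_rpow ht.le hε.le, Real.rpow_neg hε.le, Real.rpow_sub_one ht.ne']
            have := Real.rpow_pos_of_pos hε α
            field_simp

theorem integral_stepKernel_eq_rlInt {α τ : ℝ} (hα : 0 < α) (hτ : 0 < τ) (h : ℝ → ℂ) (j : ℕ) :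
    ∫ t in Ioi (0 : ℝ), ((stepKernel α j τ t : ℝ) : ℂ) * h t =
      (Real.Gamma α : ℂ) * rlInt α h (j * τ) / ((τ ^ (1 + α) : ℝ) : ℂ) := by
  have hG := (Real.Gamma_pos_of_pos hα).ne'
  have hjτ : 0 ≤ j * τ := by positivity
  have e : ∀ t, ((stepKernel α j τ t : ℝ) : ℂ) * h t =
      (Ioi (j * τ)).indicator (fun t => (((τ ^ (1 + α) : ℝ) : ℂ))⁻¹ *
        ((((t - j * τ) ^ (α - 1) : ℝ) : ℂ) * h t)) t := by
    intro t
    by_cases ht : j * τ < t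
    · rw [indicator_of_mem (show t ∈ Ioi (j * τ) from ht), stepKernel, if_pos ht]
      push_cast
      ring
    · rw [indicator_of_notMem (show t ∉ Ioi (j * τ) from ht), stepKernel, if_neg ht]
      simp
  simp_rw [e]
  rw [setIntegral_indicator measurableSet_Ioi, inter_eq_right.2 (Ioi_subset_Ioi hjτ),
    integral_const_mul, rlInt]
  push_cast
  have : (Real.Gamma α : ℂ) ≠ 0 := by exact_mod_cast hG
  field_simp

/-- The truncated Marchaud derivative of a fractional integral is a convolution with the
averaging kernel. -/
theorem truncated_marchaud {α ε : ℝ} (hα : 0 < α) (hε : 0 < ε) (l : ℕ) {h : ℝ → ℂ}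
    (hm : Measurable h)
    (hh : IntegrableOn (fun t => ((t ^ (α - 1) : ℝ) : ℂ) * h t) (Ioi 0)) :
    IntegrableOn (fun τ : ℝ => (∑ j ∈ Finset.range (l + 1), (l.choose j : ℂ) * (-1) ^ j *
        rlInt α h (j * τ)) / ((τ ^ (1 + α) : ℝ) : ℂ)) (Ioi ε) ∧
      ∫ τ in Ioi ε, (∑ j ∈ Finset.range (l + 1), (l.choose j : ℂ) * (-1) ^ j *
        rlInt α h (j * τ)) / ((τ ^ (1 + α) : ℝ) : ℂ) =
      ∫ y in Ioi (0 : ℝ), (avgKernel α l y : ℂ) * h (ε * y) := by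
  have hG := Real.Gamma_pos_of_pos hα
  have hGc : (Real.Gamma α : ℂ) ≠ 0 := by exact_mod_cast hG.ne'
  have hint := fun j => integrable_stepKernel_prod hα hε hm hh j
  have e : ∀ τ ∈ Ioi ε, (∑ j ∈ Finset.range (l + 1), (l.choose j : ℂ) * (-1) ^ j *
        rlInt α h (j * τ)) / ((τ ^ (1 + α) : ℝ) : ℂ) =
      ∑ j ∈ Finset.range (l + 1), (l.choose j : ℂ) * (-1) ^ j * (Real.Gamma α : ℂ)⁻¹ *
        ∫ t in Ioi (0 : ℝ), ((stepKernel α j τ t : ℝ) : ℂ) * h t := by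
    intro τ hτ
    rw [Finset.sum_div]
    refine Finset.sum_congr rfl fun j _ => ?_
    rw [integral_stepKernel_eq_rlInt hα (hε.trans hτ)]
    field_simp
  have hi : ∀ j, Integrable (fun τ => (l.choose j : ℂ) * (-1) ^ j * (Real.Gamma α : ℂ)⁻¹ *
        ∫ t in Ioi (0 : ℝ), ((stepKernel α j τ t : ℝ) : ℂ) * h t) (volume.restrict (Ioi ε)) :=
    fun j => (hint j).integral_prod_left.const_mul _
  constructor
  · rw [integrableOn_congr_fun e measurableSet_Ioi]
    exact integrable_finsetSum _ fun j _ => hi j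
  · rw [setIntegral_congr_fun measurableSet_Ioi e, integral_finsetSum _ fun j _ => hi j]
    have e2 : ∀ j, ∫ τ in Ioi ε, (l.choose j : ℂ) * (-1) ^ j * (Real.Gamma α : ℂ)⁻¹ *
        (∫ t in Ioi (0 : ℝ), ((stepKernel α j τ t : ℝ) : ℂ) * h t) =
        ∫ t in Ioi (0 : ℝ), (l.choose j : ℂ) * (-1) ^ j * (Real.Gamma α : ℂ)⁻¹ *
          (((max (t / ε - j) 0) ^ α / (α * t) : ℝ) * h t) := by
      intro j
      rw [integral_const_mul, integral_const_mul, integral_integral_swap (hint j)]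
      congr 1
      refine setIntegral_congr_fun measurableSet_Ioi fun t ht => ?_
      simp only [integral_mul_const]
      rw [integral_complex_ofReal, (integral_stepKernel hα hε ht j).2]
    have hi2 : ∀ j, Integrable (fun t => (l.choose j : ℂ) * (-1) ^ j * (Real.Gamma α : ℂ)⁻¹ *
          (((max (t / ε - j) 0) ^ α / (α * t) : ℝ) * h t)) (volume.restrict (Ioi 0)) := by
      intro j
      refine Integrable.const_mul ?_ _
      refine (hint j).integral_prod_right.congr ?_
      filter_upwards [ae_restrict_mem measurableSet_Ioi] with t ht
      simp only [integral_mul_const]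
      rw [integral_complex_ofReal, (integral_stepKernel hα hε ht j).2]
    simp_rw [e2]
    rw [← integral_finsetSum _ fun j _ => hi2 j]
    -- The substitution t = εy; together with 1/Γ(α) and αΓ(α) = Γ(α+1) it produces `avgKernel`,
    -- free of ε.
    have e3 := integral_comp_mul_left_Ioi
      (fun t => (∑ j ∈ Finset.range (l + 1), (l.choose j : ℂ) * (-1) ^ j *
        (Real.Gamma α : ℂ)⁻¹ * (((max (t / ε - j) 0) ^ α / (α * t) : ℝ) * h t))) 0 hε
    rw [mul_zero, eq_inv_smul_iff₀ hε.ne'] at e3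
    rw [← e3, ← integral_smul]
    refine setIntegral_congr_fun measurableSet_Ioi fun y hy => ?_
    have hy : 0 < y := hy
    simp only [avgKernel, powerDiff]
    rw [mul_div_cancel_left₀ _ hε.ne', Real.Gamma_add_one hα.ne', Complex.real_smul,
      Complex.ofReal_div, Complex.ofReal_sum, Finset.sum_div, Finset.mul_sum, Finset.sum_mul]
    refine Finset.sum_congr rfl fun j _ => ?_
    have h1 : (ε : ℂ) ≠ 0 := by exact_mod_cast hε.ne'
    have h2 : (y : ℂ) ≠ 0 := by exact_mod_cast hy.ne'
    have h3 : (α : ℂ) ≠ 0 := by exact_mod_cast hα.ne'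
    push_cast
    field_simp


/-! ### The normalizing constant -/

theorem integrableOn_kappa {α : ℝ} (hα : 0 < α) {l : ℕ} (hl : α < l) :
    IntegrableOn (fun t : ℝ => (1 - Real.exp (-t)) ^ l / t ^ (1 + α)) (Ioi 0) := by
  have hm : ∀ s, AEStronglyMeasurable (fun t : ℝ => (1 - Real.exp (-t)) ^ l / t ^ (1 + α))
      (volume.restrict s) := fun s => by
    refine Measurable.aestronglyMeasurable ?_
    fun_prop
  have hb : ∀ t : ℝ, 0 < t → 0 ≤ 1 - Real.exp (-t) := fun t ht => by
    have := Real.exp_le_one_iff.2 (by linarith : -t ≤ 0); linarith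
  rw [← Ioc_union_Ioi_eq_Ioi zero_le_one]
  refine IntegrableOn.union ?_ ?_
  · have : IntegrableOn (fun t : ℝ => t ^ ((l : ℝ) - 1 - α)) (Ioc 0 1) := by
      rw [integrableOn_Ioc_iff_integrableOn_Ioo]
      exact (intervalIntegral.integrableOn_Ioo_rpow_iff one_pos).2 (by linarith)
    refine this.mono' (hm _) ?_
    filter_upwards [ae_restrict_mem measurableSet_Ioc] with t ht
    have h1 := hb t ht.1
    have ht0 := ht.1
    have h2 : 1 - Real.exp (-t) ≤ t := by have := Real.add_one_le_exp (-t); linarith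
    rw [Real.norm_of_nonneg (by positivity)]
    rw [show (l : ℝ) - 1 - α = l - (1 + α) by ring, Real.rpow_sub ht0, Real.rpow_natCast]
    gcongr
  · refine (integrableOn_Ioi_rpow_of_lt (by linarith : -(1 + α) < -1) one_pos).mono' (hm _) ?_
    filter_upwards [ae_restrict_mem measurableSet_Ioi] with t ht
    have ht : 0 < t := one_pos.trans ht
    have h1 := hb t ht
    rw [Real.norm_of_nonneg (by positivity), Real.rpow_neg ht.le, div_eq_mul_inv]
    have h3 : (1 - Real.exp (-t)) ^ l ≤ 1 := pow_le_one₀ h1 (by linarith [Real.exp_pos (-t)])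
    exact mul_le_of_le_one_left (by positivity) h3

theorem kappa_pos {α : ℝ} (hα : 0 < α) {l : ℕ} (hl : α < l) : 0 < kappa α l := by
  have hb : ∀ t : ℝ, 0 < t → 0 < 1 - Real.exp (-t) := fun t ht => by
    have := Real.exp_lt_one_iff.2 (by linarith : -t < 0); linarith
  unfold kappa
  rw [setIntegral_pos_iff_support_of_nonneg_ae _ (integrableOn_kappa hα hl)]
  · have : Ioi (0 : ℝ) ⊆ Function.support
        (fun t : ℝ => (1 - Real.exp (-t)) ^ l / t ^ (1 + α)) ∩ Ioi 0 := fun t ht => by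
      refine ⟨?_, ht⟩
      have ht : 0 < t := ht
      have := hb t ht
      exact (by positivity : 0 < (1 - Real.exp (-t)) ^ l / t ^ (1 + α)).ne'
    exact lt_of_lt_of_le (by simp) (measure_mono this)
  · filter_upwards [ae_restrict_mem measurableSet_Ioi] with t ht
    have ht : 0 < t := ht
    have := hb t ht
    simp only [Pi.zero_apply]
    positivity

theorem setIntegral_Ioi_sub {E : Type*} [NormedAddCommGroup E] [NormedSpace ℝ E]
    (f : ℝ → E) (v : ℝ) :
    ∫ t in Ioi v, f (t - v) = ∫ t in Ioi (0 : ℝ), f t := by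
  rw [← integral_indicator measurableSet_Ioi, ← integral_indicator measurableSet_Ioi,
    ← integral_sub_right_eq_self ((Ioi 0).indicator f) v]
  congr 1
  ext t
  by_cases h : v < t
  · rw [indicator_of_mem (show t ∈ Ioi v from h),
      indicator_of_mem (show t - v ∈ Ioi 0 from sub_pos.2 h)]
  · rw [indicator_of_notMem (show t ∉ Ioi v from h),
      indicator_of_notMem (show t - v ∉ Ioi 0 from fun h' => h (sub_pos.1 h'))]

/-- The exponential is fixed by every Riemann–Liouville integral, which makes it the test function
for computing the mass of the averaging kernel. -/
theorem rlInt_exp {α : ℝ} (hα : 0 < α) (v : ℝ) :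
    rlInt α (fun t => (Real.exp (-t) : ℂ)) v = Real.exp (-v) := by
  have hG := Real.Gamma_pos_of_pos hα
  have e : ∀ t : ℝ, (((t - v) ^ (α - 1) : ℝ) : ℂ) * (Real.exp (-t) : ℂ) =
      (((Real.exp (-(t - v)) * (t - v) ^ (α - 1)) * Real.exp (-v) : ℝ) : ℂ) := fun t => by
    have : Real.exp (-t) = Real.exp (-(t - v)) * Real.exp (-v) := by
      rw [← Real.exp_add]; congr 1; ring
    rw [this]; push_cast; ring
  rw [rlInt]
  simp_rw [e]
  rw [integral_complex_ofReal, integral_mul_const,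
    setIntegral_Ioi_sub (fun t => Real.exp (-t) * t ^ (α - 1)) v, ← Real.Gamma_eq_integral hα,
    ← Complex.ofReal_mul]
  congr 1
  field_simp

/-- The total mass of the averaging kernel. -/
theorem integral_avgKernel {α : ℝ} (hα : 0 < α) {l : ℕ} (hl : α < l) :
    ∫ y in Ioi (0 : ℝ), avgKernel α l y = kappa α l := by
  have hh : IntegrableOn (fun t : ℝ => ((t ^ (α - 1) : ℝ) : ℂ) * (Real.exp (-t) : ℂ)) (Ioi 0) := by
    have := (Real.GammaIntegral_convergent hα).ofReal (𝕜 := ℂ)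
    refine this.congr (Eventually.of_forall fun t => ?_)
    simp [mul_comm]
  -- For h(t) = e^(-t) the finite difference is (1 - e^(-τ))^l by the binomial theorem. Both sides
  -- converge as ε tends to 0, the left to κ and the right to the mass.
  have key : ∀ ε > 0, ∫ τ in Ioi ε, (1 - Real.exp (-τ)) ^ l / τ ^ (1 + α) =
      ∫ y in Ioi (0 : ℝ), avgKernel α l y * Real.exp (-(ε * y)) := by
    intro ε hε
    have h := (truncated_marchaud hα hε l (h := fun t => (Real.exp (-t) : ℂ))
      (by fun_prop) hh).2
    have e1 : ∀ τ : ℝ, (∑ j ∈ Finset.range (l + 1), (l.choose j : ℂ) * (-1) ^ j *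
        rlInt α (fun t => (Real.exp (-t) : ℂ)) (j * τ)) / ((τ ^ (1 + α) : ℝ) : ℂ) =
        (((1 - Real.exp (-τ)) ^ l / τ ^ (1 + α) : ℝ) : ℂ) := by
      intro τ
      simp_rw [rlInt_exp hα]
      rw [Complex.ofReal_div]
      congr 1
      rw [sub_eq_neg_add, add_pow, Complex.ofReal_sum]
      refine Finset.sum_congr rfl fun j _ => ?_
      have : Real.exp (-(j * τ)) = Real.exp (-τ) ^ j := by
        rw [← Real.exp_nat_mul]; congr 1; ring
      rw [this, neg_pow]
      push_cast
      ring
    simp_rw [e1, ← Complex.ofReal_mul] at h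
    rw [integral_complex_ofReal, integral_complex_ofReal] at h
    exact_mod_cast h
  have hid : Tendsto (fun ε : ℝ => ε) (𝓝[>] 0) (𝓝 0) := tendsto_id.mono_left nhdsWithin_le_nhds
  have l1 : Tendsto (fun ε : ℝ => ∫ τ in Ioi ε, (1 - Real.exp (-τ)) ^ l / τ ^ (1 + α))
      (𝓝[>] 0) (𝓝 (kappa α l)) := by
    have := (aecover_Ioi_of_Ioi (μ := volume) (A := (0 : ℝ)) hid
      ).integral_tendsto_of_countably_generated (integrableOn_kappa hα hl)
    refine this.congr' ?_
    filter_upwards [self_mem_nhdsWithin] with ε hε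
    rw [Measure.restrict_restrict measurableSet_Ioi,
      inter_eq_left.2 (Ioi_subset_Ioi (le_of_lt hε))]
  have l2 : Tendsto (fun ε : ℝ => ∫ y in Ioi (0 : ℝ), avgKernel α l y * Real.exp (-(ε * y)))
      (𝓝[>] 0) (𝓝 (∫ y in Ioi (0 : ℝ), avgKernel α l y)) := by
    refine tendsto_integral_filter_of_dominated_convergence (fun y => |avgKernel α l y|) ?_ ?_
      (integrableOn_avgKernel hα hl).norm ?_
    · exact Eventually.of_forall fun ε =>
        ((measurable_avgKernel α l).mul (by fun_prop)).aestronglyMeasurable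
    · filter_upwards [self_mem_nhdsWithin] with ε hε
      filter_upwards [ae_restrict_mem measurableSet_Ioi] with y hy
      have : Real.exp (-(ε * y)) ≤ 1 :=
        Real.exp_le_one_iff.2 (neg_nonpos.2 (mul_pos hε hy).le)
      rw [norm_mul, Real.norm_eq_abs, Real.norm_of_nonneg (Real.exp_pos _).le]
      exact mul_le_of_le_one_right (abs_nonneg _) this
    · refine Eventually.of_forall fun y => ?_
      have : Tendsto (fun ε : ℝ => avgKernel α l y * Real.exp (-(ε * y))) (𝓝 0)
          (𝓝 (avgKernel α l y * Real.exp (-(0 * y)))) :=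
        Continuous.tendsto (by fun_prop) 0
      simp only [zero_mul, neg_zero, Real.exp_zero, mul_one] at this
      exact this.mono_left nhdsWithin_le_nhds
  refine tendsto_nhds_unique l2 (l1.congr' ?_)
  filter_upwards [self_mem_nhdsWithin] with ε hε using key ε hε

/-! ### Approximate identities at a one-sided point of bounded density -/

theorem lintegral_comp_mul_left_real {ε : ℝ} (hε : 0 < ε) (f : ℝ → ℝ≥0∞) :
    ∫⁻ y, f (ε * y) = ENNReal.ofReal ε⁻¹ * ∫⁻ t, f t := by
  have h := lintegral_map_equiv (μ := (volume : Measure ℝ)) f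
    (Homeomorph.mulLeft₀ ε hε.ne').toMeasurableEquiv
  have e : Measure.map (Homeomorph.mulLeft₀ ε hε.ne').toMeasurableEquiv (volume : Measure ℝ) =
      ENNReal.ofReal |ε⁻¹| • volume := Real.map_volume_mul_left hε.ne'
  rw [e, lintegral_smul_measure, abs_of_pos (inv_pos.2 hε)] at h
  exact h.symm

theorem setLIntegral_Ioc_comp_mul_left {ε ρ : ℝ} (hε : 0 < ε) (f : ℝ → ℝ≥0∞) :
    ∫⁻ y in Ioc 0 ρ, f (ε * y) = ENNReal.ofReal ε⁻¹ * ∫⁻ t in Ioc 0 (ε * ρ), f t := by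
  rw [← lintegral_indicator measurableSet_Ioc, ← lintegral_indicator measurableSet_Ioc,
    ← lintegral_comp_mul_left_real hε]
  refine lintegral_congr fun y => ?_
  have : y ∈ Ioc 0 ρ ↔ ε * y ∈ Ioc 0 (ε * ρ) := by
    simp [mem_Ioc, hε, mul_pos_iff_of_pos_left]
  by_cases h : y ∈ Ioc 0 ρ
  · rw [indicator_of_mem h, indicator_of_mem (this.1 h)]
  · rw [indicator_of_notMem h, indicator_of_notMem (fun h' => h (this.2 h'))]

/-- Write 1 = y⁻¹ ∫ dρ over (y, 2y], replace |k(y)| there by κ(ρ) and exchange the integrals. The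
inner integral is then at most (2/ρ) ε⁻¹ times the integral of m over (0, ερ]. For ερ ≤ δ this is at
most 2D by hypothesis; for ερ > δ it is at most (2/δ) ∫ m, multiplied by a tail of κ that vanishes
with ε. -/
theorem eventually_lintegral_kernel_le {k κ : ℝ → ℝ} (hκm : Measurable κ) (hκ : IntegrableOn κ (Ioi 0))
    (hk : ∀ y > 0, ∀ ρ ∈ Icc y (2 * y), |k y| ≤ κ ρ) {m : ℝ → ℝ≥0∞} (hm : Measurable m)
    (hfin : ∫⁻ t in Ioi (0 : ℝ), m t ≠ ∞) {D : ℝ≥0∞} {δ : ℝ} (hδ : 0 < δ)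
    (hD : ∀ r, 0 < r → r ≤ δ → ∫⁻ t in Ioc 0 r, m t ≤ D * ENNReal.ofReal r)
    {η : ℝ≥0∞} (hη : 0 < η) :
    ∀ᶠ ε in 𝓝[>] (0 : ℝ), ∫⁻ y in Ioi (0 : ℝ), ENNReal.ofReal |k y| * m (ε * y) ≤
      2 * D * (∫⁻ ρ in Ioi (0 : ℝ), ENNReal.ofReal (κ ρ)) + η := by
  set N := ∫⁻ t in Ioi (0 : ℝ), m t with hN
  set c : ℝ≥0∞ := ENNReal.ofReal (2 / δ) * N with hc
  have hκfin : ∫⁻ ρ in Ioi (0 : ℝ), ENNReal.ofReal (κ ρ) ≠ ∞ := by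
    have := hκ.lintegral_lt_top
    exact this.ne
  have bound : ∀ ε > 0, ∫⁻ y in Ioi (0 : ℝ), ENNReal.ofReal |k y| * m (ε * y) ≤
      2 * D * (∫⁻ ρ in Ioi (0 : ℝ), ENNReal.ofReal (κ ρ)) +
        c * ∫⁻ ρ in Ioi (0 : ℝ), (Ioi (δ / ε)).indicator (fun ρ => ENNReal.ofReal (κ ρ)) ρ := by
    intro ε hε
    have hmk : Measurable fun p : ℝ × ℝ =>
        {p : ℝ × ℝ | p.1 < p.2 ∧ p.2 ≤ 2 * p.1}.indicator
          (fun p => ENNReal.ofReal (p.1)⁻¹ * ENNReal.ofReal (κ p.2) * m (ε * p.1)) p := by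
      refine Measurable.indicator (by fun_prop) ?_
      exact (measurableSet_lt measurable_fst measurable_snd).inter
        (measurableSet_le measurable_snd (measurable_fst.const_mul 2))
    calc ∫⁻ y in Ioi (0 : ℝ), ENNReal.ofReal |k y| * m (ε * y)
        ≤ ∫⁻ y in Ioi (0 : ℝ), ∫⁻ ρ in Ioi (0 : ℝ),
            {p : ℝ × ℝ | p.1 < p.2 ∧ p.2 ≤ 2 * p.1}.indicator
          (fun p => ENNReal.ofReal (p.1)⁻¹ * ENNReal.ofReal (κ p.2) * m (ε * p.1)) (y, ρ) := by
          refine setLIntegral_mono' measurableSet_Ioi fun y hy => ?_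
          have hy : 0 < y := hy
          have hsub : Ioc y (2 * y) ⊆ Ioi 0 := fun ρ hρ => hy.trans hρ.1
          calc ENNReal.ofReal |k y| * m (ε * y)
              = ∫⁻ ρ in Ioc y (2 * y), ENNReal.ofReal y⁻¹ * ENNReal.ofReal |k y| * m (ε * y) := by
                rw [setLIntegral_const, Real.volume_Ioc, show 2 * y - y = y by ring,
                  mul_right_comm _ (m _), mul_right_comm _ (ENNReal.ofReal |k y|),
                  ← ENNReal.ofReal_mul (by positivity), inv_mul_cancel₀ hy.ne', ENNReal.ofReal_one,
                  one_mul]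
            _ ≤ ∫⁻ ρ in Ioc y (2 * y), ENNReal.ofReal y⁻¹ * ENNReal.ofReal (κ ρ) * m (ε * y) := by
                refine setLIntegral_mono' measurableSet_Ioc fun ρ hρ => ?_
                gcongr
                exact hk y hy ρ ⟨hρ.1.le, hρ.2⟩
            _ = ∫⁻ ρ in Ioi (0 : ℝ), (Ioc y (2 * y)).indicator
                (fun ρ => ENNReal.ofReal y⁻¹ * ENNReal.ofReal (κ ρ) * m (ε * y)) ρ := by
                rw [setLIntegral_indicator measurableSet_Ioc, inter_eq_left.2 hsub]
            _ = _ := by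
                refine lintegral_congr fun ρ => ?_
                by_cases h : ρ ∈ Ioc y (2 * y)
                · rw [indicator_of_mem h, indicator_of_mem (show (y, ρ) ∈ _ from h)]
                · rw [indicator_of_notMem h, indicator_of_notMem (show (y, ρ) ∉ _ from h)]
      _ = ∫⁻ ρ in Ioi (0 : ℝ), ∫⁻ y in Ioi (0 : ℝ),
            {p : ℝ × ℝ | p.1 < p.2 ∧ p.2 ≤ 2 * p.1}.indicator
          (fun p => ENNReal.ofReal (p.1)⁻¹ * ENNReal.ofReal (κ p.2) * m (ε * p.1)) (y, ρ) :=
          lintegral_lintegral_swap hmk.aemeasurable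
      _ ≤ ∫⁻ ρ in Ioi (0 : ℝ), (2 * D * ENNReal.ofReal (κ ρ) +
            c * (Ioi (δ / ε)).indicator (fun ρ => ENNReal.ofReal (κ ρ)) ρ) := by
          refine setLIntegral_mono' measurableSet_Ioi fun ρ hρ => ?_
          have hρ : 0 < ρ := hρ
          have h1 : ∫⁻ y in Ioi (0 : ℝ), {p : ℝ × ℝ | p.1 < p.2 ∧ p.2 ≤ 2 * p.1}.indicator
              (fun p => ENNReal.ofReal (p.1)⁻¹ * ENNReal.ofReal (κ p.2) * m (ε * p.1)) (y, ρ) ≤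
              ENNReal.ofReal (2 / ρ) * ENNReal.ofReal (κ ρ) *
                (ENNReal.ofReal ε⁻¹ * ∫⁻ t in Ioc 0 (ε * ρ), m t) := by
            rw [← setLIntegral_Ioc_comp_mul_left hε, ← lintegral_const_mul _ (by fun_prop),
              ← lintegral_indicator measurableSet_Ioi, ← lintegral_indicator measurableSet_Ioc]
            refine lintegral_mono fun y => ?_
            by_cases hy : 0 < y
            · rw [indicator_of_mem (show y ∈ Ioi (0 : ℝ) from hy)]
              by_cases h : y < ρ ∧ ρ ≤ 2 * y
              · rw [indicator_of_mem (show (y, ρ) ∈ _ from h),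
                  indicator_of_mem (show y ∈ Ioc 0 ρ from ⟨hy, h.1.le⟩)]
                gcongr
                rw [inv_eq_one_div, div_le_div_iff₀ hy hρ]
                linarith [h.2]
              · rw [indicator_of_notMem (show (y, ρ) ∉ _ from h)]
                exact zero_le
            · rw [indicator_of_notMem (show y ∉ Ioi (0 : ℝ) from hy)]
              exact zero_le
          refine h1.trans ?_
          rcases le_or_gt ρ (δ / ε) with h | h
          · refine le_trans ?_ le_self_add
            have h2 := hD (ε * ρ) (by positivity) (by rw [le_div_iff₀ hε] at h; linarith)
            calc ENNReal.ofReal (2 / ρ) * ENNReal.ofReal (κ ρ) *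
                (ENNReal.ofReal ε⁻¹ * ∫⁻ t in Ioc 0 (ε * ρ), m t)
                ≤ ENNReal.ofReal (2 / ρ) * ENNReal.ofReal (κ ρ) *
                (ENNReal.ofReal ε⁻¹ * (D * ENNReal.ofReal (ε * ρ))) := by gcongr
              _ = (ENNReal.ofReal (2 / ρ) * ENNReal.ofReal ε⁻¹ * ENNReal.ofReal (ε * ρ)) *
                    D * ENNReal.ofReal (κ ρ) := by ring
              _ = _ := by
                rw [← ENNReal.ofReal_mul (by positivity), ← ENNReal.ofReal_mul (by positivity),
                  show 2 / ρ * ε⁻¹ * (ε * ρ) = 2 by field_simp]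
                simp
          · refine le_trans ?_ le_add_self
            rw [indicator_of_mem (show ρ ∈ Ioi (δ / ε) from h), hc]
            rw [div_lt_iff₀ hε] at h
            calc ENNReal.ofReal (2 / ρ) * ENNReal.ofReal (κ ρ) *
                (ENNReal.ofReal ε⁻¹ * ∫⁻ t in Ioc 0 (ε * ρ), m t)
                ≤ ENNReal.ofReal (2 / ρ) * ENNReal.ofReal (κ ρ) * (ENNReal.ofReal ε⁻¹ * N) := by
                  gcongr
                  exact lintegral_mono_set Ioc_subset_Ioi_self
              _ = (ENNReal.ofReal (2 / ρ) * ENNReal.ofReal ε⁻¹) * N * ENNReal.ofReal (κ ρ) := by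
                  ring
              _ ≤ _ := by
                rw [← ENNReal.ofReal_mul (by positivity)]
                gcongr
                rw [← div_eq_mul_inv, div_div]
                exact div_le_div_of_nonneg_left (by norm_num) hδ h.le
      _ = _ := by
          have : Measurable ((Ioi (δ / ε)).indicator (fun ρ => ENNReal.ofReal (κ ρ))) :=
            Measurable.indicator (by fun_prop) measurableSet_Ioi
          rw [lintegral_add_left (by fun_prop), lintegral_const_mul _ (by fun_prop),
            lintegral_const_mul _ this]
  have lim : Tendsto (fun ε : ℝ => c * ∫⁻ ρ in Ioi (0 : ℝ),
      (Ioi (δ / ε)).indicator (fun ρ => ENNReal.ofReal (κ ρ)) ρ) (𝓝[>] 0) (𝓝 (c * 0)) := by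
    refine ENNReal.Tendsto.const_mul ?_ (Or.inr (ENNReal.mul_ne_top ENNReal.ofReal_ne_top hfin))
    have := tendsto_lintegral_filter_of_dominated_convergence (l := 𝓝[>] (0 : ℝ))
      (μ := volume.restrict (Ioi (0 : ℝ)))
      (F := fun ε ρ => (Ioi (δ / ε)).indicator (fun ρ => ENNReal.ofReal (κ ρ)) ρ)
      (f := fun _ => 0) (fun ρ => ENNReal.ofReal (κ ρ))
      (Eventually.of_forall fun ε => Measurable.indicator (by fun_prop) measurableSet_Ioi)
      (Eventually.of_forall fun ε => Eventually.of_forall fun ρ => indicator_le_self _ _ _)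
      hκfin (by
        filter_upwards [ae_restrict_mem measurableSet_Ioi] with ρ hρ
        have hρ : 0 < ρ := hρ
        refine tendsto_const_nhds.congr' ?_
        have : ∀ᶠ ε in 𝓝[>] (0 : ℝ), ε < δ / ρ :=
          nhdsWithin_le_nhds (eventually_lt_nhds (by positivity))
        filter_upwards [this, self_mem_nhdsWithin] with ε h1 h2
        have h2 : 0 < ε := h2
        rw [indicator_of_notMem]
        rw [lt_div_iff₀ hρ] at h1
        rw [mem_Ioi, not_lt, le_div_iff₀ h2]
        linarith)
    simpa using this
  rw [mul_zero] at lim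
  filter_upwards [lim.eventually (gt_mem_nhds hη), self_mem_nhdsWithin] with ε h1 h2
  exact (bound ε h2).trans (add_le_add le_rfl h1.le)


/-! ### Polar coordinates -/

section
variable {n : ℕ}

/-- Integration in polar coordinates for nonnegative functions. -/
theorem lintegral_polar_euclidean (hn : 0 < n) {G : EuclideanSpace ℝ (Fin n) → ℝ≥0∞}
    (hG : Measurable G) :
    ∫⁻ v, G v = ∫⁻ η : USphere n, (∫⁻ ρ in Ioi (0 : ℝ), ENNReal.ofReal (ρ ^ (n - 1)) *
      G (ρ • (η : EuclideanSpace ℝ (Fin n)))) ∂(surf n) := by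
  have : Nonempty (Fin n) := ⟨⟨0, hn⟩⟩
  have h := (volume : Measure (EuclideanSpace ℝ (Fin n))).measurePreserving_homeomorphUnitSphereProd
  rw [finrank_euclideanSpace, Fintype.card_fin] at h
  have hs : MeasurableSet ({0}ᶜ : Set (EuclideanSpace ℝ (Fin n))) :=
    (measurableSet_singleton 0).compl
  have e1 : ∫⁻ v, G v = ∫⁻ v : ({0}ᶜ : Set (EuclideanSpace ℝ (Fin n))), G v
      ∂(Measure.comap Subtype.val volume) := by
    rw [lintegral_subtype_comap hs G, restrict_compl_singleton]
  have e2 : ∀ v : ({0}ᶜ : Set (EuclideanSpace ℝ (Fin n))), G v =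
      (fun p : USphere n × Ioi (0 : ℝ) => G ((p.2 : ℝ) • (p.1 : EuclideanSpace ℝ (Fin n))))
        (homeomorphUnitSphereProd _ v) := fun v => by
    conv_lhs => rw [← (homeomorphUnitSphereProd _).symm_apply_apply v]
    rw [homeomorphUnitSphereProd_symm_apply_coe]
  have hm : Measurable (fun p : USphere n × Ioi (0 : ℝ) =>
      G ((p.2 : ℝ) • (p.1 : EuclideanSpace ℝ (Fin n)))) := by fun_prop
  rw [e1]
  simp_rw [e2]
  rw [h.lintegral_comp hm, lintegral_prod _ hm.aemeasurable]
  refine lintegral_congr fun η => ?_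
  rw [Measure.volumeIoiPow, lintegral_withDensity_eq_lintegral_mul _ (by fun_prop) (by fun_prop)]
  exact lintegral_subtype_comap measurableSet_Ioi
    (fun ρ : ℝ => ENNReal.ofReal (ρ ^ (n - 1)) * G (ρ • (η : EuclideanSpace ℝ (Fin n))))

/-- Appending a last coordinate. -/
noncomputable def snocE (v : EuclideanSpace ℝ (Fin n)) (z : ℝ) : EuclideanSpace ℝ (Fin (n + 1)) :=
  WithLp.toLp 2 (Fin.snoc (α := fun _ => ℝ) (fun i => v i) z)

theorem measurePreserving_snocE : MeasurePreserving
    (fun p : ℝ × EuclideanSpace ℝ (Fin n) => snocE p.2 p.1) := by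
  have h1 := (PiLp.volume_preserving_ofLp (Fin n))
  have h2 := (MeasurePreserving.id (volume : Measure ℝ)).prod h1
  have h3 := (volume_preserving_piFinSuccAbove (fun _ : Fin (n + 1) => ℝ) (Fin.last n)).symm
  have h4 := PiLp.volume_preserving_toLp (Fin (n + 1))
  have h := h4.comp (h3.comp h2)
  suffices e : (fun p : ℝ × EuclideanSpace ℝ (Fin n) => snocE p.2 p.1) = WithLp.toLp 2 ∘
      (MeasurableEquiv.piFinSuccAbove (fun _ => ℝ) (Fin.last n)).symm ∘
        Prod.map id WithLp.ofLp by
    rw [e]; exact h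
  funext p
  simp only [snocE, Function.comp_apply, Prod.map, MeasurableEquiv.piFinSuccAbove_symm_apply]
  congr 1
  funext i
  simp [Fin.insertNthEquiv, Fin.insertNth_last']

@[fun_prop]
theorem measurable_snocE {X : Type*} [MeasurableSpace X] {v : X → EuclideanSpace ℝ (Fin n)}
    {z : X → ℝ} (hv : Measurable v) (hz : Measurable z) :
    Measurable fun x => snocE (v x) (z x) :=
  measurePreserving_snocE.measurable.comp (hz.prodMk hv)

theorem norm_snocE_sq (v : EuclideanSpace ℝ (Fin n)) (z : ℝ) :
    ‖snocE v z‖ ^ 2 = ‖v‖ ^ 2 + z ^ 2 := by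
  rw [EuclideanSpace.norm_sq_eq, EuclideanSpace.norm_sq_eq, Fin.sum_univ_castSucc]
  simp [snocE]

theorem smul_snocE (c : ℝ) (v : EuclideanSpace ℝ (Fin n)) (z : ℝ) :
    c • snocE v z = snocE (c • v) (c * z) := by
  ext i
  refine Fin.lastCases ?_ (fun i => ?_) i <;> simp [snocE]

theorem snocE_castSucc (v : EuclideanSpace ℝ (Fin n)) (z : ℝ) (i : Fin n) :
    snocE v z (Fin.castSucc i) = v i := by simp [snocE]

theorem snocE_last (v : EuclideanSpace ℝ (Fin n)) (z : ℝ) :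
    snocE v z (Fin.last n) = z := by simp [snocE]

/-- The slope parametrization of the sphere without the poles. -/
noncomputable def slopeChart (c : ℝ) (η : USphere n) : USphere (n + 1) :=
  ⟨(√(1 + c ^ 2))⁻¹ • snocE (η : EuclideanSpace ℝ (Fin n)) c, by
    have h : ‖snocE (η : EuclideanSpace ℝ (Fin n)) c‖ = √(1 + c ^ 2) := by
      rw [eq_comm, Real.sqrt_eq_iff_eq_sq (by positivity) (norm_nonneg _), norm_snocE_sq, η.norm_eq]
      ring
    have : 0 < √(1 + c ^ 2) := by positivity
    rw [mem_sphere_zero_iff_norm, norm_smul, h, Real.norm_of_nonneg (by positivity),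
      inv_mul_cancel₀ this.ne']⟩

@[fun_prop]
theorem measurable_slopeChart {X : Type*} [MeasurableSpace X] {c : X → ℝ} {η : X → USphere n}
    (hc : Measurable c) (hη : Measurable η) : Measurable fun x => slopeChart (c x) (η x) := by
  unfold slopeChart
  exact Measurable.subtype_mk (by fun_prop)

open scoped Pointwise in
-- The point with horizontal part ρη and height ρc lies at distance ρ√(1+c²) from the origin on the
-- ray through `slopeChart c η`.
theorem smul_snocE_mem_cone_iff {s : Set (USphere (n + 1))} {ρ : ℝ} (hρ : 0 < ρ) (c : ℝ)
    (η : USphere n) :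
    snocE (ρ • (η : EuclideanSpace ℝ (Fin n))) (ρ * c) ∈ Ioo (0 : ℝ) 1 • (Subtype.val '' s) ↔
      ρ < (√(1 + c ^ 2))⁻¹ ∧ slopeChart c η ∈ s := by
  have hq : 0 < √(1 + c ^ 2) := by positivity
  have hval : snocE (ρ • (η : EuclideanSpace ℝ (Fin n))) (ρ * c) =
      (ρ * √(1 + c ^ 2)) • (slopeChart c η : EuclideanSpace ℝ (Fin (n + 1))) := by
    rw [← smul_snocE, slopeChart, smul_smul]
    congr 1
    field_simp
  rw [hval]
  constructor
  · rintro ⟨r, hr, _, ⟨y, hy, rfl⟩, h⟩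
    have h : r • (y : EuclideanSpace ℝ (Fin (n + 1))) =
      (ρ * √(1 + c ^ 2)) • (slopeChart c η : EuclideanSpace ℝ (Fin (n + 1))) := h
    have hn := congrArg norm h
    rw [norm_smul_sphere hr.1.le, norm_smul_sphere (by positivity)] at hn
    rw [hn] at h
    have h' := smul_right_injective _ (by positivity : ρ * √(1 + c ^ 2) ≠ 0) h
    rw [← Subtype.ext h']
    refine ⟨?_, hy⟩
    rw [lt_inv_comm₀ hρ hq]
    have := hr.2
    rw [hn] at this
    rw [lt_inv_comm₀ hq hρ, ← one_div, lt_div_iff₀ hq]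
    exact this
  · rintro ⟨h1, h2⟩
    refine ⟨_, ⟨by positivity, ?_⟩, _, ⟨_, h2, rfl⟩, rfl⟩
    rw [← one_div, lt_div_iff₀ hq] at h1
    exact h1

theorem setLIntegral_pow_lt {a : ℝ} (ha : 0 ≤ a) (n : ℕ) :
    ∫⁻ ρ in Ioo 0 a, ENNReal.ofReal (ρ ^ n) = ENNReal.ofReal (a ^ (n + 1) / (n + 1)) := by
  rw [Measure.restrict_congr_set Ioo_ae_eq_Ioc, ← ofReal_integral_eq_lintegral_ofReal,
    ← intervalIntegral.integral_of_le ha]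
  · simp
  · exact (intervalIntegral.intervalIntegrable_pow n).1
  · filter_upwards [ae_restrict_mem measurableSet_Ioc] with y hy
    exact pow_nonneg hy.1.le _

open scoped Pointwise in
-- Surface measure is n + 1 times the volume of the cone. Split off the last coordinate, use polar
-- coordinates in the horizontal variables and put z = ρc. The integral of ρ^n up to (1+c²)^(-1/2)
-- supplies the density and cancels the factor n + 1.
theorem surf_apply_eq_lintegral_slope (hn : 0 < n) {s : Set (USphere (n + 1))}
    (hs : MeasurableSet s) :
    surf (n + 1) s = ∫⁻ η : USphere n, (∫⁻ c : ℝ,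
      ENNReal.ofReal ((√(1 + c ^ 2))⁻¹ ^ (n + 1)) * s.indicator 1 (slopeChart c η)) ∂(surf n) := by
  set A : Set (EuclideanSpace ℝ (Fin (n + 1))) := Ioo (0 : ℝ) 1 • (Subtype.val '' s) with hA
  have hAm : MeasurableSet A := by
    have he : MeasurableEmbedding (fun p : USphere (n + 1) × Ioi (0 : ℝ) =>
        (((homeomorphUnitSphereProd (EuclideanSpace ℝ (Fin (n + 1)))).symm p :
          ({0}ᶜ : Set (EuclideanSpace ℝ (Fin (n + 1))))) : EuclideanSpace ℝ (Fin (n + 1)))) :=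
      (MeasurableEmbedding.subtype_coe (measurableSet_singleton _).compl).comp
        (homeomorphUnitSphereProd _).symm.measurableEmbedding
    have hAe : A = (fun p : USphere (n + 1) × Ioi (0 : ℝ) =>
        (((homeomorphUnitSphereProd (EuclideanSpace ℝ (Fin (n + 1)))).symm p :
          ({0}ᶜ : Set (EuclideanSpace ℝ (Fin (n + 1))))) : EuclideanSpace ℝ (Fin (n + 1)))) ''
        (s ×ˢ {r : Ioi (0 : ℝ) | (r : ℝ) < 1}) := by
      ext x
      simp only [hA, Set.mem_smul, mem_image, homeomorphUnitSphereProd_symm_apply_coe]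
      constructor
      · rintro ⟨r, hr, _, ⟨y, hy, rfl⟩, rfl⟩
        exact ⟨(y, ⟨r, hr.1⟩), ⟨hy, hr.2⟩, rfl⟩
      · rintro ⟨⟨y, r⟩, ⟨hy, hr⟩, rfl⟩
        exact ⟨r, ⟨r.2, hr⟩, _, ⟨y, hy, rfl⟩, rfl⟩
    rw [hAe]
    exact he.measurableSet_image.2 (hs.prod (measurableSet_lt measurable_subtype_coe
      measurable_const))
  have hv : volume A = ∫⁻ v : EuclideanSpace ℝ (Fin n), ∫⁻ z : ℝ,
      A.indicator (1 : EuclideanSpace ℝ (Fin (n + 1)) → ℝ≥0∞) (snocE v z) := by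
    rw [← lintegral_indicator_one hAm, ← measurePreserving_snocE.lintegral_comp
      (measurable_one.indicator hAm), Measure.volume_eq_prod, lintegral_prod_symm']
    exact (measurable_one.indicator hAm).comp (by fun_prop)
  have hmA : Measurable (A.indicator (1 : EuclideanSpace ℝ (Fin (n + 1)) → ℝ≥0∞)) := measurable_one.indicator hAm
  have hms : Measurable (s.indicator (1 : USphere (n + 1) → ℝ≥0∞)) := measurable_one.indicator hs
  rw [Measure.toSphere_apply' _ hs, ← hA, hv, lintegral_polar_euclidean hn
    (Measurable.lintegral_prod_right (by fun_prop)), finrank_euclideanSpace, Fintype.card_fin,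
    ← lintegral_const_mul' _ _ (by simp)]
  refine lintegral_congr fun η => ?_
  have h1 : ∀ ρ ∈ Ioi (0 : ℝ), ENNReal.ofReal (ρ ^ (n - 1)) * ∫⁻ z : ℝ,
      A.indicator (1 : EuclideanSpace ℝ (Fin (n + 1)) → ℝ≥0∞) (snocE (ρ • (η : EuclideanSpace ℝ (Fin n))) z) =
      ∫⁻ c : ℝ, ENNReal.ofReal (ρ ^ n) * ((Iio (√(1 + c ^ 2))⁻¹).indicator 1 ρ *
        s.indicator (1 : USphere (n + 1) → ℝ≥0∞) (slopeChart c η)) := by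
    intro ρ hρ
    have hρ : 0 < ρ := hρ
    have h2 := lintegral_comp_mul_left_real hρ
      (fun z => A.indicator (1 : EuclideanSpace ℝ (Fin (n + 1)) → ℝ≥0∞) (snocE (ρ • (η : EuclideanSpace ℝ (Fin n))) z))
    have h3 : ∫⁻ z : ℝ, A.indicator (1 : EuclideanSpace ℝ (Fin (n + 1)) → ℝ≥0∞) (snocE (ρ • (η : EuclideanSpace ℝ (Fin n))) z) =
        ENNReal.ofReal ρ * ∫⁻ c : ℝ,
          A.indicator (1 : EuclideanSpace ℝ (Fin (n + 1)) → ℝ≥0∞) (snocE (ρ • (η : EuclideanSpace ℝ (Fin n))) (ρ * c)) := by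
      rw [h2, ← mul_assoc, ← ENNReal.ofReal_mul hρ.le, mul_inv_cancel₀ hρ.ne', ENNReal.ofReal_one,
        one_mul]
    rw [h3, ← mul_assoc, ← ENNReal.ofReal_mul (by positivity), ← pow_succ, Nat.sub_add_cancel hn,
      ← lintegral_const_mul' _ _ ENNReal.ofReal_ne_top]
    refine lintegral_congr fun c => ?_
    congr 1
    have := smul_snocE_mem_cone_iff (s := s) hρ c η
    rw [← hA] at this
    by_cases hc1 : ρ < (√(1 + c ^ 2))⁻¹ <;> by_cases hc2 : slopeChart c η ∈ s
    · rw [indicator_of_mem (this.2 ⟨hc1, hc2⟩), indicator_of_mem (show ρ ∈ Iio _ from hc1),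
        indicator_of_mem hc2]
      simp
    · rw [indicator_of_notMem (fun h => hc2 (this.1 h).2), indicator_of_notMem hc2, mul_zero]
    · rw [indicator_of_notMem (fun h => hc1 (this.1 h).1),
        indicator_of_notMem (show ρ ∉ Iio _ from hc1), zero_mul]
    · rw [indicator_of_notMem (fun h => hc2 (this.1 h).2), indicator_of_notMem hc2, mul_zero]
  rw [setLIntegral_congr_fun measurableSet_Ioi h1, lintegral_lintegral_swap]
  · rw [← lintegral_const_mul' _ _ (by simp)]
    refine lintegral_congr fun c => ?_
    simp_rw [← mul_assoc]
    rw [lintegral_mul_const'', ← mul_assoc]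
    · congr 1
      have h4 : ∀ ρ ∈ Ioi (0 : ℝ), ENNReal.ofReal (ρ ^ n) *
          (Iio (√(1 + c ^ 2))⁻¹).indicator 1 ρ = (Iio (√(1 + c ^ 2))⁻¹).indicator
          (fun ρ => ENNReal.ofReal (ρ ^ n)) ρ := fun ρ _ => by
        simp only [indicator_apply, Pi.one_apply]
        split_ifs <;> simp
      rw [setLIntegral_congr_fun measurableSet_Ioi h4, setLIntegral_indicator measurableSet_Iio,
        inter_comm, Ioi_inter_Iio, setLIntegral_pow_lt (by positivity),
        ← ENNReal.ofReal_natCast, ← ENNReal.ofReal_mul (by positivity)]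
      congr 1
      push_cast
      field_simp
    · refine Measurable.aemeasurable (Measurable.mul (by fun_prop) ?_)
      exact measurable_one.indicator measurableSet_Iio
  · refine Measurable.aemeasurable (Measurable.mul (by fun_prop) (Measurable.mul ?_ (by fun_prop)))
    have : (fun p : ℝ × ℝ => (Iio (√(1 + p.2 ^ 2))⁻¹).indicator (1 : ℝ → ℝ≥0∞) p.1) =
        {p : ℝ × ℝ | p.1 < (√(1 + p.2 ^ 2))⁻¹}.indicator 1 := by
      funext p
      simp only [indicator_apply, mem_Iio, mem_ofPred_eq, Pi.one_apply]
    exact this ▸ measurable_one.indicator (measurableSet_lt measurable_fst (by fun_prop))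

end


/-! ### The coordinate t = tan²(θ/2) on the sphere -/

section
variable {n : ℕ}

theorem hasDerivAt_slope {t : ℝ} (ht : 0 < t) :
    HasDerivAt (fun t => (t - 1) / (2 * √t)) ((1 + t) / (4 * t * √t)) t := by
  have h1 : HasDerivAt (fun t => 2 * √t) (2 * (1 / (2 * √t))) t :=
    (Real.hasDerivAt_sqrt ht.ne').const_mul 2
  have hq : 0 < √t := Real.sqrt_pos.2 ht
  refine (((hasDerivAt_id t).sub_const 1).div h1 (by positivity)).congr_deriv ?_
  simp only [id]
  have h2 : √t ^ 2 = t := Real.sq_sqrt ht.le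
  rw [div_eq_div_iff (by positivity) (by positivity)]
  field_simp
  rw [h2]
  ring

/-- The substitution c = -cot θ, expressed through t = tan²(θ/2); its inverse is √t = c + √(c²+1).
-/
theorem lintegral_slope (F : ℝ → ℝ≥0∞) :
    ∫⁻ c, F c = ∫⁻ t in Ioi (0 : ℝ), ENNReal.ofReal ((1 + t) / (4 * t * √t)) *
      F ((t - 1) / (2 * √t)) := by
  have hinj : InjOn (fun t : ℝ => (t - 1) / (2 * √t)) (Ioi 0) := by
    intro t ht t' ht' h
    have hq : 0 < √t := Real.sqrt_pos.2 ht
    have hq' : 0 < √t' := Real.sqrt_pos.2 ht'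
    have e : √t ^ 2 = t := Real.sq_sqrt (le_of_lt ht)
    have e' : √t' ^ 2 = t' := Real.sq_sqrt (le_of_lt ht')
    simp only at h
    rw [div_eq_div_iff (by positivity) (by positivity)] at h
    have h3 : (√t - √t') * (√t * √t' + 1) = 0 := by
      rw [← e, ← e'] at h
      simp only [Real.sqrt_sq hq.le, Real.sqrt_sq hq'.le] at h
      linarith
    rcases mul_eq_zero.1 h3 with h4 | h4
    · rw [← e, ← e', sub_eq_zero.1 h4]
    · exact absurd h4 (by positivity)
  have himg : (fun t : ℝ => (t - 1) / (2 * √t)) '' Ioi 0 = univ := by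
    refine eq_univ_of_forall fun c => ?_
    have hu : 0 < c + √(c ^ 2 + 1) := by
      have : |c| < √(c ^ 2 + 1) := Real.lt_sqrt_of_sq_lt (by rw [sq_abs]; linarith)
      linarith [neg_abs_le c]
    refine ⟨(c + √(c ^ 2 + 1)) ^ 2, pow_pos hu 2, ?_⟩
    simp only [Real.sqrt_sq hu.le]
    rw [div_eq_iff (by positivity)]
    have : √(c ^ 2 + 1) ^ 2 = c ^ 2 + 1 := Real.sq_sqrt (by positivity)
    linear_combination this
  have h := lintegral_image_eq_lintegral_abs_deriv_mul measurableSet_Ioi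
    (fun t ht => (hasDerivAt_slope ht).hasDerivWithinAt) hinj F
  rw [himg, setLIntegral_univ] at h
  rw [h]
  refine setLIntegral_congr_fun measurableSet_Ioi fun t ht => ?_
  have ht : 0 < t := ht
  rw [abs_of_nonneg (by positivity)]

/-- The point of the sphere in the direction `η` at which `tan² (θ / 2) = t`. -/
noncomputable def capChart (t : ℝ) (η : USphere n) : USphere (n + 1) :=
  polar (2 * Real.arctan √t) η

/-- The density of the surface measure in the coordinates of `capChart`. -/
noncomputable def capWeight (n : ℕ) (t : ℝ) : ℝ := (2 * √t / (1 + t)) ^ n / (2 * t)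

theorem sin_two_arctan_sqrt {t : ℝ} (ht : 0 ≤ t) :
    Real.sin (2 * Real.arctan √t) = 2 * √t / (1 + t) := by
  rw [Real.sin_two_mul, Real.sin_arctan, Real.cos_arctan, Real.sq_sqrt ht]
  have : √(1 + t) ^ 2 = 1 + t := Real.sq_sqrt (by positivity)
  rw [mul_one_div, ← mul_div_assoc, div_div, ← sq, this]

theorem cos_two_arctan_sqrt {t : ℝ} (ht : 0 ≤ t) :
    Real.cos (2 * Real.arctan √t) = (1 - t) / (1 + t) := by
  rw [Real.cos_two_mul, Real.cos_sq_arctan, Real.sq_sqrt ht]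
  field_simp
  ring

theorem polar_coe (θ : ℝ) (η : USphere n) : (polar θ η : EuclideanSpace ℝ (Fin (n + 1))) =
    snocE (Real.sin θ • (η : EuclideanSpace ℝ (Fin n))) (-Real.cos θ) := rfl

theorem capChart_coe {t : ℝ} (ht : 0 ≤ t) (η : USphere n) :
    (capChart t η : EuclideanSpace ℝ (Fin (n + 1))) =
      snocE ((2 * √t / (1 + t)) • (η : EuclideanSpace ℝ (Fin n))) ((t - 1) / (1 + t)) := by
  rw [capChart, polar_coe, sin_two_arctan_sqrt ht, cos_two_arctan_sqrt ht]
  congr 1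
  ring

theorem inv_sqrt_one_add_slope_sq {t : ℝ} (ht : 0 < t) :
    (√(1 + ((t - 1) / (2 * √t)) ^ 2))⁻¹ = 2 * √t / (1 + t) := by
  have hq : 0 < √t := Real.sqrt_pos.2 ht
  have e : 1 + ((t - 1) / (2 * √t)) ^ 2 = ((1 + t) / (2 * √t)) ^ 2 := by
    have : √t ^ 2 = t := Real.sq_sqrt ht.le
    rw [div_pow, div_pow, mul_pow, this]
    field_simp
    ring
  rw [e, Real.sqrt_sq (by positivity), inv_div]

theorem capChart_eq_slopeChart {t : ℝ} (ht : 0 < t) (η : USphere n) :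
    capChart t η = slopeChart ((t - 1) / (2 * √t)) η := by
  have hq : 0 < √t := Real.sqrt_pos.2 ht
  apply Subtype.ext
  simp only [capChart_coe ht.le, slopeChart]
  rw [inv_sqrt_one_add_slope_sq ht, smul_snocE]
  congr 1
  field_simp

theorem lastCoord_capChart {t : ℝ} (ht : 0 ≤ t) (η : USphere n) :
    lastCoord (capChart t η) = (t - 1) / (1 + t) := by
  rw [lastCoord, capChart_coe ht, snocE_last]

theorem tanSq_capChart {t : ℝ} (ht : 0 ≤ t) (η : USphere n) : tanSq (capChart t η) = t := by
  have h : angle (capChart t η) = 2 * Real.arctan √t := by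
    rw [angle, lastCoord, capChart, polar_coe, snocE_last, neg_neg, Real.arccos_cos]
    · have := Real.arctan_nonneg.2 (Real.sqrt_nonneg t)
      positivity
    · have := Real.arctan_lt_pi_div_two √t
      linarith
  rw [tanSq, h, mul_div_cancel_left₀ _ (two_ne_zero), Real.tan_arctan, Real.sq_sqrt ht]

theorem direction_capChart {t : ℝ} (ht : 0 < t) (η : USphere n) :
    direction (capChart t η) = (η : EuclideanSpace ℝ (Fin n)) := by
  have hq : 0 < √t := Real.sqrt_pos.2 ht
  have h : (WithLp.toLp 2 fun i : Fin n =>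
      (capChart t η : EuclideanSpace ℝ (Fin (n + 1))) (Fin.castSucc i)) =
      (2 * √t / (1 + t)) • (η : EuclideanSpace ℝ (Fin n)) := by
    ext i
    simp only [capChart_coe ht.le, snocE_castSucc]
  simp only [direction, h]
  rw [norm_smul_sphere (by positivity), smul_smul, inv_mul_cancel₀ (by positivity), one_smul]

theorem capChart_injOn : InjOn (fun p : ℝ × USphere n => capChart p.1 p.2) (Ioi 0 ×ˢ univ) := by
  rintro ⟨t, η⟩ ⟨ht, -⟩ ⟨t', η'⟩ ⟨ht', -⟩ h
  have ht : 0 < t := ht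
  have ht' : 0 < t' := ht'
  have h : capChart t η = capChart t' η' := h
  have h1 := congrArg tanSq h
  have h2 := congrArg direction h
  rw [tanSq_capChart ht.le, tanSq_capChart ht'.le] at h1
  rw [direction_capChart ht, direction_capChart ht'] at h2
  rw [h1, Subtype.ext h2]

@[fun_prop]
theorem measurable_capChart {X : Type*} [MeasurableSpace X] {t : X → ℝ} {η : X → USphere n}
    (ht : Measurable t) (hη : Measurable η) : Measurable fun x => capChart (t x) (η x) := by
  have : ∀ x, capChart (t x) (η x) = (⟨snocE (Real.sin (2 * Real.arctan √(t x)) •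
      (η x : EuclideanSpace ℝ (Fin n))) (-Real.cos (2 * Real.arctan √(t x))),
      (capChart (t x) (η x)).2⟩ : USphere (n + 1)) := fun x => rfl
  simp_rw [this]
  have h := Real.measurable_arctan
  refine Measurable.subtype_mk (measurable_snocE ?_ ?_) <;> fun_prop

theorem capChart_mem_segS_iff {b t : ℝ} (hb : b < 1) (ht : 0 < t) (η : USphere n) :
    capChart t η ∈ segS n (-1) b ↔ t < (1 + b) / (1 - b) := by
  have h1 : 0 < 1 - b := by linarith
  change _ < _ ∧ _ < _ ↔ _
  rw [lastCoord_capChart ht.le, lt_div_iff₀ (by positivity), div_lt_iff₀ (by positivity),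
    lt_div_iff₀ h1]
  constructor
  · rintro ⟨-, h⟩
    linarith
  · intro h
    constructor <;> linarith

theorem capWeight_pos {t : ℝ} (ht : 0 < t) : 0 < capWeight n t := by
  have hq : 0 < √t := Real.sqrt_pos.2 ht
  unfold capWeight
  positivity

@[fun_prop]
theorem measurable_capWeight : Measurable (capWeight n) := by
  unfold capWeight
  fun_prop

/-- The surface measure in the coordinates of `capChart`. -/
noncomputable def capMeasure (n : ℕ) : Measure (ℝ × USphere n) :=
  (((volume : Measure ℝ).restrict (Ioi 0)).prod (surf n)).withDensity
    fun p => ENNReal.ofReal (capWeight n p.1)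

/-- In terms of t the slope density is (2√t/(1+t))^(n+1), and multiplying by the Jacobian
(1+t)/(4t√t) gives `capWeight`. -/
theorem measurePreserving_capChart (hn : 0 < n) : MeasurePreserving
    (fun p : ℝ × USphere n => capChart p.1 p.2) (capMeasure n) (surf (n + 1)) := by
  refine ⟨by fun_prop, ?_⟩
  ext s hs
  have hms : Measurable (s.indicator (1 : USphere (n + 1) → ℝ≥0∞)) := measurable_one.indicator hs
  rw [surf_apply_eq_lintegral_slope hn hs, ← lintegral_indicator_one hs,
    lintegral_map hms (by fun_prop), capMeasure, lintegral_withDensity_eq_lintegral_mul _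
    (by fun_prop) (by fun_prop), lintegral_prod_symm' _ (by fun_prop)]
  refine lintegral_congr fun η => ?_
  rw [lintegral_slope]
  refine setLIntegral_congr_fun measurableSet_Ioi fun t ht => ?_
  have ht : 0 < t := ht
  have hq : 0 < √t := Real.sqrt_pos.2 ht
  simp only [Pi.mul_apply]
  rw [capChart_eq_slopeChart ht, inv_sqrt_one_add_slope_sq ht, ← mul_assoc,
    ← ENNReal.ofReal_mul (by positivity), capWeight, pow_succ]
  congr 2
  field_simp
  ring

/-- A property holds almost everywhere on the sphere if it does so in the coordinates of
`capChart`. -/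
theorem ae_surf_of_ae_capChart (hn : 0 < n) {P : USphere (n + 1) → Prop}
    (h : ∀ᵐ p ∂(((volume : Measure ℝ).restrict (Ioi 0)).prod (surf n)), P (capChart p.1 p.2)) :
    ∀ᵐ x ∂(surf (n + 1)), P x := by
  have : PolishSpace (USphere n) := Metric.isClosed_sphere.polishSpace
  set ν := ((volume : Measure ℝ).restrict (Ioi 0)).prod (surf n) with hν
  have h0 : ∀ᵐ p ∂ν, p ∈ (Ioi (0 : ℝ)) ×ˢ (univ : Set (USphere n)) := by
    have e : ν = (((volume : Measure ℝ).prod (surf n))).restrict ((Ioi 0) ×ˢ univ) := by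
      rw [hν, ← Measure.prod_restrict, Measure.restrict_univ]
    rw [e]
    exact ae_restrict_mem (measurableSet_Ioi.prod MeasurableSet.univ)
  obtain ⟨E, hE, hEm, hE0⟩ := exists_measurable_superset_of_null (ae_iff.1 (h.and h0))
  -- The property is arbitrary, so a measurable set of full measure has to be produced: by the
  -- Lusin–Souslin theorem the injective image of a Borel set in a Polish space is Borel.
  have himg : MeasurableSet ((fun p : ℝ × USphere n => capChart p.1 p.2) '' Eᶜ) := by
    refine hEm.compl.image_of_measurable_injOn (by fun_prop) (capChart_injOn.mono ?_)
    intro p hp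
    by_contra hc
    exact hp (hE fun h => hc h.2)
  have h1 : ∀ᵐ x ∂(surf (n + 1)), x ∈ (fun p : ℝ × USphere n => capChart p.1 p.2) '' Eᶜ := by
    rw [← (measurePreserving_capChart hn).map_eq]
    refine (ae_map_iff (by fun_prop) himg).2 ?_
    rw [capMeasure]
    refine (withDensity_absolutelyContinuous _ _).ae_le ?_
    have : ∀ᵐ p ∂ν, p ∈ Eᶜ := by rw [ae_iff]; simpa using hE0
    filter_upwards [this] with p hp
    exact mem_image_of_mem _ hp
  filter_upwards [h1] with x hx
  obtain ⟨p, hp, rfl⟩ := hx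
  by_contra hc
  exact hp (hE fun h => hc h.1)

/-- The chordal distance in stereographic projection from the North Pole, which sends the two points
to √s ξ and √t η. -/
theorem norm_capChart_sub {s t : ℝ} (hs : 0 < s) (ht : 0 < t) (ξ η : USphere n) :
    ‖(capChart s ξ : EuclideanSpace ℝ (Fin (n + 1))) - capChart t η‖ =
      2 * √t * ‖√(s / t) • (ξ : EuclideanSpace ℝ (Fin n)) - η‖ / (√(1 + s) * √(1 + t)) := by
  have hq : 0 < √t := Real.sqrt_pos.2 ht
  have hsub : (capChart s ξ : EuclideanSpace ℝ (Fin (n + 1))) - capChart t η =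
      snocE ((2 * √s / (1 + s)) • (ξ : EuclideanSpace ℝ (Fin n)) -
        (2 * √t / (1 + t)) • (η : EuclideanSpace ℝ (Fin n)))
        ((s - 1) / (1 + s) - (t - 1) / (1 + t)) := by
    rw [capChart_coe hs.le, capChart_coe ht.le]
    ext i
    refine Fin.lastCases ?_ (fun i => ?_) i <;> simp [snocE]
  have hin : ∀ a c : ℝ, ‖a • (ξ : EuclideanSpace ℝ (Fin n)) - c • (η : EuclideanSpace ℝ (Fin n))‖ ^ 2
      = a ^ 2 - 2 * (a * c) * inner ℝ (ξ : EuclideanSpace ℝ (Fin n)) η + c ^ 2 := fun a c => by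
    rw [norm_sub_sq_real, norm_smul, norm_smul, ξ.norm_eq, η.norm_eq, inner_smul_left,
      inner_smul_right]
    simp only [mul_one, Real.norm_eq_abs, sq_abs, conj_trivial]
    ring
  have h1 := hin √(s / t) 1
  rw [one_smul] at h1
  rw [← sq_eq_sq₀ (norm_nonneg _) (by positivity), hsub, norm_snocE_sq, hin,
    div_pow (2 * √t * _), mul_pow _ ‖_‖, h1, mul_pow √(1 + s), mul_pow 2 √t, Real.sq_sqrt (by positivity), Real.sq_sqrt (by positivity),
    Real.sq_sqrt (show 0 ≤ 1 + s by positivity), Real.sq_sqrt (show 0 ≤ 1 + t by positivity),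
    Real.sqrt_div hs.le]
  set I := inner ℝ (ξ : EuclideanSpace ℝ (Fin n)) (η : EuclideanSpace ℝ (Fin n))
  obtain ⟨a, ha, rfl⟩ : ∃ a, 0 < a ∧ s = a ^ 2 := ⟨√s, Real.sqrt_pos.2 hs, (Real.sq_sqrt hs.le).symm⟩
  obtain ⟨c, hc, rfl⟩ : ∃ a, 0 < a ∧ t = a ^ 2 := ⟨√t, hq, (Real.sq_sqrt ht.le).symm⟩
  rw [Real.sqrt_sq ha.le, Real.sqrt_sq hc.le]
  field_simp
  ring

/-- The identity on which everything rests. The heights differ by 2(t-s)/((1+s)(1+t)), the n-th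
power of the chord supplies the denominator of the Poisson kernel of radius √(s/t), and one of the α
factors t - s is used for its numerator 1 - s/t = (t-s)/t. -/
theorem kernel_mul_capWeight {α s t : ℝ} (hn : 0 < n) (hs : 0 < s) (hst : s < t) (ξ η : USphere n) :
    (lastCoord (capChart t η) - lastCoord (capChart s ξ)) ^ α /
      ‖(capChart s ξ : EuclideanSpace ℝ (Fin (n + 1))) - capChart t η‖ ^ n * capWeight n t =
    area n * 2 ^ (α - 1) * (1 + s) ^ ((n : ℝ) / 2 - α) * ((t - s) ^ (α - 1) *
      (1 + t) ^ (-(α + (n : ℝ) / 2)) * poissonK √(s / t) ξ η) := by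
  have ht : 0 < t := hs.trans hst
  have hts : 0 < t - s := by linarith
  have hq : 0 < √t := Real.sqrt_pos.2 ht
  have hr : √(s / t) < 1 := by
    rw [Real.sqrt_lt' one_pos, one_pow, div_lt_one ht]; exact hst
  have hA : 0 < area n := area_pos hn
  have hD : 0 < ‖√(s / t) • (ξ : EuclideanSpace ℝ (Fin n)) - η‖ := by
    rw [norm_sub_pos_iff]
    intro h
    have := congrArg norm h
    rw [norm_smul_sphere (by positivity), η.norm_eq] at this
    linarith
  have hl : lastCoord (capChart t η) - lastCoord (capChart s ξ) =
      2 * (t - s) * (1 + s)⁻¹ * (1 + t)⁻¹ := by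
    rw [lastCoord_capChart ht.le, lastCoord_capChart hs.le]
    field_simp
    ring
  have e1 : ∀ u : ℝ, 0 < u → (√(1 + u)) ^ n = (1 + u) ^ ((n : ℝ) / 2) := fun u hu => by
    rw [Real.sqrt_eq_rpow, ← Real.rpow_natCast, ← Real.rpow_mul (by positivity)]
    congr 1; ring
  have e2 : (1 + t) ^ n = (1 + t) ^ ((n : ℝ) / 2) * (1 + t) ^ ((n : ℝ) / 2) := by
    rw [← Real.rpow_add (by positivity), add_halves, Real.rpow_natCast]
  rw [hl, norm_capChart_sub hs ht, Real.mul_rpow (by positivity) (by positivity),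
    Real.mul_rpow (by positivity) (by positivity), Real.mul_rpow (by positivity) (by positivity),
    Real.inv_rpow (by positivity), Real.inv_rpow (by positivity), capWeight, div_pow, div_pow,
    mul_pow _ ‖_‖, mul_pow √(1 + s), e1 s hs, e1 t ht, e2, poissonK, pKer,
    norm_smul_sphere (by positivity), Real.sq_sqrt (by positivity),
    Real.rpow_sub hts, Real.rpow_neg (by positivity), Real.rpow_add (by positivity),
    Real.rpow_sub (show 0 < 1 + s by positivity), Real.rpow_sub two_pos, Real.rpow_one,
    Real.rpow_one]
  have p1 : 0 < (1 + s) ^ ((n : ℝ) / 2) := by positivity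
  have p2 : 0 < (1 + t) ^ ((n : ℝ) / 2) := by positivity
  have p3 : 0 < (1 + s) ^ α := by positivity
  have p4 : 0 < (1 + t) ^ α := by positivity
  have p5 : 0 < (2 * √t) ^ n := by positivity
  field_simp

end


section
variable {n : ℕ}

/-! ### Poisson integrals of complex functions -/

/-- The Poisson integral of a complex function. -/
noncomputable def cPoisson (r : ℝ) (f : USphere n → ℂ) (ξ : USphere n) : ℂ :=
  ∫ η, (poissonK r ξ η : ℂ) * f η ∂(surf n)

theorem enorm_cPoisson_le (hn : 0 < n) {r : ℝ} (h0 : 0 ≤ r) (h1 : r < 1) (f : USphere n → ℂ)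
    (ξ : USphere n) : ‖cPoisson r f ξ‖ₑ ≤ lPoisson r (fun η => ‖f η‖ₑ) ξ := by
  refine (enorm_integral_le_lintegral_enorm _).trans_eq (lintegral_congr fun η => ?_)
  rw [enorm_mul, ← ofReal_norm, Complex.norm_real,
    Real.norm_of_nonneg (poissonK_nonneg hn h0 h1 ξ η)]

theorem integrable_poissonK_mul_complex (hn : 0 < n) {r : ℝ} (h0 : 0 ≤ r) (h1 : r < 1)
    {f : USphere n → ℂ} (hf : Integrable f (surf n)) (ξ : USphere n) :
    Integrable (fun η => (poissonK r ξ η : ℂ) * f η) (surf n) := by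
  refine hf.bdd_mul (c := 1 / (1 - r) ^ n / area n)
    (Measurable.aestronglyMeasurable (by fun_prop)) (Eventually.of_forall fun η => ?_)
  rw [Complex.norm_real, Real.norm_of_nonneg (poissonK_nonneg hn h0 h1 _ _)]
  exact poissonK_le hn h0 h1 _ _

theorem enorm_cPoisson_sub_le (hn : 0 < n) {r : ℝ} (h0 : 0 ≤ r) (h1 : r < 1) {f g : USphere n → ℂ}
    (hf : Measurable f) (hg : Integrable g (surf n)) (ξ : USphere n) :
    ‖cPoisson r f ξ - cPoisson r g ξ‖ₑ ≤ lPoisson r (fun η => ‖f η - g η‖ₑ) ξ := by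
  by_cases h : lPoisson r (fun η => ‖f η - g η‖ₑ) ξ = ∞
  · rw [h]; exact le_top
  have hg' := integrable_poissonK_mul_complex hn h0 h1 hg ξ
  have hd : Integrable (fun η => (poissonK r ξ η : ℂ) * (f η - g η)) (surf n) := by
    refine ⟨(Measurable.aestronglyMeasurable (f := fun η => (poissonK r ξ η : ℂ))
      (by fun_prop)).mul (hf.aestronglyMeasurable.sub hg.1), ?_⟩
    rw [hasFiniteIntegral_iff_enorm]
    refine lt_of_le_of_lt (lintegral_mono fun η => ?_) (lt_top_iff_ne_top.2 h)
    rw [enorm_mul, ← ofReal_norm, Complex.norm_real,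
      Real.norm_of_nonneg (poissonK_nonneg hn h0 h1 ξ η)]
  have hf' : Integrable (fun η => (poissonK r ξ η : ℂ) * f η) (surf n) := by
    refine (hd.add hg').congr (Eventually.of_forall fun η => ?_)
    simp only [Pi.add_apply]
    ring
  have e : cPoisson r f ξ - cPoisson r g ξ = cPoisson r (fun η => f η - g η) ξ := by
    unfold cPoisson
    rw [← integral_sub hf' hg']
    simp_rw [mul_sub]
  rw [e]
  exact enorm_cPoisson_le hn h0 h1 _ ξ

theorem stronglyMeasurable_cPoisson {X : Type*} [MeasurableSpace X] {G : ℝ × USphere n → ℂ}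
    (hG : Measurable G) {r t : X → ℝ} {ξ : X → USphere n} (hr : Measurable r) (ht : Measurable t)
    (hξ : Measurable ξ) :
    StronglyMeasurable fun x => cPoisson (r x) (fun η => G (t x, η)) (ξ x) := by
  unfold cPoisson
  refine StronglyMeasurable.integral_prod_right
    (f := fun x η => (poissonK (r x) (ξ x) η : ℂ) * G (t x, η)) ?_
  exact Measurable.stronglyMeasurable (by fun_prop)

theorem measurable_poissonMax_prod {F : ℝ × USphere n → ℝ≥0∞} (hF : Measurable F) :
    Measurable fun p : ℝ × USphere n => poissonMax (fun η => F (p.1, η)) p.2 := by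
  unfold poissonMax lPoisson
  refine Measurable.iSup fun j => Measurable.lintegral_prod_right'
    (f := fun p : (ℝ × USphere n) × USphere n =>
      ENNReal.ofReal (poissonK (maxRadius j) p.1.2 p.2) * F (p.1.1, p.2)) ?_
  fun_prop

/-- The limit is joint in the parallel and the radius, as both vary together later. Away from ξ the
kernel is small since 1 - r < d/2 keeps rξ at distance at least d/2 from η; near ξ continuity of g
and mass one suffice. -/
theorem tendsto_cPoisson (hn : 0 < n) {g : ℝ × USphere n → ℂ} (hg : Continuous g) {C : ℝ}
    (hC : ∀ p, ‖g p‖ ≤ C) (s : ℝ) (ξ : USphere n) :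
    Tendsto (fun p : ℝ × ℝ => cPoisson p.2 (fun η => g (p.1, η)) ξ) (𝓝 s ×ˢ 𝓝[<] 1)
      (𝓝 (g (s, ξ))) := by
  have hA := area_pos hn
  have hC0 : 0 ≤ C := (norm_nonneg _).trans (hC (s, ξ))
  rw [Metric.tendsto_nhds]
  intro ε hε
  obtain ⟨d, hd, hdg⟩ := Metric.continuousAt_iff.1 (hg.continuousAt (x := (s, ξ))) (ε / 2) (by positivity)
  have e1 : ∀ᶠ r in 𝓝[<] (1 : ℝ), (0 ≤ r ∧ r < 1 ∧ 1 - r < d / 2) ∧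
      (1 - r ^ 2) / (d / 2) ^ n * (2 * C) < ε / 2 := by
    have hc : Tendsto (fun r : ℝ => (1 - r ^ 2) / (d / 2) ^ n * (2 * C)) (𝓝[<] 1) (𝓝 0) := by
      have : Continuous fun r : ℝ => (1 - r ^ 2) / (d / 2) ^ n * (2 * C) := by fun_prop
      have h := (this.tendsto 1).mono_left (nhdsWithin_le_nhds (s := Iio 1))
      simpa using h
    filter_upwards [hc.eventually (gt_mem_nhds (show (0 : ℝ) < ε / 2 by positivity)),
      Ioo_mem_nhdsLT (show max 0 (1 - d / 2) < 1 by simp [hd])] with r h1 h2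
    exact ⟨⟨(le_max_left _ _).trans h2.1.le, h2.2, by linarith [(le_max_right 0 (1 - d / 2)).trans_lt h2.1]⟩, h1⟩
  have e2 : ∀ᶠ t in 𝓝 s, dist t s < d := Metric.ball_mem_nhds s hd
  filter_upwards [e2.prod_mk e1] with p hp
  obtain ⟨ht, ⟨h0, h1, hrd⟩, hsmall⟩ := hp
  set t := p.1
  set r := p.2
  have hgi : Integrable (fun η => g (t, η)) (surf n) :=
    Integrable.of_bound (by fun_prop) C (Eventually.of_forall fun η => hC _)
  have i1 := integrable_poissonK_mul_complex hn h0 h1 hgi ξ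
  have i2 := integrable_poissonK_mul_complex hn h0 h1
    (integrable_const (μ := surf n) (g (s, ξ))) ξ
  have ec : ∫ η, (poissonK r ξ η : ℂ) * g (s, ξ) ∂(surf n) = g (s, ξ) := by
    rw [integral_mul_const, integral_complex_ofReal, integral_poissonK hn h0 h1]
    simp
  rw [dist_eq_norm]
  conv_lhs => rw [← ec]
  rw [cPoisson, ← integral_sub i1 i2]
  have ib : Integrable (fun η => poissonK r ξ η * (ε / 2) +
      (1 - r ^ 2) / (d / 2) ^ n / area n * (2 * C)) (surf n) :=
    ((integrable_poissonK hn h0 h1 ξ).mul_const _).add (integrable_const _)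
  have hr2 : 0 ≤ 1 - r ^ 2 := by nlinarith
  refine (norm_integral_le_of_norm_le ib (Eventually.of_forall fun η => ?_)).trans_lt ?_
  · rw [← mul_sub, norm_mul, Complex.norm_real, Real.norm_of_nonneg (poissonK_nonneg hn h0 h1 _ _)]
    by_cases hη : dist η ξ < d
    · have : ‖g (t, η) - g (s, ξ)‖ ≤ ε / 2 := by
        rw [← dist_eq_norm]
        refine (hdg ?_).le
        rw [Prod.dist_eq]
        exact max_lt ht hη
      have hk := poissonK_nonneg hn h0 h1 ξ η
      calc _ ≤ poissonK r ξ η * (ε / 2) := by gcongr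
        _ ≤ _ := le_add_of_nonneg_right (by positivity)
    · have h2 : ‖g (t, η) - g (s, ξ)‖ ≤ 2 * C := by
        refine (norm_sub_le _ _).trans ?_
        linarith [hC (t, η), hC (s, ξ)]
      have h3 : poissonK r ξ η ≤ (1 - r ^ 2) / (d / 2) ^ n / area n := by
        unfold poissonK
        gcongr
        have := pKer_le (x := r • (ξ : EuclideanSpace ℝ (Fin n)))
          (y := (η : EuclideanSpace ℝ (Fin n))) (d := d / 2) (by positivity) ?_
          (by rw [norm_smul_sphere h0]; exact h1.le)
        · rwa [norm_smul_sphere h0] at this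
        · have h4 : d ≤ ‖(ξ : EuclideanSpace ℝ (Fin n)) - η‖ := by
            rw [← dist_eq_norm, dist_comm]
            exact not_lt.1 hη
          have e5 : (ξ : EuclideanSpace ℝ (Fin n)) - η =
              (1 - r) • (ξ : EuclideanSpace ℝ (Fin n)) +
                (r • (ξ : EuclideanSpace ℝ (Fin n)) - η) := by
            rw [sub_smul, one_smul]; abel
          have h6 := norm_add_le ((1 - r) • (ξ : EuclideanSpace ℝ (Fin n)))
            (r • (ξ : EuclideanSpace ℝ (Fin n)) - η)
          rw [← e5, norm_smul_sphere (sub_nonneg.2 h1.le)] at h6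
          linarith
      have hk := poissonK_nonneg hn h0 h1 ξ η
      calc _ ≤ (1 - r ^ 2) / (d / 2) ^ n / area n * (2 * C) := by gcongr
        _ ≤ _ := le_add_of_nonneg_left (by positivity)
  · have : Integrable (fun η => poissonK r ξ η * (ε / 2)) (surf n) :=
      (integrable_poissonK hn h0 h1 ξ).mul_const _
    rw [integral_add this (integrable_const _), integral_mul_const, integral_poissonK hn h0 h1,
      integral_const, measureReal_surf_univ hn, smul_eq_mul]
    have : area n * ((1 - r ^ 2) / (d / 2) ^ n / area n * (2 * C)) =
      (1 - r ^ 2) / (d / 2) ^ n * (2 * C) := by field_simp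
    linarith

/-! ### Differentiation of integrals along the first coordinate -/

/-- Lebesgue differentiation on almost every line, with intervals to the right of the point.
Restricting to the radii 2^(-i) makes the upper limit measurable, as needed to reassemble the lines
by Fubini; passing to arbitrary radii costs the factor 2. -/
theorem ae_setLIntegral_Ioc_le {Y : Type*} [MeasurableSpace Y] (ν : Measure Y) [SFinite ν]
    {F : ℝ × Y → ℝ≥0∞} (hF : Measurable F)
    (hfin : ∫⁻ p, F p ∂((volume : Measure ℝ).prod ν) ≠ ∞) :
    ∀ᵐ p ∂((volume : Measure ℝ).prod ν), ∀ D, F p < D → ∃ δ > 0, ∀ r, 0 < r → r ≤ δ →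
      ∫⁻ t in Ioc 0 r, F (p.1 + t, p.2) ≤ 2 * D * ENNReal.ofReal r := by
  set A : ℕ → ℝ × Y → ℝ≥0∞ := fun i p => (ENNReal.ofReal ((1 / 2) ^ i))⁻¹ *
    ∫⁻ t in Ioc (0 : ℝ) ((1 / 2) ^ i), F (p.1 + t, p.2) with hA
  have hAm : ∀ i, Measurable (A i) := fun i => by
    refine Measurable.const_mul (Measurable.lintegral_prod_right'
      (f := fun q : (ℝ × Y) × ℝ => F (q.1.1 + q.2, q.1.2)) (by fun_prop)) _
  have hset : MeasurableSet {p | limsup (fun i => A i p) atTop ≤ F p} :=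
    measurableSet_le (Measurable.limsup hAm) hF
  have hae : ∀ᵐ p ∂((volume : Measure ℝ).prod ν), limsup (fun i => A i p) atTop ≤ F p := by
    rw [ae_iff]
    have hm : MeasurableSet {p | ¬ limsup (fun i => A i p) atTop ≤ F p} := hset.compl
    rw [Measure.prod_apply_symm hm, lintegral_eq_zero_iff (measurable_measure_prodMk_right hm)]
    have hfib : ∀ᵐ y ∂ν, ∫⁻ t, F (t, y) < ∞ := by
      refine ae_lt_top hF.lintegral_prod_left' ?_
      rwa [← lintegral_prod_symm' _ hF]
    filter_upwards [hfib] with y hy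
    change volume {s | ¬ limsup (fun i => A i (s, y)) atTop ≤ F (s, y)} = 0
    rw [← ae_iff]
    have hFy : Measurable fun t => F (t, y) := by fun_prop
    filter_upwards [VitaliFamily.ae_tendsto_lintegral_div (IsUnifLocDoublingMeasure.vitaliFamily
      (volume : Measure ℝ) 1) hFy.aemeasurable hy.ne] with s hs
    have h1 := hs.comp (Real.tendsto_Icc_vitaliFamily_right s)
    have h2 : Tendsto (fun i : ℕ => s + ((1 : ℝ) / 2) ^ i) atTop (𝓝[>] s) := by
      refine tendsto_nhdsWithin_iff.2 ⟨?_, Eventually.of_forall fun i => ?_⟩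
      · have := (tendsto_pow_atTop_nhds_zero_of_lt_one (r := (1 : ℝ) / 2) (by norm_num)
          (by norm_num)).const_add s
        rwa [add_zero] at this
      · exact lt_add_of_pos_right s (by positivity)
    have h3 := h1.comp h2
    refine (Tendsto.limsup_eq (h3.congr fun i => ?_)).le
    simp only [Function.comp_apply, hA, Real.volume_Icc, add_sub_cancel_left]
    rw [ENNReal.div_eq_inv_mul]
    congr 1
    rw [Measure.restrict_congr_set Ioc_ae_eq_Icc.symm, ← lintegral_indicator measurableSet_Ioc,
      ← lintegral_indicator measurableSet_Ioc, ← lintegral_add_left_eq_self _ s]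
    refine lintegral_congr fun t => ?_
    simp only [indicator_apply, mem_Ioc, lt_add_iff_pos_right, add_le_add_iff_left]
  filter_upwards [hae] with p hp D hD
  have hev := eventually_lt_of_limsup_lt (hp.trans_lt hD)
  obtain ⟨i0, hi0⟩ := eventually_atTop.1 hev
  refine ⟨(1 / 2) ^ i0, by positivity, fun r hr hr0 => ?_⟩
  have hr1 : r ≤ 1 := hr0.trans (pow_le_one₀ (by norm_num) (by norm_num))
  obtain ⟨i, hi1, hi2⟩ := exists_nat_pow_near_of_lt_one hr hr1 (by norm_num : (0 : ℝ) < 1 / 2)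
    (by norm_num)
  have key : ∀ j, i0 ≤ j → r ≤ (1 / 2) ^ j → (1 / 2) ^ j ≤ 2 * r →
      ∫⁻ t in Ioc 0 r, F (p.1 + t, p.2) ≤ 2 * D * ENNReal.ofReal r := by
    intro j hj h1 h2
    have h3 := (hi0 j hj).le
    have hpos : (0 : ℝ) < (1 / 2) ^ j := by positivity
    simp only [hA] at h3
    rw [ENNReal.inv_mul_le_iff (by simp) (by simp)] at h3
    calc ∫⁻ t in Ioc 0 r, F (p.1 + t, p.2)
        ≤ ∫⁻ t in Ioc 0 ((1 / 2) ^ j), F (p.1 + t, p.2) :=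
          lintegral_mono_set (Ioc_subset_Ioc_right h1)
      _ ≤ ENNReal.ofReal ((1 / 2) ^ j) * D := h3
      _ ≤ ENNReal.ofReal (2 * r) * D := by gcongr
      _ = _ := by
        rw [ENNReal.ofReal_mul (by norm_num), ENNReal.ofReal_ofNat]; ring
  rcases Nat.lt_or_ge i i0 with h | h
  · have : r ≤ (1 / 2) ^ i0 := hr0
    have h4 : ((1 : ℝ) / 2) ^ i0 ≤ (1 / 2) ^ (i + 1) :=
      pow_le_pow_of_le_one (by norm_num) (by norm_num) h
    exact key i0 le_rfl hr0 (by linarith)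
  · refine key i h hi2 ?_
    rw [pow_succ] at hi1
    linarith

end


/-! ### Averages of Poisson integrals over the parallels above a point -/

section
variable {n : ℕ}

theorem poissonMax_zero {f : USphere n → ℝ≥0∞} (hf : ∀ η, f η = 0) (ξ : USphere n) :
    poissonMax f ξ = 0 := by
  simp [poissonMax, lPoisson, hf]

theorem norm_cPoisson_le (hn : 0 < n) {r : ℝ} (h0 : 0 ≤ r) (h1 : r < 1) {f : USphere n → ℂ}
    {C : ℝ} (hC : ∀ η, ‖f η‖ ≤ C) (ξ : USphere n) : ‖cPoisson r f ξ‖ ≤ C := by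
  have hi : Integrable (fun η => poissonK r ξ η * C) (surf n) :=
    (integrable_poissonK hn h0 h1 ξ).mul_const _
  refine (norm_integral_le_of_norm_le hi (Eventually.of_forall fun η => ?_)).trans_eq ?_
  · rw [norm_mul, Complex.norm_real, Real.norm_of_nonneg (poissonK_nonneg hn h0 h1 _ _)]
    exact mul_le_mul_of_nonneg_left (hC η) (poissonK_nonneg hn h0 h1 _ _)
  · rw [integral_mul_const, integral_poissonK hn h0 h1, one_mul]

theorem sqrt_div_mem {s t : ℝ} (hs : 0 < s) (ht : 0 < t) : 0 ≤ √(s / (s + t)) ∧ √(s / (s + t)) < 1 := by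
  refine ⟨Real.sqrt_nonneg _, ?_⟩
  rw [Real.sqrt_lt' one_pos, one_pow, div_lt_one (by positivity)]
  linarith

theorem tendsto_integral_avgKernel_continuous (hn : 0 < n) {α : ℝ} (hα : 0 < α) {l : ℕ}
    (hl : α < l) {g : ℝ × USphere n → ℂ} (hg : Continuous g) {C : ℝ} (hC : ∀ p, ‖g p‖ ≤ C)
    {s : ℝ} (hs : 0 < s) (ξ : USphere n) :
    Tendsto (fun ε => ∫ y in Ioi (0 : ℝ), (avgKernel α l y : ℂ) *
      cPoisson √(s / (s + ε * y)) (fun η => g (s + ε * y, η)) ξ) (𝓝[>] 0)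
      (𝓝 ((kappa α l : ℂ) * g (s, ξ))) := by
  have hlim : ∫ y in Ioi (0 : ℝ), (avgKernel α l y : ℂ) * g (s, ξ) = (kappa α l : ℂ) * g (s, ξ) := by
    rw [integral_mul_const, integral_complex_ofReal, integral_avgKernel hα hl]
  rw [← hlim]
  have hk := measurable_avgKernel α l
  refine tendsto_integral_filter_of_dominated_convergence (fun y => |avgKernel α l y| * C) ?_ ?_
    ((integrableOn_avgKernel hα hl).abs.mul_const C) ?_
  · refine Eventually.of_forall fun ε => StronglyMeasurable.aestronglyMeasurable
      (StronglyMeasurable.mul (Measurable.stronglyMeasurable (by fun_prop)) ?_)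
    exact stronglyMeasurable_cPoisson hg.measurable (by fun_prop) (by fun_prop) measurable_const
  · filter_upwards [self_mem_nhdsWithin] with ε hε
    have hε : 0 < ε := hε
    filter_upwards [ae_restrict_mem measurableSet_Ioi] with y hy
    have hy : 0 < y := hy
    obtain ⟨h0, h1⟩ := sqrt_div_mem hs (mul_pos hε hy)
    rw [norm_mul, Complex.norm_real, Real.norm_eq_abs]
    gcongr
    exact norm_cPoisson_le hn h0 h1 (fun η => hC _) ξ
  · filter_upwards [ae_restrict_mem measurableSet_Ioi] with y hy
    have hy : 0 < y := hy
    refine Tendsto.const_mul _ ?_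
    have h1 : Tendsto (fun ε : ℝ => s + ε * y) (𝓝[>] 0) (𝓝 s) := by
      have : Continuous fun ε : ℝ => s + ε * y := by fun_prop
      have h := (this.tendsto 0).mono_left (nhdsWithin_le_nhds (s := Ioi 0))
      simpa using h
    have h2 : Tendsto (fun ε : ℝ => √(s / (s + ε * y))) (𝓝[>] 0) (𝓝[<] 1) := by
      refine tendsto_nhdsWithin_iff.2 ⟨?_, ?_⟩
      · have h := (tendsto_const_nhds (x := s)).div h1 hs.ne'
        rw [div_self hs.ne'] at h
        simpa using h.sqrt
      · filter_upwards [self_mem_nhdsWithin] with ε hε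
        exact (sqrt_div_mem hs (mul_pos hε hy)).2
    have h3 := (tendsto_cPoisson hn hg hC s ξ).comp (h1.prodMk h2)
    simpa only [Function.comp_def] using h3

/-- A pointwise criterion. Replacing G by a continuous g costs at most the kernel integral of the
maximal function of G - g, which the density bound on short intervals keeps of order e; for g itself
the limit is known. -/
theorem tendsto_integral_avgKernel_of_approx (hn : 0 < n) {α : ℝ} (hα : 0 < α) {l : ℕ}
    (hl : α < l) {G : ℝ × USphere n → ℂ} (hG : Measurable G) {s : ℝ} (hs : 0 < s) {ξ : USphere n}
    (happ : ∀ e : ℝ≥0∞, 0 < e → ∃ g : ℝ × USphere n → ℂ, Continuous g ∧ (∃ C, ∀ p, ‖g p‖ ≤ C) ∧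
      ∫⁻ t in Ioi (0 : ℝ), poissonMax (fun η => ‖G (s + t, η) - g (s + t, η)‖ₑ) ξ ≠ ∞ ∧
      ‖G (s, ξ) - g (s, ξ)‖ₑ ≤ e ∧ ∃ δ > 0, ∀ r, 0 < r → r ≤ δ →
        ∫⁻ t in Ioc 0 r, poissonMax (fun η => ‖G (s + t, η) - g (s + t, η)‖ₑ) ξ ≤
          e * ENNReal.ofReal r) :
    Tendsto (fun ε => ∫ y in Ioi (0 : ℝ), (avgKernel α l y : ℂ) *
      cPoisson √(s / (s + ε * y)) (fun η => G (s + ε * y, η)) ξ) (𝓝[>] 0)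
      (𝓝 ((kappa α l : ℂ) * G (s, ξ))) := by
  obtain ⟨κ, hκm, hκ0, hκ, hkκ⟩ := exists_avgKernel_majorant hα hl
  set K : ℝ≥0∞ := ∫⁻ ρ in Ioi (0 : ℝ), ENNReal.ofReal (κ ρ) with hK
  have hKfin : K ≠ ∞ := hκ.lintegral_lt_top.ne
  have hkm := measurable_avgKernel α l
  -- The three terms of the final triangle inequality, per unit of e: replacing G by g under the
  -- integral, the convergence for g, and replacing g by G in the limit.
  set c : ℝ≥0∞ := 2 ^ (n + 1) * (2 * K + 1) + 1 + ‖(kappa α l : ℂ)‖ₑ with hc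
  have hcfin : c ≠ ∞ := by
    refine ENNReal.add_ne_top.2 ⟨ENNReal.add_ne_top.2 ⟨ENNReal.mul_ne_top (by simp) ?_, by simp⟩,
      enorm_ne_top⟩
    exact ENNReal.add_ne_top.2 ⟨ENNReal.mul_ne_top (by simp) hKfin, by simp⟩
  rw [EMetric.tendsto_nhds]
  intro ε0 hε0
  obtain ⟨e, he0, hec⟩ := ENNReal.exists_nnreal_pos_mul_lt hcfin hε0.ne'
  have he : (0 : ℝ≥0∞) < e := by exact_mod_cast he0
  obtain ⟨g, hg, ⟨C, hC⟩, hfin, hpt, δ, hδ, hD⟩ := happ e he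
  have hmm : Measurable fun t : ℝ => poissonMax (fun η => ‖G (s + t, η) - g (s + t, η)‖ₑ) ξ := by
    have hgm := hg.measurable
    have h := (measurable_poissonMax_prod (F := fun q => ‖G q - g q‖ₑ) (by fun_prop)).comp
      (show Measurable fun t : ℝ => (s + t, ξ) by fun_prop)
    simpa only [Function.comp_def] using h
  have hA := eventually_lintegral_kernel_le (k := avgKernel α l) hκm hκ hkκ hmm hfin hδ hD he
  have hB := EMetric.tendsto_nhds.1 (tendsto_integral_avgKernel_continuous hn hα hl hg hC hs ξ) e he
  filter_upwards [hA, hB, self_mem_nhdsWithin] with ε h1 h2 hε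
  have hε : 0 < ε := hε
  have hsmG : StronglyMeasurable fun y : ℝ => (avgKernel α l y : ℂ) *
      cPoisson √(s / (s + ε * y)) (fun η => G (s + ε * y, η)) ξ :=
    StronglyMeasurable.mul (Measurable.stronglyMeasurable (by fun_prop))
      (stronglyMeasurable_cPoisson hG (by fun_prop) (by fun_prop) measurable_const)
  have hsmg : StronglyMeasurable fun y : ℝ => (avgKernel α l y : ℂ) *
      cPoisson √(s / (s + ε * y)) (fun η => g (s + ε * y, η)) ξ :=
    StronglyMeasurable.mul (Measurable.stronglyMeasurable (by fun_prop))
      (stronglyMeasurable_cPoisson hg.measurable (by fun_prop) (by fun_prop) measurable_const)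
  have hig : Integrable (fun y : ℝ => (avgKernel α l y : ℂ) *
      cPoisson √(s / (s + ε * y)) (fun η => g (s + ε * y, η)) ξ) (volume.restrict (Ioi 0)) := by
    refine Integrable.mono' ((integrableOn_avgKernel hα hl).abs.mul_const C)
      hsmg.aestronglyMeasurable ?_
    filter_upwards [ae_restrict_mem measurableSet_Ioi] with y hy
    obtain ⟨h0, h1⟩ := sqrt_div_mem hs (mul_pos hε hy)
    rw [norm_mul, Complex.norm_real, Real.norm_eq_abs]
    gcongr
    exact norm_cPoisson_le hn h0 h1 (fun η => hC _) ξ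
  have hdiff : ∫⁻ y in Ioi (0 : ℝ), ‖(avgKernel α l y : ℂ) *
      cPoisson √(s / (s + ε * y)) (fun η => G (s + ε * y, η)) ξ - (avgKernel α l y : ℂ) *
      cPoisson √(s / (s + ε * y)) (fun η => g (s + ε * y, η)) ξ‖ₑ ≤
      2 ^ (n + 1) * (2 * e * K + e) := by
    refine le_trans ?_ (mul_le_mul_right h1 _)
    rw [← lintegral_const_mul' _ _ (by simp)]
    refine setLIntegral_mono' measurableSet_Ioi fun y hy => ?_
    obtain ⟨h0, h1⟩ := sqrt_div_mem hs (mul_pos hε hy)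
    have hgm := hg.measurable
    rw [← mul_sub, enorm_mul, ← ofReal_norm, Complex.norm_real, Real.norm_eq_abs, mul_left_comm]
    gcongr
    refine (enorm_cPoisson_sub_le hn h0 h1 (by fun_prop) ?_ ξ).trans
      (lPoisson_le_poissonMax hn h0 h1 (by fun_prop) ξ)
    exact Integrable.of_bound (by fun_prop) C (Eventually.of_forall fun η => hC _)
  have hid : Integrable (fun y : ℝ => (avgKernel α l y : ℂ) *
      cPoisson √(s / (s + ε * y)) (fun η => G (s + ε * y, η)) ξ - (avgKernel α l y : ℂ) *
      cPoisson √(s / (s + ε * y)) (fun η => g (s + ε * y, η)) ξ) (volume.restrict (Ioi 0)) := by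
    refine ⟨(hsmG.sub hsmg).aestronglyMeasurable, ?_⟩
    rw [hasFiniteIntegral_iff_enorm]
    refine hdiff.trans_lt (lt_top_iff_ne_top.2 (ENNReal.mul_ne_top (by simp) ?_))
    exact ENNReal.add_ne_top.2 ⟨ENNReal.mul_ne_top (by finiteness) hKfin, by simp⟩
  have hiG : Integrable (fun y : ℝ => (avgKernel α l y : ℂ) *
      cPoisson √(s / (s + ε * y)) (fun η => G (s + ε * y, η)) ξ) (volume.restrict (Ioi 0)) := by
    refine (hid.add hig).congr (Eventually.of_forall fun y => ?_)
    simp only [Pi.add_apply, sub_add_cancel]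
  have e1 : edist (∫ y in Ioi (0 : ℝ), (avgKernel α l y : ℂ) *
      cPoisson √(s / (s + ε * y)) (fun η => G (s + ε * y, η)) ξ)
      (∫ y in Ioi (0 : ℝ), (avgKernel α l y : ℂ) *
      cPoisson √(s / (s + ε * y)) (fun η => g (s + ε * y, η)) ξ) ≤
      2 ^ (n + 1) * (2 * e * K + e) := by
    rw [edist_eq_enorm_sub, ← integral_sub hiG hig]
    exact (enorm_integral_le_lintegral_enorm _).trans hdiff
  have e3 : edist ((kappa α l : ℂ) * g (s, ξ)) ((kappa α l : ℂ) * G (s, ξ)) ≤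
      ‖(kappa α l : ℂ)‖ₑ * e := by
    rw [edist_comm, edist_eq_enorm_sub, ← mul_sub, enorm_mul]
    gcongr
  refine lt_of_le_of_lt ((edist_triangle4 _ _ _ _).trans (add_le_add (add_le_add e1 h2.le) e3)) ?_
  refine lt_of_eq_of_lt ?_ hec
  rw [hc]
  ring

/-- Approximation by continuous functions together with their Poisson maximal functions. -/
theorem exists_continuous_approx (hn : 0 < n) {p : ℝ} (hp : 1 < p) {B : ℝ}
    {G : ℝ × USphere n → ℂ} (hG : Measurable G) (hsupp : ∀ q, q.1 ∉ Ioo 0 B → G q = 0)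
    (hfin : ∫⁻ q, ‖G q‖ₑ ^ p ∂((volume : Measure ℝ).prod (surf n)) ≠ ∞) {e : ℝ≥0∞} (he : 0 < e) :
    ∃ g : ℝ × USphere n → ℂ, Continuous g ∧ (∃ C, ∀ q, ‖g q‖ ≤ C) ∧
      ∫⁻ q : ℝ × USphere n, (poissonMax (fun η => ‖G (q.1, η) - g (q.1, η)‖ₑ) q.2 + ‖G q - g q‖ₑ)
        ∂((volume : Measure ℝ).prod (surf n)) ≤ e := by
  have hp0 : 0 < p := one_pos.trans hp
  have hee : e / 2 ≠ 0 := (ENNReal.half_pos he.ne').ne'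
  -- B + 2 is the length of (-1, B + 1), where the cut-off approximation lives. The 2 counts the
  -- maximal function and the pointwise error, each costing δ times the area of a parallel.
  set a : ℝ≥0∞ := 2 * surf n univ * ENNReal.ofReal (B + 2) with ha
  have hafin : a ≠ ∞ := ENNReal.mul_ne_top (ENNReal.mul_ne_top (by simp) (measure_ne_top _ _)) (by simp)
  obtain ⟨δ, hδ0, hδ⟩ := ENNReal.exists_nnreal_pos_mul_lt hafin hee
  obtain ⟨C1, hC1, hmax⟩ := exists_lintegral_poissonMax_le hn hp (show (0 : ℝ) < δ by exact_mod_cast hδ0)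
  set C : ℝ≥0∞ := C1 + ENNReal.ofReal ((δ : ℝ) ^ (1 - p)) with hC
  have hCfin : C ≠ ∞ := ENNReal.add_ne_top.2 ⟨hC1, by simp⟩
  obtain ⟨N, hN0, hN⟩ := ENNReal.exists_nnreal_pos_mul_lt hCfin hee
  set μ' := ((volume : Measure ℝ).restrict (Ioo (-1) (B + 1))).prod (surf n) with hμ'
  have hμ'e : μ' = ((volume : Measure ℝ).prod (surf n)).restrict (Ioo (-1) (B + 1) ×ˢ univ) := by
    rw [hμ', ← Measure.prod_restrict, Measure.restrict_univ]
  have hpp0 : ENNReal.ofReal p ≠ 0 := by simpa using hp0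
  have hGm : MemLp G (ENNReal.ofReal p) μ' := by
    refine ⟨hG.aestronglyMeasurable, ?_⟩
    rw [eLpNorm_lt_top_iff_lintegral_rpow_enorm_lt_top hpp0 (by simp), ENNReal.toReal_ofReal hp0.le,
      hμ'e]
    exact (setLIntegral_le_lintegral _ _).trans_lt (lt_top_iff_ne_top.2 hfin)
  have hN1 : ((N : ℝ≥0∞) ^ (1 / p)) ≠ 0 := by
    have : (0 : ℝ≥0∞) < N := by exact_mod_cast hN0
    exact (ENNReal.rpow_pos this (by simp)).ne'
  obtain ⟨g0, hg0, -⟩ := hGm.exists_boundedContinuous_eLpNorm_sub_le (by simp) hN1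
  have hg0' : ∫⁻ q, ‖G q - g0 q‖ₑ ^ p ∂μ' ≤ N := by
    rw [eLpNorm_eq_lintegral_rpow_enorm_toReal hpp0 (by simp), ENNReal.toReal_ofReal hp0.le,
      ENNReal.rpow_le_rpow_iff (by positivity)] at hg0
    exact hg0
  set χ : ℝ → ℝ := fun t => max 0 (min 1 (min (t + 1) (B + 1 - t))) with hχ
  have hχc : Continuous χ := by fun_prop
  have hχ0 : ∀ t, 0 ≤ χ t := fun t => le_max_left _ _
  have hχ1 : ∀ t, χ t ≤ 1 := fun t => max_le zero_le_one (min_le_left _ _)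
  have hχin : ∀ t ∈ Ioo 0 B, χ t = 1 := fun t ht => by
    have : min 1 (min (t + 1) (B + 1 - t)) = 1 :=
      min_eq_left (le_min (by linarith [ht.1]) (by linarith [ht.2]))
    simp [hχ, this]
  have hχout : ∀ t, t ∉ Ioo (-1) (B + 1) → χ t = 0 := fun t ht => by
    refine max_eq_left ((min_le_right _ _).trans ?_)
    by_contra! h
    exact ht ⟨by linarith [(lt_min_iff.1 h).1], by linarith [(lt_min_iff.1 h).2]⟩
  set g : ℝ × USphere n → ℂ := fun q => (χ q.1 : ℂ) * g0 q with hg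
  have hgc : Continuous g := by fun_prop
  -- Since χ = 1 on (0, B), outside of which G vanishes, the cut-off does not increase the error and
  -- confines it to a bounded range of t.
  have hgG : ∀ q, G q - g q = (χ q.1 : ℂ) * (G q - g0 q) := fun q => by
    by_cases hq : q.1 ∈ Ioo 0 B
    · simp [hg, hχin _ hq]
    · simp [hg, hsupp q hq]
  set D : ℝ × USphere n → ℝ≥0∞ := fun q => ‖G q - g q‖ₑ with hD
  have hgm := hgc.measurable
  have hDm : Measurable D := by fun_prop
  have hDle : ∀ q, D q ≤ ‖G q - g0 q‖ₑ := fun q => by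
    rw [hD]
    simp only
    rw [hgG, enorm_mul]
    refine mul_le_of_le_one_left' ?_
    rw [← ofReal_norm, Complex.norm_real, Real.norm_of_nonneg (hχ0 _)]
    exact ENNReal.ofReal_le_one.2 (hχ1 _)
  have hDout : ∀ q, q.1 ∉ Ioo (-1) (B + 1) → D q = 0 := fun q hq => by
    simp [hD, hgG, hχout _ hq]
  refine ⟨g, hgc, ⟨‖g0‖, fun q => ?_⟩, ?_⟩
  · rw [hg]
    simp only [norm_mul, Complex.norm_real, Real.norm_of_nonneg (hχ0 _)]
    exact (mul_le_of_le_one_left (norm_nonneg _) (hχ1 _)).trans (g0.norm_coe_le_norm q)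
  have hPm : Measurable fun q : ℝ × USphere n => poissonMax (fun η => D (q.1, η)) q.2 :=
    measurable_poissonMax_prod hDm
  change ∫⁻ q : ℝ × USphere n, (poissonMax (fun η => D (q.1, η)) q.2 + D q) ∂_ ≤ e
  rw [lintegral_prod _ (by fun_prop)]
  have hfib : ∀ t, ∫⁻ ξ, (poissonMax (fun η => D (t, η)) ξ + D (t, ξ)) ∂(surf n) ≤
      (Ioo (-1) (B + 1)).indicator (fun t => 2 * ENNReal.ofReal δ * surf n univ +
        C * ∫⁻ ξ, D (t, ξ) ^ p ∂(surf n)) t := fun t => by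
    by_cases ht : t ∈ Ioo (-1) (B + 1)
    · rw [indicator_of_mem ht, lintegral_add_right _ (by fun_prop)]
      have h1 := hmax (fun η => D (t, η)) (by fun_prop)
      have h2 : ∫⁻ ξ, D (t, ξ) ∂(surf n) ≤ ENNReal.ofReal δ * surf n univ +
          ENNReal.ofReal ((δ : ℝ) ^ (1 - p)) * ∫⁻ ξ, D (t, ξ) ^ p ∂(surf n) := by
        refine (lintegral_mono fun ξ => le_add_rpow_mul hp (show (0 : ℝ) < δ by exact_mod_cast hδ0)
          (D (t, ξ))).trans_eq ?_
        rw [lintegral_add_left (by fun_prop), lintegral_const, lintegral_const_mul _ (by fun_prop)]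
      refine (add_le_add h1 h2).trans_eq ?_
      rw [hC]
      ring
    · rw [indicator_of_notMem ht]
      have : ∀ ξ, D (t, ξ) = 0 := fun ξ => hDout _ ht
      simp [this, poissonMax_zero]
  refine (lintegral_mono hfib).trans ?_
  have hDpm : Measurable fun t => ∫⁻ ξ, D (t, ξ) ^ p ∂(surf n) :=
    Measurable.lintegral_prod_right' (f := fun q : ℝ × USphere n => D q ^ p) (by fun_prop)
  rw [lintegral_indicator measurableSet_Ioo, lintegral_add_left measurable_const,
    lintegral_const, lintegral_const_mul _ hDpm, Measure.restrict_apply_univ, Real.volume_Ioo]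
  have h3 : ∫⁻ t in Ioo (-1) (B + 1), ∫⁻ ξ, D (t, ξ) ^ p ∂(surf n) ≤ N := by
    refine le_trans ?_ hg0'
    rw [hμ', lintegral_prod _ (by fun_prop)]
    exact lintegral_mono fun t => lintegral_mono fun ξ => ENNReal.rpow_le_rpow (hDle _) hp0.le
  calc _ ≤ 2 * ENNReal.ofReal δ * surf n univ * ENNReal.ofReal (B + 1 - -1) + C * N := by gcongr
    _ = δ * a + N * C := by
      rw [ha, show B + 1 - -1 = B + 2 by ring, ENNReal.ofReal_coe_nnreal]
      ring
    _ ≤ e / 2 + e / 2 := add_le_add hδ.le hN.le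
    _ = e := ENNReal.add_halves e

end


/-! ### Almost everywhere convergence of the averages -/

section
variable {n : ℕ}

/-- By Tonelli the total integral is at most the integral of t^(β-1) over (0, B) times the integral
of F: for t ≥ B the shifted support misses positive first coordinates. -/
theorem ae_lintegral_shift_ne_top {Y : Type*} [MeasurableSpace Y] (ν : Measure Y) [SFinite ν]
    {F : ℝ × Y → ℝ≥0∞} (hF : Measurable F) {B : ℝ} (hsupp : ∀ q, q.1 ∉ Ioo 0 B → F q = 0)
    (hfin : ∫⁻ q, F q ∂((volume : Measure ℝ).prod ν) ≠ ∞) {β : ℝ} (hβ : 0 < β) :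
    ∀ᵐ q ∂(((volume : Measure ℝ).restrict (Ioi 0)).prod ν),
      ∫⁻ t in Ioi (0 : ℝ), ENNReal.ofReal (t ^ (β - 1)) * F (q.1 + t, q.2) ≠ ∞ := by
  have hm : Measurable fun z : (ℝ × Y) × ℝ => ENNReal.ofReal (z.2 ^ (β - 1)) *
      F (z.1.1 + z.2, z.1.2) := by fun_prop
  have hint : ∫⁻ t in Ioo 0 B, ENNReal.ofReal (t ^ (β - 1)) ≠ ∞ := by
    rcases le_or_gt B 0 with h | h
    · simp [Ioo_eq_empty_of_le h]
    · have := (intervalIntegral.intervalIntegrable_rpow' (a := 0) (b := B)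
        (show -1 < β - 1 by linarith)).1
      exact ((this.mono_set Ioo_subset_Ioc_self).lintegral_lt_top).ne
  suffices h : ∫⁻ q, (∫⁻ t in Ioi (0 : ℝ), ENNReal.ofReal (t ^ (β - 1)) * F (q.1 + t, q.2))
      ∂(((volume : Measure ℝ).restrict (Ioi 0)).prod ν) ≠ ∞ by
    filter_upwards [ae_lt_top hm.lintegral_prod_right' h] with q hq using hq.ne
  rw [lintegral_lintegral_swap hm.aemeasurable]
  refine ne_top_of_le_ne_top (ENNReal.mul_ne_top hint hfin) ?_
  rw [← lintegral_mul_const _ (by fun_prop), ← lintegral_indicator measurableSet_Ioo,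
    ← lintegral_indicator measurableSet_Ioi]
  refine lintegral_mono fun t => ?_
  by_cases ht0 : t ∈ Ioi (0 : ℝ)
  swap
  · rw [indicator_of_notMem ht0]; exact bot_le
  rw [indicator_of_mem ht0]
  have ht0 : 0 < t := ht0
  rw [lintegral_const_mul _ (by fun_prop)]
  by_cases htB : t < B
  · rw [indicator_of_mem (show t ∈ Ioo 0 B from ⟨ht0, htB⟩)]
    refine mul_le_mul_right ?_ _
    rw [lintegral_prod_symm' _ (by fun_prop), lintegral_prod_symm' _ hF]
    refine lintegral_mono fun y => (setLIntegral_le_lintegral _ _).trans_eq ?_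
    exact lintegral_add_right_eq_self (fun s => F (s, y)) t
  · have h0 : ∫⁻ q : ℝ × Y, F (q.1 + t, q.2) ∂(((volume : Measure ℝ).restrict (Ioi 0)).prod ν) = 0 := by
      rw [lintegral_prod_symm' _ (by fun_prop)]
      refine lintegral_eq_zero_of_ae_eq_zero (Eventually.of_forall fun y => ?_)
      refine setLIntegral_eq_zero measurableSet_Ioi fun s hs => hsupp _ fun h => ?_
      have hs : 0 < s := hs
      exact htB (by linarith [h.2])
    rw [h0, mul_zero]
    exact bot_le

/-- Continuous approximants with summable errors make the series of maximal and pointwise errors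
converge almost everywhere. At such a point both errors tend to 0 along the sequence, and
differentiation turns a small value of the maximal function into small averages on short intervals.
-/
theorem ae_tendsto_avgKernel_of_lintegral (hn : 0 < n) {α : ℝ} (hα : 0 < α) {l : ℕ} (hl : α < l)
    {p : ℝ} (hp : 1 < p) {B : ℝ} {G : ℝ × USphere n → ℂ} (hG : Measurable G)
    (hsupp : ∀ q, q.1 ∉ Ioo 0 B → G q = 0)
    (hfin : ∫⁻ q, ‖G q‖ₑ ^ p ∂((volume : Measure ℝ).prod (surf n)) ≠ ∞) :
    ∀ᵐ q ∂((volume : Measure ℝ).prod (surf n)), 0 < q.1 →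
      Tendsto (fun ε => ∫ y in Ioi (0 : ℝ), (avgKernel α l y : ℂ) *
        cPoisson √(q.1 / (q.1 + ε * y)) (fun η => G (q.1 + ε * y, η)) q.2) (𝓝[>] 0)
        (𝓝 ((kappa α l : ℂ) * G q)) := by
  obtain ⟨e, he, hes⟩ := ENNReal.exists_pos_sum_of_countable one_ne_zero ℕ
  have happ := fun j => exists_continuous_approx hn hp hG hsupp hfin
    (show (0 : ℝ≥0∞) < e j by exact_mod_cast he j)
  choose g hgc hgb hgi using happ
  have hgm := fun j => (hgc j).measurable
  set P : ℕ → ℝ × USphere n → ℝ≥0∞ := fun j q =>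
    poissonMax (fun η => ‖G (q.1, η) - g j (q.1, η)‖ₑ) q.2 with hP
  have hPm : ∀ j, Measurable (P j) := fun j =>
    measurable_poissonMax_prod (F := fun q => ‖G q - g j q‖ₑ) (by fun_prop)
  have hPfin : ∀ j, ∫⁻ q, P j q ∂((volume : Measure ℝ).prod (surf n)) ≠ ∞ := fun j => by
    refine ne_top_of_le_ne_top ENNReal.coe_ne_top ((lintegral_mono fun q => ?_).trans (hgi j))
    exact le_self_add
  have h1 : ∀ᵐ q ∂((volume : Measure ℝ).prod (surf n)),
      Tendsto (fun j => P j q + ‖G q - g j q‖ₑ) atTop (𝓝 0) := by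
    have hs : ∫⁻ q, ∑' j, (P j q + ‖G q - g j q‖ₑ) ∂((volume : Measure ℝ).prod (surf n)) ≠ ∞ := by
      rw [lintegral_tsum fun j => by fun_prop]
      exact ne_top_of_le_ne_top (hes.trans ENNReal.one_lt_top).ne (ENNReal.tsum_le_tsum hgi)
    filter_upwards [ae_lt_top (by fun_prop) hs] with q hq
    exact ENNReal.tendsto_atTop_zero_of_tsum_ne_top hq.ne
  have h2 := ae_all_iff.2 fun j => ae_setLIntegral_Ioc_le (surf n) (hPm j) (hPfin j)
  have h3 : ∀ᵐ q ∂((volume : Measure ℝ).prod (surf n)), ∀ j, ∫⁻ t, P j (t, q.2) < ∞ := by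
    refine ae_all_iff.2 fun j => Measure.quasiMeasurePreserving_snd.ae
      (p := fun ξ => ∫⁻ t, P j (t, ξ) < ∞) (ae_lt_top (hPm j).lintegral_prod_left' ?_)
    rw [← lintegral_prod_symm' _ (hPm j)]
    exact hPfin j
  filter_upwards [h1, h2, h3] with q hq1 hq2 hq3 hq
  refine tendsto_integral_avgKernel_of_approx hn hα hl hG hq fun d hd => ?_
  have hd2 : 0 < d / 2 := ENNReal.half_pos hd.ne'
  obtain ⟨j, hj⟩ := (hq1.eventually (gt_mem_nhds hd2)).exists
  -- The tolerance d/2 compensates the factor 2 in the bound on short intervals.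
  refine ⟨g j, hgc j, hgb j, ?_, ?_, ?_⟩
  · refine ne_top_of_le_ne_top (hq3 j).ne ((setLIntegral_le_lintegral _ _).trans_eq ?_)
    exact lintegral_add_left_eq_self (fun t => P j (t, q.2)) q.1
  · exact (le_add_self.trans hj.le).trans ENNReal.half_le_self
  · obtain ⟨δ, hδ, h⟩ := hq2 j (d / 2) (lt_of_le_of_lt le_self_add hj)
    refine ⟨δ, hδ, fun r hr hrδ => (h r hr hrδ).trans_eq ?_⟩
    rw [ENNReal.mul_div_cancel (by simp) (by simp)]

/-- The almost everywhere statement behind the inversion of the fractional integral. -/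
theorem ae_tendsto_avgKernel (hn : 0 < n) {α : ℝ} (hα : 0 < α) {l : ℕ} (hl : α < l)
    {p : ℝ} (hp : 1 < p) {B : ℝ} {G : ℝ × USphere n → ℂ} (hG : Measurable G)
    (hsupp : ∀ q, q.1 ∉ Ioo 0 B → G q = 0)
    (hfin : ∀ t0 > 0, ∫⁻ q in Ioi t0 ×ˢ univ, ‖G q‖ₑ ^ p
      ∂((volume : Measure ℝ).prod (surf n)) ≠ ∞) :
    ∀ᵐ q ∂(((volume : Measure ℝ).restrict (Ioi 0)).prod (surf n)),
      (∀ β : ℝ, β = α ∨ β = 1 → ∫⁻ t in Ioi (0 : ℝ), ENNReal.ofReal (t ^ (β - 1)) *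
        poissonMax (fun η => ‖G (q.1 + t, η)‖ₑ) q.2 ≠ ∞) ∧
      Tendsto (fun ε => ∫ y in Ioi (0 : ℝ), (avgKernel α l y : ℂ) *
        cPoisson √(q.1 / (q.1 + ε * y)) (fun η => G (q.1 + ε * y, η)) q.2) (𝓝[>] 0)
        (𝓝 ((kappa α l : ℂ) * G q)) := by
  have hp0 : 0 < p := one_pos.trans hp
  set S : ℕ → Set (ℝ × USphere n) := fun k => Ioi (1 / ((k : ℝ) + 1)) ×ˢ univ with hS
  have hSm : ∀ k, MeasurableSet (S k) := fun k => measurableSet_Ioi.prod MeasurableSet.univ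
  -- G is p-integrable only away from t = 0, the South Pole. At a point with coordinate above
  -- 1/(k+1) all integrals involve larger t only, so G can be cut off there.
  set Gk : ℕ → ℝ × USphere n → ℂ := fun k => (S k).indicator G with hGk
  have hGkm : ∀ k, Measurable (Gk k) := fun k => hG.indicator (hSm k)
  have hGks : ∀ k q, q.1 ∉ Ioo 0 B → Gk k q = 0 := fun k q hq => by
    simp [hGk, indicator_apply, hsupp q hq]
  have hGkfin : ∀ k, ∫⁻ q, ‖Gk k q‖ₑ ^ p ∂((volume : Measure ℝ).prod (surf n)) ≠ ∞ := fun k => by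
    have : ∀ q, ‖Gk k q‖ₑ ^ p = (S k).indicator (fun q => ‖G q‖ₑ ^ p) q := fun q => by
      simp only [hGk, indicator_apply]
      split_ifs
      · rfl
      · simp [hp0]
    simp_rw [this]
    rw [lintegral_indicator (hSm k)]
    exact hfin _ (by positivity)
  set F : ℕ → ℝ × USphere n → ℝ≥0∞ := fun k q => poissonMax (fun η => ‖Gk k (q.1, η)‖ₑ) q.2 with hF
  have hFm : ∀ k, Measurable (F k) := fun k =>
    measurable_poissonMax_prod (F := fun q => ‖Gk k q‖ₑ) (by have := hGkm k; fun_prop)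
  have hFs : ∀ k q, q.1 ∉ Ioo 0 B → F k q = 0 := fun k q hq =>
    poissonMax_zero (fun η => by rw [hGks k (q.1, η) hq, enorm_zero]) _
  have hFfin : ∀ k, ∫⁻ q, F k q ∂((volume : Measure ℝ).prod (surf n)) ≠ ∞ := fun k => by
    obtain ⟨C, hC, hmax⟩ := exists_lintegral_poissonMax_le hn hp one_pos
    have hGm := hGkm k
    rw [lintegral_prod _ (by fun_prop)]
    have hle : ∀ t, ∫⁻ ξ, F k (t, ξ) ∂(surf n) ≤ (Ioo 0 B).indicator (fun _ => ENNReal.ofReal 1 *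
        surf n univ) t + C * ∫⁻ ξ, ‖Gk k (t, ξ)‖ₑ ^ p ∂(surf n) := fun t => by
      by_cases ht : t ∈ Ioo 0 B
      · rw [indicator_of_mem ht]
        exact hmax _ (by fun_prop)
      · have : ∀ ξ, F k (t, ξ) = 0 := fun ξ => hFs k _ ht
        simp [this]
    refine ne_top_of_le_ne_top ?_ (lintegral_mono hle)
    rw [lintegral_add_left (measurable_const.indicator measurableSet_Ioo),
      lintegral_indicator measurableSet_Ioo, lintegral_const, lintegral_const_mul' _ _ hC,
      ← lintegral_prod (fun q => ‖Gk k q‖ₑ ^ p) (by fun_prop)]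
    refine ENNReal.add_ne_top.2 ⟨ENNReal.mul_ne_top (ENNReal.mul_ne_top (by simp)
      (measure_ne_top _ _)) (by simp), ENNReal.mul_ne_top hC (hGkfin k)⟩
  have hle : ((volume : Measure ℝ).restrict (Ioi 0)).prod (surf n) ≤
      (volume : Measure ℝ).prod (surf n) := Measure.prod_mono Measure.restrict_le_self le_rfl
  -- The exponent α serves the Riemann–Liouville integral at the point itself; the exponent 1 below
  -- gives the plain integrability used for almost every parallel above it.
  have h1 := ae_all_iff.2 fun k => ae_lintegral_shift_ne_top (surf n) (hFm k) (hFs k) (hFfin k) hα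
  have h2 := ae_all_iff.2 fun k =>
    ae_lintegral_shift_ne_top (surf n) (hFm k) (hFs k) (hFfin k) one_pos
  have h3 := ae_all_iff.2 fun k => ae_mono hle
    (ae_tendsto_avgKernel_of_lintegral hn hα hl hp (hGkm k) (hGks k) (hGkfin k))
  have h0 : ∀ᵐ q ∂(((volume : Measure ℝ).restrict (Ioi 0)).prod (surf n)), 0 < q.1 :=
    Measure.quasiMeasurePreserving_fst.ae (p := fun t : ℝ => 0 < t) (ae_restrict_mem measurableSet_Ioi)
  filter_upwards [h0, h1, h2, h3] with q hq hq1 hq2 hq3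
  obtain ⟨k, hk⟩ := exists_nat_one_div_lt hq
  have hG1 : ∀ t : ℝ, 0 ≤ t → ∀ η, Gk k (q.1 + t, η) = G (q.1 + t, η) := fun t ht η =>
    indicator_of_mem (show (q.1 + t, η) ∈ S k from ⟨by
      change 1 / ((k : ℝ) + 1) < q.1 + t
      linarith, mem_univ _⟩) _
  refine ⟨fun β hβ => ?_, ?_⟩
  · have hβ' : ∫⁻ t in Ioi (0 : ℝ), ENNReal.ofReal (t ^ (β - 1)) * F k (q.1 + t, q.2) ≠ ∞ := by
      rcases hβ with rfl | rfl
      · exact hq1 k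
      · exact hq2 k
    refine ne_top_of_le_ne_top hβ' (setLIntegral_mono' measurableSet_Ioi fun t ht => ?_)
    simp only [hF, hG1 t (le_of_lt ht), le_refl]
  · have h4 := hq3 k hq
    have e0 : Gk k q = G q := by
      have := hG1 0 le_rfl q.2
      simpa only [add_zero] using this
    rw [e0] at h4
    refine h4.congr' ?_
    filter_upwards [self_mem_nhdsWithin] with ε hε
    refine setIntegral_congr_fun measurableSet_Ioi fun y hy => ?_
    simp only [hG1 (ε * y) (mul_pos hε hy).le]

end


section
variable {n : ℕ}

/-! ### The fractional integral in polar coordinates -/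

theorem setLIntegral_Ioi_add (f : ℝ → ℝ≥0∞) (s v : ℝ) :
    ∫⁻ t in Ioi v, f (s + t) = ∫⁻ t in Ioi (s + v), f t := by
  rw [← lintegral_indicator measurableSet_Ioi, ← lintegral_indicator measurableSet_Ioi,
    ← lintegral_add_left_eq_self ((Ioi (s + v)).indicator f) s]
  refine lintegral_congr fun t => ?_
  simp only [indicator_apply, mem_Ioi, add_lt_add_iff_left]

theorem setIntegral_Ioi_add {E : Type*} [NormedAddCommGroup E] [NormedSpace ℝ E] (f : ℝ → E)
    (s v : ℝ) : ∫ t in Ioi v, f (s + t) = ∫ t in Ioi (s + v), f t := by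
  rw [← integral_indicator measurableSet_Ioi, ← integral_indicator measurableSet_Ioi,
    ← integral_add_left_eq_self ((Ioi (s + v)).indicator f) s]
  refine integral_congr_ae (Eventually.of_forall fun t => ?_)
  simp only [indicator_apply, mem_Ioi, add_lt_add_iff_left]

/-- The integrand of the fractional integral in polar coordinates, at the radial parameter `σ`
and with the Poisson radius taken relative to `s`. -/
noncomputable def capIntegrand (α : ℝ) (G : ℝ × USphere n → ℂ) (σ s : ℝ) (ξ : USphere n)
    (q : ℝ × USphere n) : ℂ :=
  (((q.1 - σ) ^ (α - 1) * poissonK √(s / q.1) ξ q.2 : ℝ) : ℂ) * G q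

/-- The fractional integral in polar coordinates, up to elementary factors. -/
noncomputable def capFrac (α : ℝ) (G : ℝ × USphere n → ℂ) (s : ℝ) (ξ : USphere n) : ℂ :=
  ∫ q, capIntegrand α G s s ξ q ∂(((volume : Measure ℝ).restrict (Ioi s)).prod (surf n))

/-- The Poisson integrals over the parallels above a given point. -/
noncomputable def parallelPoisson (G : ℝ × USphere n → ℂ) (s : ℝ) (ξ : USphere n) (t : ℝ) : ℂ :=
  cPoisson √(s / (s + t)) (fun η => G (s + t, η)) ξ

/-- The Poisson integrals of the absolute value over the parallels above a given point. -/
noncomputable def parallelLPoisson (G : ℝ × USphere n → ℂ) (s : ℝ) (ξ : USphere n) (t : ℝ) :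
    ℝ≥0∞ :=
  lPoisson √(s / (s + t)) (fun η => ‖G (s + t, η)‖ₑ) ξ

theorem measurable_parallelPoisson {G : ℝ × USphere n → ℂ} (hG : Measurable G) (s : ℝ)
    (ξ : USphere n) : Measurable (parallelPoisson G s ξ) :=
  (stronglyMeasurable_cPoisson hG (by fun_prop) (by fun_prop) measurable_const).measurable

theorem measurable_parallelLPoisson {G : ℝ × USphere n → ℂ} (hG : Measurable G) (s : ℝ)
    (ξ : USphere n) : Measurable (parallelLPoisson G s ξ) :=
  Measurable.lintegral_prod_right' (f := fun p : ℝ × USphere n =>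
    ENNReal.ofReal (poissonK √(s / (s + p.1)) ξ p.2) * ‖G (s + p.1, p.2)‖ₑ) (by fun_prop)

theorem enorm_parallelPoisson_le (hn : 0 < n) (G : ℝ × USphere n → ℂ) {s : ℝ} (hs : 0 < s)
    (ξ : USphere n) {t : ℝ} (ht : 0 < t) :
    ‖parallelPoisson G s ξ t‖ₑ ≤ parallelLPoisson G s ξ t := by
  obtain ⟨h0, h1⟩ := sqrt_div_mem hs ht
  exact enorm_cPoisson_le hn h0 h1 _ ξ

theorem measurable_capIntegrand (α : ℝ) {G : ℝ × USphere n → ℂ} (hG : Measurable G) (σ s : ℝ)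
    (ξ : USphere n) : Measurable (capIntegrand α G σ s ξ) := by
  unfold capIntegrand
  fun_prop

theorem sqrt_div_mem' {s t : ℝ} (hs : 0 < s) (ht : s < t) : 0 ≤ √(s / t) ∧ √(s / t) < 1 := by
  have := sqrt_div_mem hs (sub_pos.2 ht)
  rwa [add_sub_cancel] at this

theorem enorm_capIntegrand (hn : 0 < n) (α : ℝ) (G : ℝ × USphere n → ℂ) {σ s : ℝ} (hs : 0 < s)
    (hσ : s ≤ σ) (ξ : USphere n) {q : ℝ × USphere n} (hq : σ < q.1) :
    ‖capIntegrand α G σ s ξ q‖ₑ = ENNReal.ofReal ((q.1 - σ) ^ (α - 1)) *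
      (ENNReal.ofReal (poissonK √(s / q.1) ξ q.2) * ‖G q‖ₑ) := by
  obtain ⟨h0, h1⟩ := sqrt_div_mem' hs (hσ.trans_lt hq)
  have h2 := poissonK_nonneg hn h0 h1 ξ q.2
  have h3 : 0 ≤ (q.1 - σ) ^ (α - 1) := Real.rpow_nonneg (sub_pos.2 hq).le _
  rw [capIntegrand, enorm_mul, ← ofReal_norm, Complex.norm_real,
    Real.norm_of_nonneg (mul_nonneg h3 h2), ENNReal.ofReal_mul h3, mul_assoc]

theorem ae_lt_fst (σ : ℝ) : ∀ᵐ q ∂(((volume : Measure ℝ).restrict (Ioi σ)).prod (surf n)), σ < q.1 :=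
  Measure.quasiMeasurePreserving_fst.ae (p := fun t : ℝ => σ < t) (ae_restrict_mem measurableSet_Ioi)

theorem integrable_capIntegrand (hn : 0 < n) (α : ℝ) {G : ℝ × USphere n → ℂ} (hG : Measurable G)
    {s v : ℝ} (hs : 0 < s) (hv : 0 ≤ v) (ξ : USphere n)
    (hfin : ∫⁻ t in Ioi v, ENNReal.ofReal ((t - v) ^ (α - 1)) * parallelLPoisson G s ξ t ≠ ∞) :
    Integrable (capIntegrand α G (s + v) s ξ)
      (((volume : Measure ℝ).restrict (Ioi (s + v))).prod (surf n)) := by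
  have hm := measurable_capIntegrand α hG (s + v) s ξ
  refine ⟨hm.aestronglyMeasurable, ?_⟩
  rw [hasFiniteIntegral_iff_enorm, lintegral_prod _ (by fun_prop)]
  refine lt_of_eq_of_lt ?_ (lt_top_iff_ne_top.2 hfin)
  rw [← setLIntegral_Ioi_add]
  refine setLIntegral_congr_fun measurableSet_Ioi fun t ht => ?_
  have ht : v < t := ht
  have e : ∀ η, ‖capIntegrand α G (s + v) s ξ (s + t, η)‖ₑ =
      ENNReal.ofReal ((t - v) ^ (α - 1)) * (ENNReal.ofReal (poissonK √(s / (s + t)) ξ η) *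
        ‖G (s + t, η)‖ₑ) := fun η => by
    rw [enorm_capIntegrand hn α G hs (by linarith) ξ (by simpa using ht), add_sub_add_left_eq_sub]
  simp only [e]
  rw [lintegral_const_mul _ (by fun_prop)]
  rfl

theorem integral_capIntegrand (hn : 0 < n) {α : ℝ} (hα : 0 < α) {G : ℝ × USphere n → ℂ}
    (hG : Measurable G) {s v : ℝ} (hs : 0 < s) (hv : 0 ≤ v) (ξ : USphere n)
    (hfin : ∫⁻ t in Ioi v, ENNReal.ofReal ((t - v) ^ (α - 1)) * parallelLPoisson G s ξ t ≠ ∞) :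
    ∫ q, capIntegrand α G (s + v) s ξ q
      ∂(((volume : Measure ℝ).restrict (Ioi (s + v))).prod (surf n)) =
      Real.Gamma α * rlInt α (parallelPoisson G s ξ) v := by
  have hΓ := Real.Gamma_pos_of_pos hα
  rw [integral_prod _ (integrable_capIntegrand hn α hG hs hv ξ hfin), ← setIntegral_Ioi_add, rlInt,
    ← mul_assoc, ← Complex.ofReal_mul, mul_inv_cancel₀ hΓ.ne', Complex.ofReal_one, one_mul]
  refine setIntegral_congr_fun measurableSet_Ioi fun t ht => ?_
  simp only [capIntegrand, parallelPoisson, cPoisson, add_sub_add_left_eq_sub]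
  rw [← integral_const_mul]
  refine integral_congr_ae (Eventually.of_forall fun η => ?_)
  push_cast
  ring

theorem sqrt_div_mul_sqrt_div {s σ t : ℝ} (hs : 0 < s) (hσ : 0 < σ) :
    √(s / σ) * √(σ / t) = √(s / t) := by
  rw [← Real.sqrt_mul (by positivity)]
  congr 1
  field_simp

/-- By Tonelli and the semigroup law, integrating absolute values over the intermediate parallel
gives the same kernel as going directly from s to t. -/
theorem integrable_poissonK_mul_capIntegrand (hn : 0 < n) (α : ℝ) {G : ℝ × USphere n → ℂ}
    (hG : Measurable G) {s v : ℝ} (hs : 0 < s) (hv : 0 < v) (ξ : USphere n)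
    (hfin : ∫⁻ t in Ioi v, ENNReal.ofReal ((t - v) ^ (α - 1)) * parallelLPoisson G s ξ t ≠ ∞) :
    Integrable (fun z : USphere n × (ℝ × USphere n) => (poissonK √(s / (s + v)) ξ z.1 : ℂ) *
      capIntegrand α G (s + v) (s + v) z.1 z.2)
      ((surf n).prod (((volume : Measure ℝ).restrict (Ioi (s + v))).prod (surf n))) := by
  have hσ : 0 < s + v := by positivity
  obtain ⟨h0, h1⟩ := sqrt_div_mem hs hv
  have hm : Measurable (fun z : USphere n × (ℝ × USphere n) =>
      (poissonK √(s / (s + v)) ξ z.1 : ℂ) * capIntegrand α G (s + v) (s + v) z.1 z.2) := by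
    unfold capIntegrand
    fun_prop
  refine ⟨hm.aestronglyMeasurable, ?_⟩
  rw [hasFiniteIntegral_iff_enorm, lintegral_prod_symm' _ (by fun_prop)]
  have hi := (integrable_capIntegrand hn α hG hs hv.le ξ hfin).2
  rw [hasFiniteIntegral_iff_enorm] at hi
  refine lt_of_eq_of_lt (lintegral_congr_ae ?_) hi
  filter_upwards [ae_lt_fst (s + v)] with q hq
  obtain ⟨k0, k1⟩ := sqrt_div_mem' hσ hq
  rw [enorm_capIntegrand hn α G hs (by linarith) ξ hq,
    ← sqrt_div_mul_sqrt_div (t := q.1) hs hσ, ← lintegral_poissonK_mul_poissonK hn h0 h1 k0 k1,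
    ← lintegral_mul_const _ (by fun_prop), ← lintegral_const_mul _ (by fun_prop)]
  refine lintegral_congr fun ζ => ?_
  rw [enorm_mul, enorm_capIntegrand hn α G hσ le_rfl ζ hq, ← ofReal_norm, Complex.norm_real,
    Real.norm_of_nonneg (poissonK_nonneg hn h0 h1 ξ ζ)]
  ring

theorem integrable_poissonK_mul_capFrac (hn : 0 < n) (α : ℝ) {G : ℝ × USphere n → ℂ}
    (hG : Measurable G) {s v : ℝ} (hs : 0 < s) (hv : 0 < v) (ξ : USphere n)
    (hfin : ∫⁻ t in Ioi v, ENNReal.ofReal ((t - v) ^ (α - 1)) * parallelLPoisson G s ξ t ≠ ∞) :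
    Integrable (fun ζ => (poissonK √(s / (s + v)) ξ ζ : ℂ) * capFrac α G (s + v) ζ) (surf n) := by
  refine (integrable_poissonK_mul_capIntegrand hn α hG hs hv ξ hfin).integral_prod_left.congr
    (Eventually.of_forall fun ζ => ?_)
  simp only [capFrac]
  rw [integral_const_mul]

/-- The Poisson integral of the fractional integral over a parallel is a one-dimensional
fractional integral. -/
theorem cPoisson_capFrac (hn : 0 < n) {α : ℝ} (hα : 0 < α) {G : ℝ × USphere n → ℂ}
    (hG : Measurable G) {s v : ℝ} (hs : 0 < s) (hv : 0 < v) (ξ : USphere n)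
    (hfin : ∫⁻ t in Ioi v, ENNReal.ofReal ((t - v) ^ (α - 1)) * parallelLPoisson G s ξ t ≠ ∞) :
    cPoisson √(s / (s + v)) (capFrac α G (s + v)) ξ =
      Real.Gamma α * rlInt α (parallelPoisson G s ξ) v := by
  have hσ : 0 < s + v := by positivity
  obtain ⟨h0, h1⟩ := sqrt_div_mem hs hv
  have hsw := integral_integral_swap
    (f := fun ζ q => (poissonK √(s / (s + v)) ξ ζ : ℂ) * capIntegrand α G (s + v) (s + v) ζ q)
    (integrable_poissonK_mul_capIntegrand hn α hG hs hv ξ hfin)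
  rw [← integral_capIntegrand hn hα hG hs hv.le ξ hfin]
  have e1 : cPoisson √(s / (s + v)) (capFrac α G (s + v)) ξ =
      ∫ ζ, (∫ q, (poissonK √(s / (s + v)) ξ ζ : ℂ) * capIntegrand α G (s + v) (s + v) ζ q
        ∂(((volume : Measure ℝ).restrict (Ioi (s + v))).prod (surf n))) ∂(surf n) := by
    simp only [cPoisson, capFrac, integral_const_mul]
  rw [e1, hsw]
  refine integral_congr_ae ?_
  filter_upwards [ae_lt_fst (s + v)] with q hq
  obtain ⟨k0, k1⟩ := sqrt_div_mem' hσ hq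
  -- Radii multiply: √(s/σ) √(σ/t) = √(s/t) with σ = s + v, so the intermediate parallel drops out
  -- of the Poisson kernel.
  rw [capIntegrand, ← sqrt_div_mul_sqrt_div (t := q.1) hs hσ, ← integral_poissonK_mul_poissonK hn h0 h1 k0 k1]
  have e2 : ∀ ζ, (poissonK √(s / (s + v)) ξ ζ : ℂ) * capIntegrand α G (s + v) (s + v) ζ q =
      (((poissonK √(s / (s + v)) ξ ζ * poissonK √((s + v) / q.1) ζ q.2 : ℝ)) : ℂ) *
        ((((q.1 - (s + v)) ^ (α - 1) : ℝ) : ℂ) * G q) := fun ζ => by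
    rw [capIntegrand]
    push_cast
    ring
  simp_rw [e2]
  rw [integral_mul_const, integral_complex_ofReal]
  push_cast
  ring

/-- The local integrability that makes all the fractional integrals converge. -/
theorem ae_lintegral_sub_rpow_ne_top {α : ℝ} (hα : 0 < α) {H : ℝ → ℝ≥0∞} (hH : Measurable H) {B : ℝ}
    (hsupp : ∀ t, B ≤ t → H t = 0) (hfin : ∫⁻ t in Ioi (0 : ℝ), H t ≠ ∞) :
    ∀ᵐ v ∂((volume : Measure ℝ).restrict (Ioi 0)),
      ∫⁻ t in Ioi v, ENNReal.ofReal ((t - v) ^ (α - 1)) * H t ≠ ∞ := by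
  -- A one-point second factor reduces the claim to the shift lemma on a product.
  set F : ℝ × Unit → ℝ≥0∞ := fun q => (Ioi (0 : ℝ)).indicator H q.1 with hF
  have hFm : Measurable F := (hH.indicator measurableSet_Ioi).comp measurable_fst
  have h := ae_lintegral_shift_ne_top (Measure.dirac ()) hFm (B := B) (fun q hq => by
    by_cases h : q.1 ∈ Ioi 0
    · have : B ≤ q.1 := by
        by_contra! hc
        exact hq ⟨h, hc⟩
      simp [hF, indicator_of_mem h, hsupp _ this]
    · exact indicator_of_notMem h _) (by
    rw [Measure.prod_dirac, lintegral_map hFm (by fun_prop)]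
    simpa [hF, lintegral_indicator measurableSet_Ioi] using hfin) hα
  rw [Measure.prod_dirac] at h
  filter_upwards [ae_of_ae_map (by fun_prop) h, ae_restrict_mem measurableSet_Ioi] with v hv hv0
  have hv0 : 0 < v := hv0
  have e := setLIntegral_Ioi_add (fun t => ENNReal.ofReal ((t - v) ^ (α - 1)) * H t) v 0
  rw [add_zero] at e
  rw [← e]
  refine ne_top_of_le_ne_top hv (setLIntegral_mono' measurableSet_Ioi fun t ht => ?_)
  have ht : 0 < t := ht
  simp only [hF, add_sub_cancel_left]
  rw [indicator_of_mem (show v + t ∈ Ioi 0 from add_pos hv0 ht)]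

end


/-! ### Transfer between the cap and the coordinates -/

section
variable {n : ℕ}

theorem measurable_lastCoord : Measurable (lastCoord (n := n)) := by
  unfold lastCoord
  fun_prop

theorem measurableSet_segS (a b : ℝ) : MeasurableSet (segS n a b) :=
  (measurableSet_lt measurable_const measurable_lastCoord).inter
    (measurableSet_lt measurable_lastCoord measurable_const)

theorem extendZero_val {a b : ℝ} (f : segS n a b → ℂ) (x : segS n a b) :
    extendZero f x.1 = f x := by
  simp [extendZero]

theorem extendZero_of_notMem {a b : ℝ} (f : segS n a b → ℂ) {x : USphere (n + 1)}
    (hx : x ∉ segS n a b) : extendZero f x = 0 := by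
  simp [extendZero, hx]

theorem lastCoord_capChart_lt_iff {s t : ℝ} (hs : 0 < s) (ht : 0 < t) (ξ η : USphere n) :
    lastCoord (capChart s ξ) < lastCoord (capChart t η) ↔ s < t := by
  rw [lastCoord_capChart hs.le, lastCoord_capChart ht.le,
    div_lt_div_iff₀ (by positivity) (by positivity)]
  constructor <;> intro h <;> nlinarith

/-- The integrand of the fractional integral, extended by zero to the whole sphere. -/
noncomputable def sphereIntegrand (α : ℝ) (f : USphere (n + 1) → ℂ) (x y : USphere (n + 1)) : ℂ :=
  {y | lastCoord x < lastCoord y}.indicator (fun y : USphere (n + 1) =>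
    (((lastCoord y - lastCoord x) ^ α /
      ‖(x : EuclideanSpace ℝ (Fin (n + 1))) - y‖ ^ n : ℝ) : ℂ) * f y) y

theorem measurable_sphereIntegrand (α : ℝ) {f : USphere (n + 1) → ℂ} (hf : Measurable f)
    (x : USphere (n + 1)) : Measurable (sphereIntegrand α f x) := by
  have := measurable_lastCoord (n := n)
  refine Measurable.indicator (Measurable.mul ?_ hf) (measurableSet_lt measurable_const this)
  fun_prop

theorem indicator_above_rightIntegrand {a b : ℝ} (α : ℝ) (φ : segS n a b → ℂ) (x : segS n a b) :
    (above x).indicator (rightIntegrand α φ x) = fun y => sphereIntegrand α (extendZero φ) x.1 y.1 := by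
  funext y
  simp only [sphereIntegrand, indicator_apply, above, mem_ofPred_eq, rightIntegrand, extendZero_val]

theorem measurableSet_above {a b : ℝ} (x : segS n a b) : MeasurableSet (above x) :=
  measurableSet_lt measurable_const (measurable_lastCoord.comp measurable_subtype_coe)

theorem sphereIntegrand_of_notMem {a b : ℝ} (α : ℝ) (φ : segS n a b → ℂ) (x y : USphere (n + 1))
    (hy : y ∉ segS n a b) : sphereIntegrand α (extendZero φ) x y = 0 := by
  simp [sphereIntegrand, indicator_apply, extendZero_of_notMem φ hy]

theorem segMeasure_map (a b : ℝ) :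
    (segMeasure n a b).map Subtype.val = (surf (n + 1)).restrict (segS n a b) := by
  rw [segMeasure, (MeasurableEmbedding.subtype_coe (measurableSet_segS a b)).map_comap,
    Subtype.range_coe]

theorem integral_rightIntegrand {a b : ℝ} (α : ℝ) (φ : segS n a b → ℂ) (x : segS n a b) :
    ∫ y in above x, rightIntegrand α φ x y ∂(segMeasure n a b) =
      ∫ y, sphereIntegrand α (extendZero φ) x.1 y ∂(surf (n + 1)) := by
  rw [← integral_indicator (measurableSet_above x), indicator_above_rightIntegrand, segMeasure,
    integral_subtype_comap (measurableSet_segS a b)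
      (fun y => sphereIntegrand α (extendZero φ) x.1 y)]
  exact setIntegral_eq_integral_of_forall_compl_eq_zero fun y hy =>
    sphereIntegrand_of_notMem α φ x.1 y hy

theorem integrableOn_rightIntegrand_iff {a b : ℝ} (α : ℝ) (φ : segS n a b → ℂ) (x : segS n a b) :
    IntegrableOn (rightIntegrand α φ x) (above x) (segMeasure n a b) ↔
      Integrable (sphereIntegrand α (extendZero φ) x.1) (surf (n + 1)) := by
  rw [← integrable_indicator_iff (measurableSet_above x), indicator_above_rightIntegrand]
  have he := MeasurableEmbedding.subtype_coe (measurableSet_segS (n := n) a b)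
  have h := he.integrable_map_iff (μ := segMeasure n a b)
    (g := sphereIntegrand α (extendZero φ) x.1)
  rw [segMeasure_map] at h
  rw [show (fun y : segS n a b => sphereIntegrand α (extendZero φ) x.1 y.1) =
    sphereIntegrand α (extendZero φ) x.1 ∘ Subtype.val from rfl, ← h]
  exact integrableOn_iff_integrable_of_support_subset fun y hy => by
    by_contra hc
    exact hy (sphereIntegrand_of_notMem α φ x.1 y hc)

/-- The function on the coordinate space that corresponds to the function `f` on the sphere. -/
noncomputable def capPull (α b : ℝ) (f : USphere (n + 1) → ℂ) (q : ℝ × USphere n) : ℂ :=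
  (Ioo (0 : ℝ) ((1 + b) / (1 - b)) ×ˢ (univ : Set (USphere n))).indicator (fun q =>
    (((1 + q.1) ^ (-(α + (n : ℝ) / 2)) : ℝ) : ℂ) * f (capChart q.1 q.2)) q

theorem measurable_capPull (α b : ℝ) {f : USphere (n + 1) → ℂ} (hf : Measurable f) :
    Measurable (capPull α b f) := by
  refine Measurable.indicator ?_ (measurableSet_Ioo.prod MeasurableSet.univ)
  fun_prop

theorem capPull_of_notMem (α b : ℝ) (f : USphere (n + 1) → ℂ) (q : ℝ × USphere n)
    (hq : q.1 ∉ Ioo (0 : ℝ) ((1 + b) / (1 - b))) : capPull α b f q = 0 :=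
  indicator_of_notMem (fun h => hq h.1) _

theorem capPull_eq (α : ℝ) {b : ℝ} (hb : b < 1) {f : USphere (n + 1) → ℂ}
    (hf : ∀ x, x ∉ segS n (-1) b → f x = 0) {q : ℝ × USphere n} (hq : 0 < q.1) :
    capPull α b f q = (((1 + q.1) ^ (-(α + (n : ℝ) / 2)) : ℝ) : ℂ) * f (capChart q.1 q.2) := by
  by_cases h : q.1 < (1 + b) / (1 - b)
  · exact indicator_of_mem (show q ∈ Ioo (0 : ℝ) ((1 + b) / (1 - b)) ×ˢ univ from
      ⟨⟨hq, h⟩, mem_univ _⟩) _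
  · rw [capPull_of_notMem α b f q fun h' => h h'.2,
      hf _ fun h' => h ((capChart_mem_segS_iff hb hq q.2).1 h'), mul_zero]

theorem capWeight_smul_sphereIntegrand (hn : 0 < n) (α : ℝ) {b : ℝ} (hb : b < 1)
    {f : USphere (n + 1) → ℂ} (hf : ∀ x, x ∉ segS n (-1) b → f x = 0) {s : ℝ} (hs : 0 < s)
    (ξ : USphere n) {q : ℝ × USphere n} (hq : 0 < q.1) :
    (ENNReal.ofReal (capWeight n q.1)).toReal • sphereIntegrand α f (capChart s ξ) (capChart q.1 q.2) =
      (Ioi s ×ˢ (univ : Set (USphere n))).indicator (fun q =>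
        ((area n * 2 ^ (α - 1) * (1 + s) ^ ((n : ℝ) / 2 - α) : ℝ) : ℂ) *
          capIntegrand α (capPull α b f) s s ξ q) q := by
  rw [ENNReal.toReal_ofReal (capWeight_pos hq).le]
  by_cases h : s < q.1
  · rw [indicator_of_mem (show q ∈ Ioi s ×ˢ univ from ⟨h, mem_univ _⟩), sphereIntegrand,
      indicator_of_mem (show capChart q.1 q.2 ∈ {y | lastCoord (capChart s ξ) < lastCoord y} from
        (lastCoord_capChart_lt_iff hs hq ξ q.2).2 h), capIntegrand, capPull_eq α hb hf hq,
      Complex.real_smul, ← mul_assoc, ← Complex.ofReal_mul, mul_comm (capWeight n q.1),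
      kernel_mul_capWeight hn hs h]
    push_cast
    ring
  · rw [indicator_of_notMem fun h' => h h'.1, sphereIntegrand,
      indicator_of_notMem (s := {y | lastCoord (capChart s ξ) < lastCoord y})
        (fun h' => h ((lastCoord_capChart_lt_iff hs hq ξ q.2).1 h')), smul_zero]

theorem restrict_prod_Ioi {s : ℝ} (hs : 0 < s) :
    (((volume : Measure ℝ).restrict (Ioi 0)).prod (surf n)).restrict (Ioi s ×ˢ univ) =
      ((volume : Measure ℝ).restrict (Ioi s)).prod (surf n) := by
  rw [← Measure.prod_restrict, Measure.restrict_univ, Measure.restrict_restrict measurableSet_Ioi,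
    inter_eq_left.2 (Ioi_subset_Ioi hs.le)]

theorem ae_capWeight_smul (hn : 0 < n) (α : ℝ) {b : ℝ} (hb : b < 1)
    {f : USphere (n + 1) → ℂ} (hf : ∀ x, x ∉ segS n (-1) b → f x = 0) {s : ℝ} (hs : 0 < s)
    (ξ : USphere n) :
    (fun q : ℝ × USphere n => (ENNReal.ofReal (capWeight n q.1)).toReal •
      sphereIntegrand α f (capChart s ξ) (capChart q.1 q.2))
      =ᵐ[((volume : Measure ℝ).restrict (Ioi 0)).prod (surf n)]
      (Ioi s ×ˢ (univ : Set (USphere n))).indicator (fun q =>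
        ((area n * 2 ^ (α - 1) * (1 + s) ^ ((n : ℝ) / 2 - α) : ℝ) : ℂ) *
          capIntegrand α (capPull α b f) s s ξ q) := by
  filter_upwards [ae_lt_fst (n := n) 0] with q hq
  exact capWeight_smul_sphereIntegrand hn α hb hf hs ξ hq

theorem integral_sphereIntegrand (hn : 0 < n) (α : ℝ) {b : ℝ} (hb : b < 1)
    {f : USphere (n + 1) → ℂ} (hfm : Measurable f) (hf : ∀ x, x ∉ segS n (-1) b → f x = 0) {s : ℝ}
    (hs : 0 < s) (ξ : USphere n) :
    ∫ y, sphereIntegrand α f (capChart s ξ) y ∂(surf (n + 1)) =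
      ((area n * 2 ^ (α - 1) * (1 + s) ^ ((n : ℝ) / 2 - α) : ℝ) : ℂ) *
        capFrac α (capPull α b f) s ξ := by
  have hm := measurable_sphereIntegrand α hfm (capChart s ξ)
  rw [← (measurePreserving_capChart hn).map_eq, integral_map (by fun_prop) hm.aestronglyMeasurable,
    capMeasure, integral_withDensity_eq_integral_toReal_smul (by fun_prop)
    (Eventually.of_forall fun q => ENNReal.ofReal_lt_top),
    integral_congr_ae (ae_capWeight_smul hn α hb hf hs ξ),
    integral_indicator (measurableSet_Ioi.prod MeasurableSet.univ), restrict_prod_Ioi hs,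
    integral_const_mul, capFrac]

theorem integrable_sphereIntegrand (hn : 0 < n) (α : ℝ) {b : ℝ} (hb : b < 1)
    {f : USphere (n + 1) → ℂ} (hfm : Measurable f) (hf : ∀ x, x ∉ segS n (-1) b → f x = 0) {s : ℝ}
    (hs : 0 < s) (ξ : USphere n)
    (hi : Integrable (capIntegrand α (capPull α b f) s s ξ)
      (((volume : Measure ℝ).restrict (Ioi s)).prod (surf n))) :
    Integrable (sphereIntegrand α f (capChart s ξ)) (surf (n + 1)) := by
  have hm := measurable_sphereIntegrand α hfm (capChart s ξ)
  rw [← (measurePreserving_capChart hn).integrable_comp hm.aestronglyMeasurable, capMeasure,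
    integrable_withDensity_iff_integrable_smul' (by fun_prop)
    (Eventually.of_forall fun q => ENNReal.ofReal_lt_top)]
  refine Integrable.congr ?_ (ae_capWeight_smul hn α hb hf hs ξ).symm
  rw [integrable_indicator_iff (measurableSet_Ioi.prod MeasurableSet.univ), IntegrableOn,
    restrict_prod_Ioi hs]
  exact hi.const_mul _

theorem sphereIntegrand_congr_ae (α : ℝ) {f g : USphere (n + 1) → ℂ} (h : f =ᵐ[surf (n + 1)] g)
    (x : USphere (n + 1)) : sphereIntegrand α f x =ᵐ[surf (n + 1)] sphereIntegrand α g x := by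
  filter_upwards [h] with y hy
  simp only [sphereIntegrand, indicator_apply, hy]

/-- The fractional integral in polar coordinates. -/
theorem extendZero_fracRight_capChart (hn : 0 < n) {α : ℝ} (hα : 0 < α) {b : ℝ} (hb : b < 1)
    {φ : segS n (-1) b → ℂ} {f : USphere (n + 1) → ℂ} (hfm : Measurable f)
    (hf : ∀ x, x ∉ segS n (-1) b → f x = 0) (hφ : extendZero φ =ᵐ[surf (n + 1)] f) {s : ℝ}
    (hs : 0 < s) (ξ : USphere n) :
    extendZero (fracRight α φ) (capChart s ξ) =
      ((2 ^ α / Real.Gamma α * (1 + s) ^ ((n : ℝ) / 2 - α) : ℝ) : ℂ) *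
        capFrac α (capPull α b f) s ξ := by
  have hA := area_pos hn
  have hΓ := Real.Gamma_pos_of_pos hα
  by_cases hx : capChart s ξ ∈ segS n (-1) b
  · have e := extendZero_val (fracRight α φ) ⟨_, hx⟩
    simp only at e
    rw [e, fracRight, integral_rightIntegrand,
      integral_congr_ae (sphereIntegrand_congr_ae α hφ _),
      integral_sphereIntegrand hn α hb hfm hf hs ξ, ← mul_assoc, ← Complex.ofReal_mul]
    congr 2
    -- The normalization 2/(Γ(α) σ_(n-1)) times σ_(n-1) 2^(α-1) is 2^α/Γ(α).
    rw [Real.rpow_sub two_pos, Real.rpow_one]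
    field_simp
  -- Above the cap the integral runs over t > s ≥ (1+b)/(1-b), where `capPull` vanishes, so the
  -- formula also covers the extension by zero.
  · rw [extendZero_of_notMem _ hx, capFrac, eq_comm]
    refine mul_eq_zero_of_right _ (integral_eq_zero_of_ae ?_)
    filter_upwards [ae_lt_fst (n := n) s] with q hq
    have h1 := not_lt.1 fun h => hx ((capChart_mem_segS_iff hb hs ξ).2 h)
    simp only [capIntegrand, Pi.zero_apply]
    rw [capPull_of_notMem α b f q fun h => (h1.trans_lt hq).not_gt h.2, mul_zero]

end


/-! ### `aMinus` as a one-dimensional fractional integral -/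

section
variable {n : ℕ}

theorem poissonIntegrand_eq (hn : 0 < n) (ψ : USphere n → ℂ) (ξ : USphere n) {r : ℝ} (h0 : 0 ≤ r)
    (η : USphere n) : poissonIntegrand ψ (ξ : EuclideanSpace ℝ (Fin n)) r η =
      (area n : ℂ) * ((poissonK r ξ η : ℂ) * ψ η) := by
  have hA := (area_pos hn).ne'
  rw [poissonIntegrand, ← mul_assoc, ← Complex.ofReal_mul, poissonK, pKer, norm_smul_sphere h0,
    mul_div_cancel₀ _ hA]

theorem poisson_eq (hn : 0 < n) (ψ : USphere n → ℂ) (ξ : USphere n) {r : ℝ} (h0 : 0 ≤ r) :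
    poisson ψ (ξ : EuclideanSpace ℝ (Fin n)) r = cPoisson r ψ ξ := by
  have hA : (area n : ℂ) ≠ 0 := by exact_mod_cast (area_pos hn).ne'
  simp only [poisson, poissonIntegrand_eq hn ψ ξ h0, integral_const_mul, cPoisson]
  push_cast
  field_simp

theorem poissonRadius_capChart {s v : ℝ} (hs : 0 < s) (hv : 0 < v) (ξ : USphere n) :
    poissonRadius (capChart s ξ) (-v) = √(s / (s + v)) := by
  rw [poissonRadius, tanSq_capChart hs.le, Real.rpow_neg, ← Real.sqrt_eq_rpow, ← Real.sqrt_inv]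
  · have : 1 - -v / s = (s + v) / s := by
      field_simp
      ring
    rw [this, inv_div]
  · rw [neg_div, sub_neg_eq_add]; positivity

theorem onParallel_capChart (F : USphere (n + 1) → ℂ) {s : ℝ} (hs : 0 < s) (v : ℝ) (ξ : USphere n) :
    onParallel F (capChart s ξ) (-v) = fun ζ => F (capChart (s + v) ζ) := by
  funext ζ
  rw [onParallel, tanSq_capChart hs.le, sub_neg_eq_add, capChart]

theorem cPoisson_const_mul (r : ℝ) (c : ℂ) (f : USphere n → ℂ) (ξ : USphere n) :
    cPoisson r (fun η => c * f η) ξ = c * cPoisson r f ξ := by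
  simp only [cPoisson]
  rw [← integral_const_mul]
  exact integral_congr_ae (Eventually.of_forall fun η => by ring)

/-- The prefactor of `aMinus` on the parallel σ = s + v is the inverse of the power of 1 + σ in the
fractional integral, and Γ(α) cancels. For v > 0 the Poisson integral is resolved by the semigroup
law; for v = 0 the fractional integral already has this form. -/
theorem aMinus_capChart (hn : 0 < n) {α : ℝ} (hα : 0 < α) {G : ℝ × USphere n → ℂ}
    (hG : Measurable G) {F : USphere (n + 1) → ℂ} (hF : ∀ s > 0, ∀ ξ, F (capChart s ξ) =
      ((2 ^ α / Real.Gamma α * (1 + s) ^ ((n : ℝ) / 2 - α) : ℝ) : ℂ) * capFrac α G s ξ)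
    {s v : ℝ} (hs : 0 < s) (hv : 0 ≤ v) (ξ : USphere n)
    (hfin : ∫⁻ t in Ioi v, ENNReal.ofReal ((t - v) ^ (α - 1)) * parallelLPoisson G s ξ t ≠ ∞) :
    aMinus α F (capChart s ξ) (-v) = ((2 ^ α : ℝ) : ℂ) * rlInt α (parallelPoisson G s ξ) v := by
  have hΓ := (Real.Gamma_pos_of_pos hα).ne'
  have hc : ∀ σ : ℝ, 0 < σ → (1 + σ) ^ (α - (n : ℝ) / 2) *
      (2 ^ α / Real.Gamma α * (1 + σ) ^ ((n : ℝ) / 2 - α)) * Real.Gamma α = 2 ^ α := fun σ hσ => by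
    have : (1 + σ) ^ (α - (n : ℝ) / 2) * (1 + σ) ^ ((n : ℝ) / 2 - α) = 1 := by
      rw [← Real.rpow_add (by positivity)]; simp
    rw [mul_left_comm, this]
    field_simp
  rcases hv.eq_or_lt with rfl | hv
  · have h := integral_capIntegrand hn hα hG hs le_rfl ξ hfin
    rw [add_zero] at h
    rw [aMinus, if_neg (by simp), tanSq_capChart hs.le, hF s hs, capFrac, h, ← mul_assoc, ← mul_assoc,
      ← Complex.ofReal_mul, ← Complex.ofReal_mul, hc s hs]
  · have hσ : 0 < s + v := by positivity
    rw [aMinus, if_pos (by simpa using hv), poissonRadius_capChart hs hv, onParallel_capChart F hs,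
      direction_capChart hs, poisson_eq hn _ _ (Real.sqrt_nonneg _), tanSq_capChart hs.le]
    simp only [hF _ hσ]
    rw [cPoisson_const_mul, cPoisson_capFrac hn hα hG hs hv ξ hfin, sub_neg_eq_add, add_assoc,
      ← mul_assoc, ← mul_assoc, ← Complex.ofReal_mul, ← Complex.ofReal_mul, hc _ hσ]

theorem integrable_poissonIntegrand_capChart (hn : 0 < n) {α : ℝ} {G : ℝ × USphere n → ℂ}
    (hG : Measurable G) {F : USphere (n + 1) → ℂ} (hF : ∀ s > 0, ∀ ξ, F (capChart s ξ) =
      ((2 ^ α / Real.Gamma α * (1 + s) ^ ((n : ℝ) / 2 - α) : ℝ) : ℂ) * capFrac α G s ξ)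
    {s v : ℝ} (hs : 0 < s) (hv : 0 < v) (ξ : USphere n)
    (hfin : ∫⁻ t in Ioi v, ENNReal.ofReal ((t - v) ^ (α - 1)) * parallelLPoisson G s ξ t ≠ ∞) :
    Integrable (poissonIntegrand (onParallel F (capChart s ξ) (-v)) (direction (capChart s ξ))
      (poissonRadius (capChart s ξ) (-v))) (surf n) := by
  have hσ : 0 < s + v := by positivity
  rw [poissonRadius_capChart hs hv, onParallel_capChart F hs, direction_capChart hs]
  simp only [hF _ hσ]
  refine ((integrable_poissonK_mul_capFrac hn α hG hs hv ξ hfin).const_mul ((area n : ℂ) *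
    ((2 ^ α / Real.Gamma α * (1 + (s + v)) ^ ((n : ℝ) / 2 - α) : ℝ) : ℂ))).congr
    (Eventually.of_forall fun ζ => ?_)
  rw [poissonIntegrand_eq hn _ _ (Real.sqrt_nonneg _)]
  ring

/-- The nodes jτ of the finite difference avoid a null set for almost every τ, except that j = 0
always hits 0, so the property is required there separately. -/
theorem ae_natCast_mul {P : ℝ → Prop} (h : ∀ᵐ v ∂((volume : Measure ℝ).restrict (Ioi 0)), P v)
    (h0 : P 0) (j : ℕ) : ∀ᵐ τ ∂((volume : Measure ℝ).restrict (Ioi 0)), P (j * τ) := by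
  rcases Nat.eq_zero_or_pos j with rfl | hj
  · simpa using Eventually.of_forall fun _ => h0
  · have hj : (0 : ℝ) < j := by exact_mod_cast hj
    rw [ae_restrict_iff' measurableSet_Ioi] at h ⊢
    have hq : Measure.QuasiMeasurePreserving (fun τ : ℝ => (j : ℝ) * τ) := by
      refine ⟨by fun_prop, ?_⟩
      rw [Real.map_volume_mul_left hj.ne']
      exact Measure.smul_absolutelyContinuous
    filter_upwards [hq.ae h] with τ hτ h1
    exact hτ (mul_pos hj h1)

/-- The values of the function `A_x^- f` at a point where all the integrals converge. -/
theorem hyperIntegrand_ae_eq (hn : 0 < n) {α : ℝ} (hα : 0 < α) (l : ℕ) {G : ℝ × USphere n → ℂ}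
    (hG : Measurable G) {F : USphere (n + 1) → ℂ} (hF : ∀ s > 0, ∀ ξ, F (capChart s ξ) =
      ((2 ^ α / Real.Gamma α * (1 + s) ^ ((n : ℝ) / 2 - α) : ℝ) : ℂ) * capFrac α G s ξ)
    {s : ℝ} (hs : 0 < s) (ξ : USphere n)
    (h0 : ∫⁻ t in Ioi (0 : ℝ), ENNReal.ofReal ((t - 0) ^ (α - 1)) * parallelLPoisson G s ξ t ≠ ∞)
    (hv : ∀ᵐ v ∂((volume : Measure ℝ).restrict (Ioi 0)),
      ∫⁻ t in Ioi v, ENNReal.ofReal ((t - v) ^ (α - 1)) * parallelLPoisson G s ξ t ≠ ∞) :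
    hyperIntegrand α l F (capChart s ξ) =ᵐ[(volume : Measure ℝ).restrict (Ioi 0)] fun τ =>
      ((2 ^ α : ℝ) : ℂ) * ((∑ j ∈ Finset.range (l + 1), (l.choose j : ℂ) * (-1) ^ j *
        rlInt α (parallelPoisson G s ξ) (j * τ)) / ((τ ^ (1 + α) : ℝ) : ℂ)) := by
  have h := ae_all_iff.2 fun j => ae_natCast_mul hv h0 j
  filter_upwards [h, ae_restrict_mem measurableSet_Ioi] with τ hτ hτ0
  have hτ0 : 0 < τ := hτ0
  rw [hyperIntegrand, finDiff, ← mul_div_assoc, Finset.mul_sum]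
  congr 1
  refine Finset.sum_congr rfl fun j _ => ?_
  rw [zero_sub, aMinus_capChart hn hα hG hF hs (by positivity) ξ (hτ j)]
  ring

theorem integrableOn_rpow_mul_parallelPoisson (hn : 0 < n) (α : ℝ) {G : ℝ × USphere n → ℂ}
    (hG : Measurable G) {s : ℝ} (hs : 0 < s) (ξ : USphere n)
    (h0 : ∫⁻ t in Ioi (0 : ℝ), ENNReal.ofReal (t ^ (α - 1)) * parallelLPoisson G s ξ t ≠ ∞) :
    IntegrableOn (fun t => ((t ^ (α - 1) : ℝ) : ℂ) * parallelPoisson G s ξ t) (Ioi 0) := by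
  have hm := measurable_parallelPoisson hG s ξ
  refine ⟨Measurable.aestronglyMeasurable (by fun_prop), ?_⟩
  rw [hasFiniteIntegral_iff_enorm]
  refine lt_of_le_of_lt (setLIntegral_mono' measurableSet_Ioi fun t ht => ?_)
    (lt_top_iff_ne_top.2 h0)
  have ht : 0 < t := ht
  rw [enorm_mul, ← ofReal_norm, Complex.norm_real, Real.norm_of_nonneg (by positivity)]
  gcongr
  exact enorm_parallelPoisson_le hn G hs ξ ht

/-- The inversion of the fractional integral at a point where all the integrals converge. -/
theorem inversion_at_capChart (hn : 0 < n) {α : ℝ} (hα : 0 < α) {l : ℕ} (hl : α < l) {b : ℝ}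
    (hb : b < 1) {φ : segS n (-1) b → ℂ} {f : USphere (n + 1) → ℂ} (hfm : Measurable f)
    (hf : ∀ x, x ∉ segS n (-1) b → f x = 0) (hφ : extendZero φ =ᵐ[surf (n + 1)] f) {s : ℝ}
    (hs : 0 < s) (ξ : USphere n)
    (hfin : ∀ β : ℝ, β = α ∨ β = 1 → ∫⁻ t in Ioi (0 : ℝ), ENNReal.ofReal (t ^ (β - 1)) *
      parallelLPoisson (capPull α b f) s ξ t ≠ ∞)
    (hlim : Tendsto (fun ε => ∫ y in Ioi (0 : ℝ), (avgKernel α l y : ℂ) *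
      parallelPoisson (capPull α b f) s ξ (ε * y)) (𝓝[>] 0)
      (𝓝 ((kappa α l : ℂ) * capPull α b f (s, ξ))))
    (x : segS n (-1) b) (hx : x.1 = capChart s ξ) :
    IntegrableOn (rightIntegrand α φ x) (above x) (segMeasure n (-1) b) ∧
      (∀ᵐ u ∂(volume.restrict (Iio (0 : ℝ))),
        Integrable (poissonIntegrand (onParallel (extendZero (fracRight α φ)) x.1 u)
          (direction x.1) (poissonRadius x.1 u)) (surf n)) ∧
      (∀ ε : ℝ, 0 < ε → IntegrableOn (hyperIntegrand α l (extendZero (fracRight α φ)) x.1) (Ioi ε)) ∧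
      Tendsto (fun ε : ℝ => truncTSeg α l ε (fracRight α φ) x) (𝓝[>] 0) (𝓝 (f x.1)) := by
  set G := capPull α b f with hGdef
  have hG : Measurable G := measurable_capPull α b hfm
  have hF : ∀ s > 0, ∀ ξ, extendZero (fracRight α φ) (capChart s ξ) =
      ((2 ^ α / Real.Gamma α * (1 + s) ^ ((n : ℝ) / 2 - α) : ℝ) : ℂ) * capFrac α G s ξ :=
    fun s hs ξ => extendZero_fracRight_capChart hn hα hb hfm hf hφ hs ξ
  have hα0 := hfin α (Or.inl rfl)
  have h0 : ∫⁻ t in Ioi (0 : ℝ), ENNReal.ofReal ((t - 0) ^ (α - 1)) * parallelLPoisson G s ξ t ≠ ∞ := by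
    simpa only [sub_zero] using hα0
  have hv : ∀ᵐ v ∂((volume : Measure ℝ).restrict (Ioi 0)),
      ∫⁻ t in Ioi v, ENNReal.ofReal ((t - v) ^ (α - 1)) * parallelLPoisson G s ξ t ≠ ∞ := by
    refine ae_lintegral_sub_rpow_ne_top hα (measurable_parallelLPoisson hG s ξ)
      (B := (1 + b) / (1 - b)) (fun t ht => ?_) ?_
    · have : ∀ η, G (s + t, η) = 0 := fun η => capPull_of_notMem α b f _ fun h => by
        have := h.2
        simp only at this
        linarith
      simp [parallelLPoisson, lPoisson, this]
    -- The case β = 1: plain integrability gives convergence of the fractional integral at almost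
    -- every v.
    · simpa using hfin 1 (Or.inr rfl)
  have hhyp := hyperIntegrand_ae_eq hn hα l hG hF hs ξ h0 hv
  have hmar := fun ε (hε : 0 < ε) => truncated_marchaud hα hε l (measurable_parallelPoisson hG s ξ)
    (integrableOn_rpow_mul_parallelPoisson hn α hG hs ξ hα0)
  have hres : ∀ ε : ℝ, 0 < ε → hyperIntegrand α l (extendZero (fracRight α φ)) (capChart s ξ)
      =ᵐ[(volume : Measure ℝ).restrict (Ioi ε)] fun τ =>
      ((2 ^ α : ℝ) : ℂ) * ((∑ j ∈ Finset.range (l + 1), (l.choose j : ℂ) * (-1) ^ j *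
        rlInt α (parallelPoisson G s ξ) (j * τ)) / ((τ ^ (1 + α) : ℝ) : ℂ)) := fun ε hε =>
    ae_mono (Measure.restrict_mono (Ioi_subset_Ioi hε.le) le_rfl) hhyp
  refine ⟨?_, ?_, fun ε hε => ?_, ?_⟩
  · rw [integrableOn_rightIntegrand_iff, hx]
    refine Integrable.congr ?_ (sphereIntegrand_congr_ae α hφ _).symm
    refine integrable_sphereIntegrand hn α hb hfm hf hs ξ ?_
    have := integrable_capIntegrand hn α hG hs le_rfl ξ h0
    rwa [add_zero] at this
  · rw [ae_restrict_iff' measurableSet_Ioi] at hv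
    rw [ae_restrict_iff' measurableSet_Iio, hx]
    filter_upwards [(Measure.measurePreserving_neg (volume : Measure ℝ)).quasiMeasurePreserving.ae
      hv] with u hu hu0
    have hu0 : 0 < -u := neg_pos.2 hu0
    have := integrable_poissonIntegrand_capChart hn hG hF hs hu0 ξ (hu hu0)
    rwa [neg_neg] at this
  · rw [hx]
    exact ((hmar ε hε).1.const_mul ((2 ^ α : ℝ) : ℂ)).congr (hres ε hε).symm
  · have hκ := (kappa_pos hα hl).ne'
    have he : ∀ ε : ℝ, 0 < ε → truncTSeg α l ε (fracRight α φ) x =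
        ((2 ^ (-α) / kappa α l * (1 + s) ^ (α + (n : ℝ) / 2) * 2 ^ α : ℝ) : ℂ) *
          ∫ y in Ioi (0 : ℝ), (avgKernel α l y : ℂ) * parallelPoisson G s ξ (ε * y) := fun ε hε => by
      rw [truncTSeg, restr, hx, truncT, tanSq_capChart hs.le, integral_congr_ae (hres ε hε),
        integral_const_mul, (hmar ε hε).2]
      push_cast
      ring
    have hmem : capChart s ξ ∈ segS n (-1) b := hx ▸ x.2
    have hlim' := hlim.const_mul
      ((2 ^ (-α) / kappa α l * (1 + s) ^ (α + (n : ℝ) / 2) * 2 ^ α : ℝ) : ℂ)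
    -- The normalization cancels the mass κ and the factor 2^α, while (1+s)^(α+n/2) undoes the
    -- weight built into `capPull`.
    have hval : ((2 ^ (-α) / kappa α l * (1 + s) ^ (α + (n : ℝ) / 2) * 2 ^ α : ℝ) : ℂ) *
        ((kappa α l : ℂ) * G (s, ξ)) = f x.1 := by
      rw [hx, hGdef, capPull_eq α hb hf (show 0 < (s, ξ).1 from hs), ← mul_assoc, ← mul_assoc,
        ← Complex.ofReal_mul, ← Complex.ofReal_mul]
      have : 2 ^ (-α) / kappa α l * (1 + s) ^ (α + (n : ℝ) / 2) * 2 ^ α * kappa α l *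
          (1 + s) ^ (-(α + (n : ℝ) / 2)) = 1 := by
        rw [Real.rpow_neg two_pos.le, Real.rpow_neg (by positivity)]
        have h1 : (2 : ℝ) ^ α ≠ 0 := by positivity
        have h2 : (1 + s) ^ (α + (n : ℝ) / 2) ≠ 0 := by positivity
        field_simp
      simp only [this, Complex.ofReal_one, one_mul]
    rw [hval] at hlim'
    refine hlim'.congr' ?_
    filter_upwards [self_mem_nhdsWithin] with ε hε
    exact (he ε hε).symm

end


/-! ### Weighted functions on the cap -/

section
variable {n : ℕ}

theorem measurable_extendZero {a b : ℝ} {f : segS n a b → ℂ} (hf : Measurable f) :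
    Measurable (extendZero f) := by
  have e : extendZero f = Function.extend Subtype.val f 0 := by
    funext x
    by_cases hx : x ∈ segS n a b
    · rw [extendZero_val f ⟨x, hx⟩]
      exact (Subtype.val_injective.extend_apply f 0 ⟨x, hx⟩).symm
    · rw [extendZero_of_notMem f hx, Function.extend_apply' _ _ _ fun ⟨y, hy⟩ => hx (hy ▸ y.2)]
      rfl
  rw [e]
  exact (MeasurableEmbedding.subtype_coe (measurableSet_segS a b)).measurable_extend hf
    measurable_const

theorem extendZero_congr_ae {a b : ℝ} {f g : segS n a b → ℂ} (h : f =ᵐ[segMeasure n a b] g) :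
    extendZero f =ᵐ[surf (n + 1)] extendZero g := by
  have h1 : ∀ᵐ x ∂((surf (n + 1)).restrict (segS n a b)), extendZero f x = extendZero g x := by
    rw [← segMeasure_map, (MeasurableEmbedding.subtype_coe (measurableSet_segS a b)).ae_map_iff]
    filter_upwards [h] with x hx
    rw [extendZero_val, extendZero_val, hx]
  rw [ae_restrict_iff' (measurableSet_segS a b)] at h1
  filter_upwards [h1] with x hx
  by_cases hm : x ∈ segS n a b
  · exact hx hm
  · rw [extendZero_of_notMem f hm, extendZero_of_notMem g hm]

instance isFiniteMeasure_segMeasure (a b : ℝ) : IsFiniteMeasure (segMeasure n a b) := by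
  refine ⟨?_⟩
  have h := Measure.map_apply (μ := segMeasure n a b) measurable_subtype_coe MeasurableSet.univ
  rw [segMeasure_map, preimage_univ] at h
  rw [← h]
  exact measure_lt_top _ _

/-- An almost everywhere statement on the cap in polar coordinates. -/
theorem ae_segMeasure_of_ae_capChart (hn : 0 < n) {a b : ℝ} {P : segS n a b → Prop}
    (h : ∀ᵐ q ∂(((volume : Measure ℝ).restrict (Ioi 0)).prod (surf n)),
      ∀ x : segS n a b, x.1 = capChart q.1 q.2 → P x) : ∀ᵐ x ∂(segMeasure n a b), P x := by
  have h1 : ∀ᵐ y ∂((surf (n + 1)).restrict (segS n a b)), ∀ x : segS n a b, x.1 = y → P x :=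
    ae_restrict_of_ae (ae_surf_of_ae_capChart hn (P := fun y => ∀ x : segS n a b, x.1 = y → P x) h)
  rw [← segMeasure_map, (MeasurableEmbedding.subtype_coe (measurableSet_segS a b)).ae_map_iff] at h1
  filter_upwards [h1] with x hx using hx x rfl

theorem lintegral_capMeasure_weighted_ne_top (hn : 0 < n) {b : ℝ} {r μ : ℝ} (hr : 0 < r)
    {φ : segS n (-1) b → ℂ} (hφ : Measurable φ)
    (hfin : ∫⁻ x, ‖((1 + lastCoord x.1) ^ μ : ℝ) * φ x‖ₑ ^ r ∂(segMeasure n (-1) b) ≠ ∞) :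
    ∫⁻ q : ℝ × USphere n, ENNReal.ofReal (capWeight n q.1) *
      ‖((1 + lastCoord (capChart q.1 q.2)) ^ μ : ℝ) * extendZero φ (capChart q.1 q.2)‖ₑ ^ r
      ∂(((volume : Measure ℝ).restrict (Ioi 0)).prod (surf n)) ≠ ∞ := by
  have hl := measurable_lastCoord (n := n)
  have hφm := measurable_extendZero hφ
  set W : USphere (n + 1) → ℝ≥0∞ := fun y =>
    ‖((1 + lastCoord y) ^ μ : ℝ) * extendZero φ y‖ₑ ^ r with hW
  have hWm : Measurable W := by fun_prop
  have e1 : ∫⁻ x, ‖((1 + lastCoord x.1) ^ μ : ℝ) * φ x‖ₑ ^ r ∂(segMeasure n (-1) b) =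
      ∫⁻ y, W y ∂(surf (n + 1)) := by
    have hs : Function.support W ⊆ segS n (-1) b := fun y hy => by
      by_contra hc
      exact hy (by simp [hW, extendZero_of_notMem φ hc, hr])
    rw [← setLIntegral_eq_of_support_subset hs, ← segMeasure_map,
      (MeasurableEmbedding.subtype_coe (measurableSet_segS (-1) b)).lintegral_map]
    simp only [hW, extendZero_val]
  rw [e1, ← (measurePreserving_capChart hn).lintegral_comp hWm, capMeasure,
    lintegral_withDensity_eq_lintegral_mul _ (by fun_prop) (by fun_prop)] at hfin
  exact hfin

/-- In the coordinate t the weight is a power of 2t/(1+t). On t0 < t < (1+b)/(1-b) it and the other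
elementary factors are continuous and positive, so their quotient `k` is bounded; beyond that range
`capPull` is zero. -/
theorem lintegral_capPull_ne_top (hn : 0 < n) {α b μ r : ℝ} (hb : b < 1) (hr : 0 < r)
    {φ : segS n (-1) b → ℂ} (hφ : Measurable φ)
    (hfin : ∫⁻ x, ‖((1 + lastCoord x.1) ^ μ : ℝ) * φ x‖ₑ ^ r ∂(segMeasure n (-1) b) ≠ ∞)
    {t0 : ℝ} (ht0 : 0 < t0) :
    ∫⁻ q in Ioi t0 ×ˢ univ, ‖capPull α b (extendZero φ) q‖ₑ ^ r
      ∂((volume : Measure ℝ).prod (surf n)) ≠ ∞ := by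
  have hl := measurable_lastCoord (n := n)
  have hφm := measurable_extendZero hφ
  have hw := lintegral_capMeasure_weighted_ne_top hn hr hφ hfin
  set B := (1 + b) / (1 - b) with hB
  set k : ℝ → ℝ := fun t => ((1 + t) ^ (-(α + (n : ℝ) / 2)) / (1 + (t - 1) / (1 + t)) ^ μ) ^ r /
    ((2 * √t / (1 + t)) ^ n / (2 * t)) with hk
  have hpos : ∀ t : ℝ, 0 < t → 0 < 1 + (t - 1) / (1 + t) := fun t ht => by
    have : 1 + (t - 1) / (1 + t) = 2 * t / (1 + t) := by field_simp; ring
    rw [this]; positivity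
  have hkc : ContinuousOn k (Icc t0 B) := by
    have hp : ∀ t ∈ Icc t0 B, 0 < t := fun t ht => ht0.trans_le ht.1
    have c1 : ContinuousOn (fun t : ℝ => 1 + t) (Icc t0 B) := by fun_prop
    have c2 : ContinuousOn (fun t : ℝ => 1 + (t - 1) / (1 + t)) (Icc t0 B) :=
      continuousOn_const.add (ContinuousOn.div (by fun_prop) c1 fun t ht => by
        have := hp t ht; positivity)
    have c3 : ContinuousOn (fun t : ℝ => (2 * √t / (1 + t)) ^ n / (2 * t)) (Icc t0 B) := by
      refine ContinuousOn.div (ContinuousOn.pow (ContinuousOn.div ?_ c1 fun t ht => by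
        have := hp t ht; positivity) n) (by fun_prop) fun t ht => by have := hp t ht; positivity
      exact Continuous.continuousOn (by fun_prop)
    refine ContinuousOn.div (ContinuousOn.rpow_const (ContinuousOn.div (c1.rpow_const fun t ht =>
      Or.inl ?_) (c2.rpow_const fun t ht => Or.inl (hpos t (hp t ht)).ne') fun t ht => ?_)
      fun t ht => Or.inr hr.le) c3 fun t ht => ?_
    · have := hp t ht; positivity
    · exact (Real.rpow_pos_of_pos (hpos t (hp t ht)) _).ne'
    · exact (capWeight_pos (n := n) (hp t ht)).ne'
  obtain ⟨C, hC⟩ := isCompact_Icc.exists_bound_of_continuousOn hkc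
  have hle : ((volume : Measure ℝ).prod (surf n)).restrict (Ioi t0 ×ˢ univ) ≤
      ((volume : Measure ℝ).restrict (Ioi 0)).prod (surf n) := by
    rw [← Measure.prod_restrict, Measure.restrict_univ]
    exact Measure.prod_mono (Measure.restrict_mono (Ioi_subset_Ioi ht0.le) le_rfl) le_rfl
  have hbound : ∀ q ∈ Ioi t0 ×ˢ (univ : Set (USphere n)), ‖capPull α b (extendZero φ) q‖ₑ ^ r ≤
      ENNReal.ofReal C * (ENNReal.ofReal (capWeight n q.1) *
      ‖((1 + lastCoord (capChart q.1 q.2)) ^ μ : ℝ) * extendZero φ (capChart q.1 q.2)‖ₑ ^ r) := by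
    rintro q ⟨hq, -⟩
    have hq : t0 < q.1 := hq
    have hq0 : 0 < q.1 := ht0.trans hq
    by_cases hqB : q.1 < B
    · have hkC : k q.1 ≤ C := (le_abs_self _).trans (hC q.1 ⟨hq.le, hqB.le⟩)
      have hcw := capWeight_pos (n := n) hq0
      have hp := hpos q.1 hq0
      refine le_trans (le_of_eq ?_) (mul_le_mul_left (ENNReal.ofReal_le_ofReal hkC) _)
      rw [capPull_eq α hb (fun x hx => extendZero_of_notMem φ hx) hq0, lastCoord_capChart hq0.le,
        enorm_mul, enorm_mul, ENNReal.mul_rpow_of_nonneg _ _ hr.le,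
        ENNReal.mul_rpow_of_nonneg _ _ hr.le, ← mul_assoc, ← mul_assoc, ← ofReal_norm,
        ← ofReal_norm (((1 + (q.1 - 1) / (1 + q.1)) ^ μ : ℝ) : ℂ), Complex.norm_real,
        Complex.norm_real, Real.norm_of_nonneg (by positivity), Real.norm_of_nonneg (by positivity),
        ENNReal.ofReal_rpow_of_nonneg (by positivity) hr.le,
        ENNReal.ofReal_rpow_of_nonneg (by positivity) hr.le]
      have hk0 : 0 ≤ k q.1 := by
        simp only [hk]
        positivity
      rw [← ENNReal.ofReal_mul hk0, ← ENNReal.ofReal_mul (by positivity)]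
      congr 2
      have : k q.1 * capWeight n q.1 = ((1 + q.1) ^ (-(α + (n : ℝ) / 2)) /
          (1 + (q.1 - 1) / (1 + q.1)) ^ μ) ^ r := div_mul_cancel₀ _ hcw.ne'
      rw [this, Real.div_rpow (by positivity) (by positivity), div_mul_cancel₀]
      positivity
    · rw [capPull_of_notMem α b _ q fun h => hqB h.2, enorm_zero, ENNReal.zero_rpow_of_pos hr]
      exact bot_le
  refine ne_top_of_le_ne_top ?_ ((setLIntegral_mono' (measurableSet_Ioi.prod MeasurableSet.univ)
    hbound).trans (lintegral_mono' hle le_rfl))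
  rw [lintegral_const_mul' _ _ (by simp)]
  exact ENNReal.mul_ne_top (by simp) hw

theorem aestronglyMeasurable_of_memWeightedLp {b μ : ℝ} {p : ℝ≥0∞} {φ : segS n (-1) b → ℂ}
    (hφ : MemWeightedLp (segMeasure n (-1) b) p (fun x => (1 + lastCoord x.1) ^ μ) φ) :
    AEStronglyMeasurable φ (segMeasure n (-1) b) := by
  have hl := measurable_lastCoord (n := n)
  have hw : Measurable fun x : segS n (-1) b => ((((1 + lastCoord x.1) ^ μ : ℝ) : ℂ))⁻¹ := by fun_prop
  refine (hw.aestronglyMeasurable.mul hφ.1).congr (Eventually.of_forall fun x => ?_)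
  have : (0 : ℝ) < (1 + lastCoord x.1) ^ μ := Real.rpow_pos_of_pos (by linarith [x.2.1]) _
  have h : (((1 + lastCoord x.1) ^ μ : ℝ) : ℂ) ≠ 0 := by exact_mod_cast this.ne'
  simp only [Pi.mul_apply]
  rw [inv_mul_cancel_left₀ h]

end

end SphFrac

/-! ### The inversion theorem -/

theorem mainTheorem11 (n : ℕ) (hn : 2 ≤ n) (α : ℝ) (hα : 0 < α) (l : ℕ) (hl : α < (l : ℝ))
    (b : ℝ) (hb : b ∈ Ioo (-1 : ℝ) 1)
    (p q : ℝ≥0∞) (hp : 1 < p) (hpq : ENNReal.HolderConjugate p q)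
    (μ : ℝ) (hμ : μ < (n : ℝ) / (2 * q.toReal))
    (φ : SphFrac.segS n (-1) b → ℂ)
    (hφ : SphFrac.MemWeightedLp (SphFrac.segMeasure n (-1) b) p
      (fun x => (1 + SphFrac.lastCoord x.1) ^ μ) φ) :
    ∀ᵐ x ∂(SphFrac.segMeasure n (-1) b),
      -- the fractional integral converges at `x`
      IntegrableOn (SphFrac.rightIntegrand α φ x) (SphFrac.above x)
        (SphFrac.segMeasure n (-1) b) ∧
      -- the Poisson integrals in the truncated hypersingular integral converge
      (∀ᵐ u ∂(volume.restrict (Iio (0 : ℝ))),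
        Integrable (SphFrac.poissonIntegrand
          (SphFrac.onParallel (SphFrac.extendZero (SphFrac.fracRight α φ)) x.1 u)
          (SphFrac.direction x.1) (SphFrac.poissonRadius x.1 u)) (SphFrac.surf n)) ∧
      -- the truncated hypersingular integrals converge
      (∀ ε : ℝ, 0 < ε →
        IntegrableOn
          (SphFrac.hyperIntegrand α l (SphFrac.extendZero (SphFrac.fracRight α φ)) x.1)
          (Ioi ε)) ∧
      -- and they tend to the value of the given function
      Tendsto (fun ε : ℝ => SphFrac.truncTSeg α l ε (SphFrac.fracRight α φ) x)
        (𝓝[>] 0) (𝓝 (φ x)) := by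
  have hn0 : 0 < n := by omega
  have hφm := SphFrac.aestronglyMeasurable_of_memWeightedLp hφ
  set φ' := hφm.mk φ with hφ'
  have hφ'm : Measurable φ' := hφm.stronglyMeasurable_mk.measurable
  have hae : φ =ᵐ[SphFrac.segMeasure n (-1) b] φ' := hφm.ae_eq_mk
  -- On a finite measure space a finite exponent r with 1 < r < p may replace p, which also covers p
  -- = ∞.
  obtain ⟨r, hr1, hrp⟩ := ENNReal.lt_iff_exists_nnreal_btwn.1 hp
  have hr : (1 : ℝ) < r := by exact_mod_cast hr1
  have hr0 : (0 : ℝ) < r := one_pos.trans hr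
  have hφr := MemLp.mono_exponent hφ hrp.le
  have hfin : ∫⁻ x, ‖((1 + SphFrac.lastCoord x.1) ^ μ : ℝ) * φ' x‖ₑ ^ (r : ℝ)
      ∂(SphFrac.segMeasure n (-1) b) ≠ ∞ := by
    have h := lintegral_rpow_enorm_lt_top_of_eLpNorm_lt_top
      (by simpa using hr0.ne') ENNReal.coe_ne_top hφr.2
    refine (lt_of_eq_of_lt (lintegral_congr_ae ?_) h).ne
    filter_upwards [hae] with x hx
    rw [hx, ENNReal.coe_toReal]
  set f := SphFrac.extendZero φ' with hf
  have hfm : Measurable f := SphFrac.measurable_extendZero hφ'm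
  have hf0 : ∀ x, x ∉ SphFrac.segS n (-1) b → f x = 0 := fun x hx =>
    SphFrac.extendZero_of_notMem φ' hx
  have hmain := SphFrac.ae_tendsto_avgKernel hn0 hα hl hr (SphFrac.measurable_capPull α b hfm)
    (SphFrac.capPull_of_notMem α b f) fun t0 ht0 =>
      SphFrac.lintegral_capPull_ne_top hn0 hb.2 hr0 hφ'm hfin ht0
  have hall : ∀ᵐ x ∂(SphFrac.segMeasure n (-1) b),
      IntegrableOn (SphFrac.rightIntegrand α φ x) (SphFrac.above x)
        (SphFrac.segMeasure n (-1) b) ∧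
      (∀ᵐ u ∂(volume.restrict (Iio (0 : ℝ))),
        Integrable (SphFrac.poissonIntegrand
          (SphFrac.onParallel (SphFrac.extendZero (SphFrac.fracRight α φ)) x.1 u)
          (SphFrac.direction x.1) (SphFrac.poissonRadius x.1 u)) (SphFrac.surf n)) ∧
      (∀ ε : ℝ, 0 < ε →
        IntegrableOn
          (SphFrac.hyperIntegrand α l (SphFrac.extendZero (SphFrac.fracRight α φ)) x.1)
          (Ioi ε)) ∧
      Tendsto (fun ε : ℝ => SphFrac.truncTSeg α l ε (SphFrac.fracRight α φ) x)
        (𝓝[>] 0) (𝓝 (f x.1)) := by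
    refine SphFrac.ae_segMeasure_of_ae_capChart hn0 ?_
    filter_upwards [hmain, SphFrac.ae_lt_fst 0] with z hz hz0 x hx
    refine SphFrac.inversion_at_capChart hn0 hα hl hb.2 hfm hf0
      (SphFrac.extendZero_congr_ae hae) hz0 z.2 (fun β hβ => ?_) hz.2 x hx
    have hG := SphFrac.measurable_capPull α b hfm
    -- The factor 2^(n+1) is the Harnack loss in bounding a Poisson integral at an arbitrary radius
    -- by the maximal function.
    refine ne_top_of_le_ne_top (ENNReal.mul_ne_top (a := 2 ^ (n + 1)) (by simp) (hz.1 β hβ)) ?_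
    rw [← lintegral_const_mul' _ _ (by simp)]
    refine setLIntegral_mono' measurableSet_Ioi fun t ht => ?_
    obtain ⟨h0, h1⟩ := SphFrac.sqrt_div_mem hz0 ht
    rw [mul_left_comm]
    gcongr
    exact SphFrac.lPoisson_le_poissonMax hn0 h0 h1 (by fun_prop) z.2
  filter_upwards [hall, hae] with x hx hx'
  rw [hf, SphFrac.extendZero_val, ← hx'] at hx
  exact hx
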